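/- Let $M$ be a compact smooth manifold of real dimension $2n$, let $\omega$ be a symplectic form and $b$ a real $d$-closed $2$-form on $M$, and put $\psi=e^{b-\sqrt{-1}\omega}$. Equip $TM\oplus T^*M$ with the pairing $\langle v+\xi,u+\eta\rangle=\tfrac12(\xi(u)+\eta(v))$ and with its action $(v+\xi)\cdot\phi=i_v\phi+\xi\wedge\phi$ on differential forms. A generalized complex structure is an orthogonal endomorphism $\mathcal J$ of $TM\oplus T^*M$ with $\mathcal J^2=-\mathrm{id}$ whose $-\sqrt{-1}$-eigenbundle $\mathcal L_{\mathcal J}\subset(TM\oplus T^*M)^{\mathbb C}$ is closed under the Courant bracket; $\mathcal J_\psi$ denotes the one with $\mathcal L_{\mathcal J_\psi}=\ker\psi=\{e: e\cdot\psi=0\}$. Let $(M,\mathcal J,\mathcal J_\psi)$ be a generalized Kähler manifold of symplectic type, that is, $\mathcal J$ is a generalized complex structure which commutes with $\mathcal J_\psi$ and $\langle-\mathcal J\mathcal J_\psi\,\cdot,\cdot\rangle$ is positive definite. Let $(E,h)$ be a smooth Hermitian complex vector bundle over $M$ and $\mathcal D:\Gamma(E)\to\Gamma(E\otimes(TM\oplus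 T^*M)^{\mathbb C})$ a generalized Hermitian connection, that is, a complex linear operator with $\mathcal D(fs)=s\otimes df+f\mathcal Ds$ and $dh(s,s')=h(\mathcal Ds,s')+h(s,\mathcal Ds')$. Write $\mathcal D=D^A+V$ with an ordinary connection $D^A$ of curvature $F_A$ and $V\in\Gamma(\mathrm{End}(E)\otimes TM)$, and write $\mathcal D=\mathcal D^{1,0}+\mathcal D^{0,1}$ according to $(TM\oplus T^*M)^{\mathbb C}=\mathcal L_{\mathcal J}\oplus\overline{\mathcal L}_{\mathcal J}$. The curvature of $\mathcal D$ is $$\mathcal F_{\mathcal A}(\psi)=F_A\cdot\psi+d^A(V\cdot\psi)+\tfrac12[V\cdot V]\cdot\psi\ \in\ \Gamma\big(\mathrm{End}(E)\otimes(U^{-n}\oplus U^{-n+2})\big),$$ where $[(A\otimes v)\cdot(B\otimes w)]=[A,B]\otimes v\cdot w$ with the Clifford product $v\cdot w$, $U^{-n}=\mathbb C\psi$ and $U^{-n+2}=\wedge^2\overline{\mathcal L}_{\mathcal J_\psi}\cdot\psi$. The mean curvature $\mathcal K_{\mathcal A}(\psi)$ is the $h$-Hermitian part of the endomorphism $k$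 of $E$ for which $k\otimes\psi$ is the component of $\mathcal F_{\mathcal A}(\psi)$ in $\mathrm{End}(E)\otimes U^{-n}$. Assume that $\mathcal D^{0,1}\circ\mathcal D^{0,1}=0$ (for the extension of $\mathcal D^{0,1}$ to $E\otimes\wedge^\bullet\overline{\mathcal L}_{\mathcal J}$ by the Lie algebroid differential of $\mathcal L_{\mathcal J}$) and that, for a real constant $\lambda$, the Einstein–Hermitian condition $\mathcal K_{\mathcal A}(\psi)=\lambda\,\mathrm{id}_E$ holds. If $\lambda<0$, then every smooth section $s$ of $E$ with $\mathcal D^{0,1}s=0$ is zero. If $\lambda=0$, then every smooth section $s$ of $E$ with $\mathcal D^{0,1}s=0$ is parallel, that is, $\mathcal Ds=0$. -/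

import Mathlib

open scoped Manifold ContDiff TensorProduct Bundle

noncomputable section

namespace GenKahler

/-! ### Mixed forms on a real vector space, with coefficients in a complex vector space -/

section Forms

variable {T : Type*} [AddCommGroup T] [Module ℝ T]
variable {W : Type*} [AddCommGroup W] [Module ℂ W]

/-- Mixed forms `⨁_p W ⊗ ⋀^p T*` with coefficients in a complex vector space `W`
(`T` will have finite dimension, so only finitely many degrees are nonzero). -/
abbrev MixedForm (T W : Type*) [AddCommGroup T] [Module ℝ T] [AddCommGroup W] [Module ℂ W] :
    Type _ :=
  (p : ℕ) → T [⋀^Fin p]→ₗ[ℝ] W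

/-- `A ⊗ α` for `A ∈ W` and a complex form `α`. -/
def tensForm (A : W) {p : ℕ} (α : T [⋀^Fin p]→ₗ[ℝ] ℂ) : T [⋀^Fin p]→ₗ[ℝ] W :=
  ((LinearMap.toSpanSingleton ℂ W A).restrictScalars ℝ).compAlternatingMap α

@[simp] theorem tensForm_apply (A : W) {p : ℕ} (α : T [⋀^Fin p]→ₗ[ℝ] ℂ) (v : Fin p → T) :
    tensForm A α v = α v • A := rfl

/-- `A ⊗ φ` for `A ∈ W` and a complex mixed form `φ`. -/
def tensMixed (A : W) (φ : MixedForm T ℂ) : MixedForm T W := fun p => tensForm A (φ p)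

/-- The wedge product `θ ∧ α` of a `W`-valued `1`-form and a complex `p`-form,
`(θ ∧ α)(v₀, …, v_p) = ∑ i, (-1)^i α(v₀, …, v̂ᵢ, …, v_p) θ(vᵢ)`. -/
def wedgeOne (θ : T →ₗ[ℝ] W) {p : ℕ} (α : T [⋀^Fin p]→ₗ[ℝ] ℂ) : T [⋀^Fin (p + 1)]→ₗ[ℝ] W :=
  AlternatingMap.alternatizeUncurryFin
    { toFun := fun u => tensForm (θ u) α
      map_add' := fun u v => by ext w; simp
      map_smul' := fun r u => by
        ext w
        simp only [tensForm_apply, map_smul, AlternatingMap.smul_apply, RingHom.id_apply]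
        exact smul_comm _ _ _ }

theorem wedgeOne_apply (θ : T →ₗ[ℝ] W) {p : ℕ} (α : T [⋀^Fin p]→ₗ[ℝ] ℂ)
    (v : Fin (p + 1) → T) :
    wedgeOne θ α v = ∑ i : Fin (p + 1), (-1 : ℤ) ^ (i : ℕ) • α (i.removeNth v) • θ (v i) := by
  simp [wedgeOne, AlternatingMap.alternatizeUncurryFin_apply]

theorem wedgeOne_add (θ θ' : T →ₗ[ℝ] W) {p : ℕ} (α : T [⋀^Fin p]→ₗ[ℝ] ℂ) :
    wedgeOne (θ + θ') α = wedgeOne θ α + wedgeOne θ' α := by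
  ext v; simp [wedgeOne_apply, Finset.sum_add_distrib]

theorem wedgeOne_smul (r : ℝ) (θ : T →ₗ[ℝ] W) {p : ℕ} (α : T [⋀^Fin p]→ₗ[ℝ] ℂ) :
    wedgeOne (r • θ) α = r • wedgeOne θ α := by
  ext v
  simp only [wedgeOne_apply, LinearMap.smul_apply, AlternatingMap.smul_apply, Finset.smul_sum]
  refine Finset.sum_congr rfl fun i _ => ?_
  rw [smul_comm r, smul_comm r]

/-- The `W`-valued `1`-form `i_u B = B(u, ·)`. -/
def slot (B : T [⋀^Fin 2]→ₗ[ℝ] W) (u : T) : T →ₗ[ℝ] W where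
  toFun w := B ![u, w]
  map_add' w w' := by
    have h (z : T) : Function.update ![u, 0] (1 : Fin 2) z = ![u, z] := by
      funext i; fin_cases i <;> simp
    have := B.map_update_add ![u, 0] 1 w w'
    rwa [h, h, h] at this
  map_smul' r w := by
    have h (z : T) : Function.update ![u, 0] (1 : Fin 2) z = ![u, z] := by
      funext i; fin_cases i <;> simp
    have := B.map_update_smul ![u, 0] 1 r w
    rwa [h, h] at this

@[simp] theorem slot_apply (B : T [⋀^Fin 2]→ₗ[ℝ] W) (u w : T) : slot B u w = B ![u, w] := rfl

theorem slot_add (B : T [⋀^Fin 2]→ₗ[ℝ] W) (u u' : T) : slot B (u + u') = slot B u + slot B u' := by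
  ext w
  exact congrArg (fun f => f ![w]) (B.curryLeft.map_add u u')

theorem slot_smul (B : T [⋀^Fin 2]→ₗ[ℝ] W) (r : ℝ) (u : T) : slot B (r • u) = r • slot B u := by
  ext w
  exact congrArg (fun f => f ![w]) (B.curryLeft.map_smul r u)

/-- The wedge product `B ∧ α` of a `W`-valued `2`-form and a complex `p`-form: if
`B = (1/2) ∑ B(eᵢ, eⱼ) eⁱ ∧ eʲ`, then `B ∧ α = (1/2) ∑ eⁱ ∧ (B(eᵢ, ·) ∧ α)`. -/
def wedgeTwo (B : T [⋀^Fin 2]→ₗ[ℝ] W) {p : ℕ} (α : T [⋀^Fin p]→ₗ[ℝ] ℂ) :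
    T [⋀^Fin (p + 2)]→ₗ[ℝ] W :=
  (1 / 2 : ℝ) • AlternatingMap.alternatizeUncurryFin
    { toFun := fun u => wedgeOne (slot B u) α
      map_add' := fun u v => by rw [slot_add, wedgeOne_add]
      map_smul' := fun r u => by rw [slot_smul, wedgeOne_smul]; rfl }

/-- `B ∧ φ` for a `W`-valued `2`-form `B` and a complex mixed form `φ`. -/
def wedgeTwoMixed (B : T [⋀^Fin 2]→ₗ[ℝ] W) (φ : MixedForm T ℂ) : MixedForm T W
  | 0 => 0
  | 1 => 0
  | p + 2 => wedgeTwo B (φ p)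

/-- The exponential `e^β = ∑ k, β^k / k!` of a complex `2`-form. The component of degree `2k` is
`β^k / k!`, and `β^(k+1) / (k+1)! = (1 / (k+1)) β ∧ (β^k / k!)`. -/
def expForm (β : T [⋀^Fin 2]→ₗ[ℝ] ℂ) : MixedForm T ℂ
  | 0 => AlternatingMap.constOfIsEmpty ℝ T (Fin 0) 1
  | 1 => 0
  | p + 2 => (2 / (p + 2 : ℂ)) • wedgeTwo β (expForm β p)

/-- Complex conjugation of mixed forms. -/
def conjForm (φ : MixedForm T ℂ) : MixedForm T ℂ :=
  fun p => Complex.conjAe.toLinearMap.compAlternatingMap (φ p)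

/-- The interior product `i_v φ`. -/
def interior (v : T) (φ : MixedForm T ℂ) : MixedForm T ℂ := fun p => (φ (p + 1)).curryLeft v

theorem interior_apply (v : T) (φ : MixedForm T ℂ) (p : ℕ) (w : Fin p → T) :
    interior v φ p w = φ (p + 1) (Matrix.vecCons v w) := rfl

theorem interior_add_left (u v : T) (φ : MixedForm T ℂ) :
    interior (u + v) φ = interior u φ + interior v φ := by
  funext p; exact (φ (p + 1)).curryLeft.map_add u v

theorem interior_smul_left (r : ℝ) (v : T) (φ : MixedForm T ℂ) :
    interior (r • v) φ = r • interior v φ := by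
  funext p; exact (φ (p + 1)).curryLeft.map_smul r v

theorem interior_add_right (v : T) (φ χ : MixedForm T ℂ) :
    interior v (φ + χ) = interior v φ + interior v χ := rfl

theorem interior_smul_right (r : ℝ) (v : T) (φ : MixedForm T ℂ) :
    interior v (r • φ) = r • interior v φ := rfl

theorem tensMixed_add_left (A B : W) (φ : MixedForm T ℂ) :
    tensMixed (A + B) φ = tensMixed A φ + tensMixed B φ := by
  funext p; ext v; simp [tensMixed]

theorem tensMixed_smul_left (r : ℝ) (A : W) (φ : MixedForm T ℂ) :
    tensMixed (r • A) φ = r • tensMixed A φ := by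
  funext p; ext v; exact smul_comm _ _ _

theorem tensMixed_add_right (A : W) (φ χ : MixedForm T ℂ) :
    tensMixed A (φ + χ) = tensMixed A φ + tensMixed A χ := by
  funext p; ext v; simp [tensMixed, add_smul]

theorem tensMixed_smul_right (r : ℝ) (A : W) (φ : MixedForm T ℂ) :
    tensMixed A (r • φ) = r • tensMixed A φ := by
  funext p; ext v; simp [tensMixed, mul_smul]

/-- The action on `φ` of a vector with coefficients in `W`: `(A ⊗ v) · φ = A ⊗ i_v φ`. -/
def vecAct (φ : MixedForm T ℂ) : W ⊗[ℝ] T →ₗ[ℝ] MixedForm T W :=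
  TensorProduct.lift (LinearMap.mk₂ ℝ (fun (A : W) (v : T) => tensMixed A (interior v φ))
    (fun A B v => tensMixed_add_left A B _)
    (fun r A v => tensMixed_smul_left r A _)
    (fun A u v => by rw [interior_add_left, tensMixed_add_right])
    (fun r A v => by rw [interior_smul_left, tensMixed_smul_right]))

/-- The linear map `B ⊗ w ↦ [A, B] ⊗ i_v i_w φ`. -/
def bracketActAux {S : Type*} [AddCommGroup S] [Module ℂ S] (φ : MixedForm T ℂ)
    (A : Module.End ℂ S) (v : T) : Module.End ℂ S ⊗[ℝ] T →ₗ[ℝ] MixedForm T (Module.End ℂ S) :=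
  TensorProduct.lift (LinearMap.mk₂ ℝ
    (fun (B : Module.End ℂ S) (w : T) => tensMixed (A * B - B * A) (interior v (interior w φ)))
    (fun B B' w => by rw [← tensMixed_add_left]; congr 1; noncomm_ring)
    (fun r B w => by
      rw [← tensMixed_smul_left, smul_sub, mul_smul_comm, smul_mul_assoc])
    (fun B w w' => by rw [interior_add_left, interior_add_right, tensMixed_add_right])
    (fun r B w => by rw [interior_smul_left, interior_smul_right, tensMixed_smul_right]))

theorem bracketActAux_tmul {S : Type*} [AddCommGroup S] [Module ℂ S] (φ : MixedForm T ℂ)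
    (A B : Module.End ℂ S) (v w : T) :
    bracketActAux φ A v (B ⊗ₜ[ℝ] w) = tensMixed (A * B - B * A) (interior v (interior w φ)) := rfl

/-- The action `[V · V'] · φ` with `[(A ⊗ v) · (B ⊗ w)] = [A, B] ⊗ v · w`, where the product of
`v` and `w` is the Clifford product, so that `v · w` acts on forms by `i_v i_w`. -/
def bracketAct {S : Type*} [AddCommGroup S] [Module ℂ S] (φ : MixedForm T ℂ)
    (V V' : Module.End ℂ S ⊗[ℝ] T) : MixedForm T (Module.End ℂ S) :=
  TensorProduct.lift (LinearMap.mk₂ ℝ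
    (fun (A : Module.End ℂ S) (v : T) => bracketActAux φ A v V')
    (fun A A' v => by
      induction V' using TensorProduct.induction_on with
      | zero => simp
      | tmul B w =>
        simp only [bracketActAux_tmul]
        rw [← tensMixed_add_left]; congr 1; noncomm_ring
      | add x y hx hy => simp only [map_add, hx, hy]; abel)
    (fun r A v => by
      induction V' using TensorProduct.induction_on with
      | zero => simp
      | tmul B w =>
        simp only [bracketActAux_tmul]
        rw [← tensMixed_smul_left, smul_sub, mul_smul_comm, smul_mul_assoc]
      | add x y hx hy => simp only [map_add, hx, hy, smul_add])
    (fun A u v => by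
      induction V' using TensorProduct.induction_on with
      | zero => simp
      | tmul B w =>
        simp only [bracketActAux_tmul]
        rw [interior_add_left, tensMixed_add_right]
      | add x y hx hy => simp only [map_add, hx, hy]; abel)
    (fun r A v => by
      induction V' using TensorProduct.induction_on with
      | zero => simp
      | tmul B w =>
        simp only [bracketActAux_tmul]
        rw [interior_smul_left, tensMixed_smul_right]
      | add x y hx hy => simp only [map_add, hx, hy, smul_add])) V

end Forms

/-! ### The space `T ⊕ T*`, its pairing and its action on mixed forms -/

section GenTangent

variable {T : Type*} [AddCommGroup T] [Module ℝ T] [TopologicalSpace T]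
variable {W : Type*} [AddCommGroup W] [Module ℂ W]

/-- The generalized tangent space `T ⊕ T*`. -/
abbrev GenTangent (T : Type*) [AddCommGroup T] [Module ℝ T] [TopologicalSpace T] : Type _ :=
  T × (T →L[ℝ] ℝ)

/-- The neutral pairing `⟨v + ξ, u + η⟩ = (ξ(u) + η(v)) / 2`. -/
def pairing (a b : GenTangent T) : ℝ := (1 / 2) * (a.2 b.1 + b.2 a.1)

/-- The functional `b ↦ 2⟨a, b⟩`: a vector `a = v` reads off the value on `v` of the cotangent
part of `b`, a covector `a = ξ` the value of `ξ` on the tangent part of `b`. -/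
def flat (a : GenTangent T) : GenTangent T →ₗ[ℝ] ℝ where
  toFun b := 2 * pairing a b
  map_add' b c := by simp only [pairing, Prod.fst_add, Prod.snd_add, map_add,
    _root_.add_apply]; ring
  map_smul' r b := by simp only [pairing, Prod.smul_fst, Prod.smul_snd, map_smul,
    _root_.smul_apply, smul_eq_mul, RingHom.id_apply]; ring

/-- Contraction of an element of `W ⊗ (T ⊕ T*)` with `a ∈ T ⊕ T*`: `w ⊗ b ↦ 2⟨a, b⟩ w`. -/
def contract (a : GenTangent T) : W ⊗[ℝ] GenTangent T →ₗ[ℝ] W :=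
  (TensorProduct.rid ℝ W).toLinearMap ∘ₗ LinearMap.lTensor W (flat a)

/-- Contraction with the complex element `a + √-1 a'`, complex linear in that element. -/
def contractC (a a' : GenTangent T) (t : W ⊗[ℝ] GenTangent T) : W :=
  contract a t + Complex.I • contract a' t

/-- The element `a + √-1 a'` of the complexification `(T ⊕ T*)^ℂ`. -/
def cpx (a a' : GenTangent T) : ℂ ⊗[ℝ] GenTangent T :=
  (1 : ℂ) ⊗ₜ[ℝ] a + Complex.I ⊗ₜ[ℝ] a'

/-- The `-√-1`-eigenspace `L_J` of `J` in `(T ⊕ T*)^ℂ`. -/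
def eigL (J : GenTangent T →ₗ[ℝ] GenTangent T) : Submodule ℂ (ℂ ⊗[ℝ] GenTangent T) :=
  Module.End.eigenspace (J.baseChange ℂ) (-Complex.I)

/-- The `√-1`-eigenspace of `J` in `(T ⊕ T*)^ℂ`, the complex conjugate of `L_J`. -/
def eigLbar (J : GenTangent T →ₗ[ℝ] GenTangent T) : Submodule ℂ (ℂ ⊗[ℝ] GenTangent T) :=
  Module.End.eigenspace (J.baseChange ℂ) Complex.I

/-- The component in `W ⊗ L̄_J` of an element of `W ⊗_ℝ (T ⊕ T*) = W ⊗_ℂ (T ⊕ T*)^ℂ`.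
The projection of `(T ⊕ T*)^ℂ` to `L̄_J` along `L_J` is `(1 - √-1 J) / 2`. -/
def proj01 (J : GenTangent T →ₗ[ℝ] GenTangent T) (t : W ⊗[ℝ] GenTangent T) :
    W ⊗[ℝ] GenTangent T :=
  (1 / 2 : ℂ) • (t - Complex.I • LinearMap.lTensor W J t)

/-- `ξ ∧ φ` for a real covector `ξ`. -/
def wedgeCovector (ξ : T →L[ℝ] ℝ) (φ : MixedForm T ℂ) : MixedForm T ℂ
  | 0 => 0
  | p + 1 => wedgeOne (Complex.ofRealCLM.toLinearMap ∘ₗ ξ.toLinearMap) (φ p)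

/-- The spin representation `(v + ξ) · φ = i_v φ + ξ ∧ φ`, as a function of `v + ξ ∈ T ⊕ T*`. -/
def spinAct (φ : MixedForm T ℂ) : GenTangent T →ₗ[ℝ] MixedForm T ℂ where
  toFun a := interior a.1 φ + wedgeCovector a.2 φ
  map_add' a b := by
    have h : wedgeCovector (a + b).2 φ = wedgeCovector a.2 φ + wedgeCovector b.2 φ := by
      funext p
      cases p with
      | zero => simp [wedgeCovector]
      | succ p =>
        simp only [wedgeCovector, Pi.add_apply]
        rw [← wedgeOne_add]; congr 1; ext v; simp
    rw [h, Prod.fst_add, interior_add_left]; abel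
  map_smul' r a := by
    have h : wedgeCovector (r • a).2 φ = r • wedgeCovector a.2 φ := by
      funext p
      cases p with
      | zero => simp [wedgeCovector]
      | succ p =>
        simp only [wedgeCovector, Pi.smul_apply]
        rw [← wedgeOne_smul]; congr 1; ext v; simp
    rw [h, Prod.smul_fst, interior_smul_left, RingHom.id_apply, smul_add]

/-- The action of `(T ⊕ T*)^ℂ` on `φ`. -/
def spinActC (φ : MixedForm T ℂ) : ℂ ⊗[ℝ] GenTangent T →ₗ[ℂ] MixedForm T ℂ :=
  LinearMap.liftBaseChange ℂ (spinAct φ)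

/-- `ker φ = {e ∈ (T ⊕ T*)^ℂ | e · φ = 0}`. -/
def annihilator (φ : MixedForm T ℂ) : Submodule ℂ (ℂ ⊗[ℝ] GenTangent T) :=
  LinearMap.ker (spinActC φ)

/-- The space `W ⊗ U^{-n+2}`, where `U^{-n+2} = ⋀² L̄_ψ · ψ` is spanned by the `e₁ · e₂ · ψ` with
`e₁`, `e₂` in `L̄_ψ`, the complex conjugate of `L_ψ = ker ψ`, that is, in the annihilator
of the conjugate of `ψ`. -/
def UTwo (W : Type*) [AddCommGroup W] [Module ℂ W] (ψ : MixedForm T ℂ) :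
    Submodule ℂ (MixedForm T W) :=
  Submodule.span ℂ {Φ | ∃ A : W, ∃ e₁ ∈ annihilator (conjForm ψ), ∃ e₂ ∈ annihilator (conjForm ψ),
    Φ = tensMixed A (spinActC (spinActC ψ e₂) e₁)}

end GenTangent

/-! ### Manifolds: vector fields, forms, generalized complex structures -/

section Manifold

variable {H : Type*} [NormedAddCommGroup H] [NormedSpace ℝ H]
variable {M : Type*} [TopologicalSpace M] [ChartedSpace H M]

/-- The tangent space of `M` at `x`. -/
abbrev Tan (H : Type*) [NormedAddCommGroup H] [NormedSpace ℝ H]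
    {M : Type*} [TopologicalSpace M] [ChartedSpace H M] (x : M) : Type _ :=
  TangentSpace 𝓘(ℝ, H) x

/-- The directional derivative `X f` at a point, for a complex function `f`. -/
def dirDeriv (f : M → ℂ) (x : M) (v : Tan H x) : ℂ := mvfderiv 𝓘(ℝ, H) f x v

/-- Smooth vector fields. -/
def SmoothVF [IsManifold 𝓘(ℝ, H) ∞ M] (X : (x : M) → Tan H x) : Prop :=
  ContMDiff 𝓘(ℝ, H) 𝓘(ℝ, H).tangent ∞ (fun x => (⟨x, X x⟩ : TangentBundle 𝓘(ℝ, H) M))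

/-- Smooth real `1`-forms: those that give smooth functions on smooth vector fields. -/
def SmoothOneForm [IsManifold 𝓘(ℝ, H) ∞ M] (ξ : (x : M) → Tan H x →L[ℝ] ℝ) : Prop :=
  ∀ X : (x : M) → Tan H x, SmoothVF X → ContMDiff 𝓘(ℝ, H) 𝓘(ℝ, ℝ) ∞ (fun x => ξ x (X x))

/-- Smooth real `2`-forms: those that give smooth functions on smooth vector fields. -/
def SmoothTwoForm [IsManifold 𝓘(ℝ, H) ∞ M] (Ω : (x : M) → Tan H x [⋀^Fin 2]→L[ℝ] ℝ) : Prop :=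
  ∀ X Y : (x : M) → Tan H x, SmoothVF X → SmoothVF Y →
    ContMDiff 𝓘(ℝ, H) 𝓘(ℝ, ℝ) ∞ (fun x => Ω x ![X x, Y x])

/-- Smooth sections of `TM ⊕ T*M`. -/
def SmoothGen [IsManifold 𝓘(ℝ, H) ∞ M] (a : (x : M) → GenTangent (Tan H x)) : Prop :=
  SmoothVF (fun x => (a x).1) ∧ SmoothOneForm (fun x => (a x).2)

/-- The expression of a real `p`-form in the chart at `x`, a form on the model space. -/
def chartForm {p : ℕ} (α : (x : M) → Tan H x [⋀^Fin p]→L[ℝ] ℝ) (x : M) (y : H) :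
    H [⋀^Fin p]→L[ℝ] ℝ :=
  (α ((extChartAt 𝓘(ℝ, H) x).symm y)).compContinuousLinearMap
    (mfderiv 𝓘(ℝ, H) 𝓘(ℝ, H) (extChartAt 𝓘(ℝ, H) x).symm y)

/-- The exterior derivative of a real `p`-form at `x`: transport the form to the model space by
the chart at `x`, differentiate there, and pull the result back by the chart. -/
def extD {p : ℕ} (α : (x : M) → Tan H x [⋀^Fin p]→L[ℝ] ℝ) (x : M) :
    Tan H x [⋀^Fin (p + 1)]→L[ℝ] ℝ :=
  (extDeriv (chartForm α x) (extChartAt 𝓘(ℝ, H) x x)).compContinuousLinearMap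
    (mfderiv 𝓘(ℝ, H) 𝓘(ℝ, H) (extChartAt 𝓘(ℝ, H) x) x)

/-- The `1`-form `i_v dη = dη(v, ·)` at a point, for a `1`-form `η`. -/
def interiorD (η : (x : M) → Tan H x →L[ℝ] ℝ) (x : M) (v : Tan H x) : Tan H x →L[ℝ] ℝ :=
  (extD (fun y => ContinuousAlternatingMap.ofSubsingleton ℝ (Tan H y) ℝ (0 : Fin 1) (η y))
    x).toContinuousMultilinearMap.toContinuousLinearMap ![v, 0] 1

/-- The Lie derivative `ℒ_X η = i_X dη + d(i_X η)` of a `1`-form. -/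
def lieD (X : (x : M) → Tan H x) (η : (x : M) → Tan H x →L[ℝ] ℝ) (x : M) : Tan H x →L[ℝ] ℝ :=
  interiorD η x (X x) + mvfderiv 𝓘(ℝ, H) (fun y => η y (X y)) x

/-- The Courant bracket
`[u + ξ, v + η] = [u, v] + ℒ_u η - ℒ_v ξ - (1/2) (d i_u η - d i_v ξ)`. -/
def courant (a b : (x : M) → GenTangent (Tan H x)) (x : M) : GenTangent (Tan H x) :=
  (VectorField.mlieBracket 𝓘(ℝ, H) (fun y => (a y).1) (fun y => (b y).1) x,
    lieD (fun y => (a y).1) (fun y => (b y).2) x - lieD (fun y => (b y).1) (fun y => (a y).2) x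
      - (1 / 2 : ℝ) • (mvfderiv 𝓘(ℝ, H) (fun y => (b y).2 (a y).1) x
        - mvfderiv 𝓘(ℝ, H) (fun y => (a y).2 (b y).1) x))

/-- Real part of the complex bilinear extension of the Courant bracket,
`[a + √-1 a', b + √-1 b']`. -/
def courantRe (a a' b b' : (x : M) → GenTangent (Tan H x)) (x : M) : GenTangent (Tan H x) :=
  courant a b x - courant a' b' x

/-- Imaginary part of the complex bilinear extension of the Courant bracket,
`[a + √-1 a', b + √-1 b']`. -/
def courantIm (a a' b b' : (x : M) → GenTangent (Tan H x)) (x : M) : GenTangent (Tan H x) :=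
  courant a b' x + courant a' b x

/-- `a + √-1 a'` is a smooth section of the complex bundle `L_J`. -/
def IsSectionL [IsManifold 𝓘(ℝ, H) ∞ M]
    (J : (x : M) → GenTangent (Tan H x) →ₗ[ℝ] GenTangent (Tan H x))
    (a a' : (x : M) → GenTangent (Tan H x)) : Prop :=
  SmoothGen a ∧ SmoothGen a' ∧ ∀ x, cpx (a x) (a' x) ∈ eigL (J x)

/-- Generalized complex structures: smooth orthogonal endomorphisms of `TM ⊕ T*M` of square `-1`
(such an endomorphism has determinant one) for which `L_J` is closed under the
Courant bracket. -/
structure IsGenComplex [IsManifold 𝓘(ℝ, H) ∞ M]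
    (J : (x : M) → GenTangent (Tan H x) →ₗ[ℝ] GenTangent (Tan H x)) : Prop where
  smooth : ∀ a : (x : M) → GenTangent (Tan H x), SmoothGen a → SmoothGen (fun x => J x (a x))
  sq : ∀ x a, J x (J x a) = -a
  orthogonal : ∀ x a b, pairing (J x a) (J x b) = pairing a b
  involutive : ∀ a a' b b' : (x : M) → GenTangent (Tan H x),
    IsSectionL J a a' → IsSectionL J b b' →
      ∀ x, cpx (courantRe a a' b b' x) (courantIm a a' b b' x) ∈ eigL (J x)

/-- Generalized Kähler structures: commuting generalized complex structures such that
`⟨-J₁ J₂ a, a⟩` is positive definite. -/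
structure IsGenKahler [IsManifold 𝓘(ℝ, H) ∞ M]
    (J₁ J₂ : (x : M) → GenTangent (Tan H x) →ₗ[ℝ] GenTangent (Tan H x)) : Prop where
  genComplex₁ : IsGenComplex J₁
  genComplex₂ : IsGenComplex J₂
  commute : ∀ x a, J₁ x (J₂ x a) = J₂ x (J₁ x a)
  pos : ∀ x a, a ≠ 0 → 0 < pairing (-(J₁ x (J₂ x a))) a

/-- Smooth closed real `2`-forms. -/
structure IsClosedTwoForm [IsManifold 𝓘(ℝ, H) ∞ M] (b : (x : M) → Tan H x [⋀^Fin 2]→L[ℝ] ℝ) :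
    Prop where
  smooth : SmoothTwoForm b
  closed : ∀ x, extD b x = 0

/-- Symplectic forms. -/
structure IsSymplectic [IsManifold 𝓘(ℝ, H) ∞ M] (Ω : (x : M) → Tan H x [⋀^Fin 2]→L[ℝ] ℝ) :
    Prop extends IsClosedTwoForm Ω where
  nondegenerate : ∀ x (v : Tan H x), (∀ w : Tan H x, Ω x ![v, w] = 0) → v = 0

/-- The spinor `ψ = e^{b - √-1 Ω}`. -/
def psi (b Ω : (x : M) → Tan H x [⋀^Fin 2]→L[ℝ] ℝ) (x : M) : MixedForm (Tan H x) ℂ :=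
  expForm (Complex.ofRealCLM.toLinearMap.compAlternatingMap (b x).toAlternatingMap -
    Complex.I • Complex.ofRealCLM.toLinearMap.compAlternatingMap (Ω x).toAlternatingMap)

/-- `J` is the almost generalized complex structure `J_ψ` induced by a nondegenerate pure spinor
`ψ`: it is `-√-1` on `ker ψ` and `√-1` on the complex conjugate of `ker ψ`. -/
def IsInducedBy (J : (x : M) → GenTangent (Tan H x) →ₗ[ℝ] GenTangent (Tan H x))
    (ψ : (x : M) → MixedForm (Tan H x) ℂ) : Prop :=
  ∀ x, eigL (J x) = annihilator (ψ x) ∧ eigLbar (J x) = annihilator (conjForm (ψ x))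

end Manifold

/-! ### Hermitian bundles and generalized connections -/

section Bundle

variable {H : Type*} [NormedAddCommGroup H] [NormedSpace ℝ H]
variable {M : Type*} [TopologicalSpace M] [ChartedSpace H M]
variable {F : Type*} [NormedAddCommGroup F] [NormedSpace ℂ F]
variable {E : M → Type*} [∀ x, AddCommGroup (E x)] [∀ x, Module ℂ (E x)]
  [∀ x, TopologicalSpace (E x)] [TopologicalSpace (Bundle.TotalSpace F E)] [FiberBundle F E]

/-- Smooth sections of `E`. -/
def SmoothSection (H : Type*) [NormedAddCommGroup H] [NormedSpace ℝ H]
    {M : Type*} [TopologicalSpace M] [ChartedSpace H M]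
    (F : Type*) [NormedAddCommGroup F] [NormedSpace ℂ F]
    {E : M → Type*} [∀ x, TopologicalSpace (E x)] [TopologicalSpace (Bundle.TotalSpace F E)]
    [FiberBundle F E] (s : (x : M) → E x) : Prop :=
  ContMDiff 𝓘(ℝ, H) (𝓘(ℝ, H).prod 𝓘(ℝ, F)) ∞ (fun x => Bundle.TotalSpace.mk' F x (s x))

/-- Hermitian metrics of `E`, linear in the first and conjugate linear in the second variable. -/
structure HermitianMetric (H : Type*) [NormedAddCommGroup H] [NormedSpace ℝ H]
    {M : Type*} [TopologicalSpace M] [ChartedSpace H M]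
    (F : Type*) [NormedAddCommGroup F] [NormedSpace ℂ F]
    (E : M → Type*) [∀ x, AddCommGroup (E x)] [∀ x, Module ℂ (E x)]
    [∀ x, TopologicalSpace (E x)] [TopologicalSpace (Bundle.TotalSpace F E)]
    [FiberBundle F E] where
  /-- the form on the fibre over `x` -/
  form : (x : M) → E x →ₗ[ℂ] E x →ₗ⋆[ℂ] ℂ
  conj_symm : ∀ x v w, form x w v = starRingEnd ℂ (form x v w)
  pos : ∀ x v, v ≠ 0 → 0 < (form x v v).re
  smooth : ∀ s t : (x : M) → E x, SmoothSection H F s → SmoothSection H F t →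
    ContMDiff 𝓘(ℝ, H) 𝓘(ℝ, ℂ) ∞ (fun x => form x (s x) (t x))

/-- Generalized connections: complex linear maps `𝒟 : Γ(E) → Γ(E ⊗ (TM ⊕ T*M)^ℂ)` with
`𝒟(f s) = s ⊗ df + f 𝒟s`. Here `E ⊗_ℂ (TM ⊕ T*M)^ℂ = E ⊗_ℝ (TM ⊕ T*M)`. Only the values of
`toFun` on smooth sections are constrained, and only they are ever used. With complex
linearity, the Leibniz rule for real functions is that for complex functions. -/
structure GenConnection (H : Type*) [NormedAddCommGroup H] [NormedSpace ℝ H]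
    {M : Type*} [TopologicalSpace M] [ChartedSpace H M] [IsManifold 𝓘(ℝ, H) ∞ M]
    (F : Type*) [NormedAddCommGroup F] [NormedSpace ℂ F]
    (E : M → Type*) [∀ x, AddCommGroup (E x)] [∀ x, Module ℂ (E x)]
    [∀ x, TopologicalSpace (E x)] [TopologicalSpace (Bundle.TotalSpace F E)]
    [FiberBundle F E] where
  /-- the differential operator -/
  toFun : ((x : M) → E x) → (x : M) → E x ⊗[ℝ] GenTangent (Tan H x)
  add : ∀ s t : (x : M) → E x, SmoothSection H F s → SmoothSection H F t →
    ∀ x, toFun (fun y => s y + t y) x = toFun s x + toFun t x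
  smul : ∀ (c : ℂ) (s : (x : M) → E x), SmoothSection H F s →
    ∀ x, toFun (fun y => c • s y) x = c • toFun s x
  leibniz : ∀ (f : M → ℝ) (s : (x : M) → E x), ContMDiff 𝓘(ℝ, H) 𝓘(ℝ, ℝ) ∞ f →
    SmoothSection H F s → ∀ x, toFun (fun y => f y • s y) x =
      s x ⊗ₜ[ℝ] ((0, mvfderiv 𝓘(ℝ, H) f x) : GenTangent (Tan H x)) + f x • toFun s x
  smooth : ∀ (a : (x : M) → GenTangent (Tan H x)) (s : (x : M) → E x), SmoothGen a →
    SmoothSection H F s → SmoothSection H F (fun x => contract (a x) (toFun s x))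

variable [IsManifold 𝓘(ℝ, H) ∞ M]

/-- Generalized Hermitian connections: `dh(s, t) = h(𝒟s, t) + h(s, 𝒟t)`, an identity in
`(TM ⊕ T*M)^ℂ` that is stated after contraction with each `a ∈ TM ⊕ T*M`. -/
def IsHermitianConnection (h : HermitianMetric H F E) (D : GenConnection H F E) : Prop :=
  ∀ s t : (x : M) → E x, SmoothSection H F s → SmoothSection H F t →
    ∀ x (a : GenTangent (Tan H x)),
      dirDeriv (fun y => h.form y (s y) (t y)) x a.1 =
        h.form x (contract a (D.toFun s x)) (t x) + h.form x (s x) (contract a (D.toFun t x))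

/-- The `(0,1)`-component `𝒟^{0,1} s ∈ Γ(E ⊗ L̄_J)` with respect to `J`. -/
def D01 (J : (x : M) → GenTangent (Tan H x) →ₗ[ℝ] GenTangent (Tan H x))
    (D : GenConnection H F E) (s : (x : M) → E x) (x : M) : E x ⊗[ℝ] GenTangent (Tan H x) :=
  proj01 (J x) (D.toFun s x)

/-- `𝒟^{0,1} ∘ 𝒟^{0,1} = 0`. By the pairing `2⟨·, ·⟩`, `L̄_J` is the dual of the Lie algebroid `L_J`
(and `∂̄f` is `e ↦ (anchor of e) f`). The operator `𝒟^{0,1}` on `E ⊗ L̄_J` is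
`(𝒟^{0,1} α)(e₁, e₂) = 𝒟_{e₁}(α(e₂)) - 𝒟_{e₂}(α(e₁)) - α([e₁, e₂])` for sections
`e₁ = a + √-1 a'`, `e₂ = b + √-1 b'` of `L_J`, where `𝒟_e t = (𝒟^{0,1} t)(e)`; it is applied to
`α = 𝒟^{0,1} s`. -/
def IsIntegrable01 (J : (x : M) → GenTangent (Tan H x) →ₗ[ℝ] GenTangent (Tan H x))
    (D : GenConnection H F E) : Prop :=
  ∀ (s : (x : M) → E x) (a a' b b' : (x : M) → GenTangent (Tan H x)),
    SmoothSection H F s → IsSectionL J a a' → IsSectionL J b b' → ∀ x,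
      contractC (a x) (a' x) (D01 J D (fun y => contractC (b y) (b' y) (D01 J D s y)) x)
        - contractC (b x) (b' x) (D01 J D (fun y => contractC (a y) (a' y) (D01 J D s y)) x)
        - contractC (courantRe a a' b b' x) (courantIm a a' b b' x) (D01 J D s x) = 0

/-- The covariant derivative `D^A_v s` of the ordinary connection `D^A`, the `T*M`-part
of `𝒟`. -/
def cov (D : GenConnection H F E) (s : (x : M) → E x) (x : M) (v : Tan H x) : E x :=
  contract ((v, 0) : GenTangent (Tan H x)) (D.toFun s x)

/-- `V ∈ Γ(End(E) ⊗ TM)` is the `TM`-part of `𝒟 = D^A + V`. -/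
def IsVectorPart (D : GenConnection H F E) (V : (x : M) → Module.End ℂ (E x) ⊗[ℝ] Tan H x) :
    Prop :=
  ∀ s : (x : M) → E x, SmoothSection H F s → ∀ x,
    LinearMap.rTensor (Tan H x)
        ((LinearMap.applyₗ (s x) : Module.End ℂ (E x) →ₗ[ℂ] E x).restrictScalars ℝ) (V x) =
      LinearMap.lTensor (E x) (LinearMap.fst ℝ (Tan H x) (Tan H x →L[ℝ] ℝ)) (D.toFun s x)

/-- `R` is the curvature `F_A` of the ordinary connection `D^A`. -/
def IsCurvature (D : GenConnection H F E)
    (R : (x : M) → Tan H x [⋀^Fin 2]→ₗ[ℝ] Module.End ℂ (E x)) : Prop :=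
  ∀ (X Y : (x : M) → Tan H x) (s : (x : M) → E x), SmoothVF X → SmoothVF Y →
    SmoothSection H F s → ∀ x,
      R x ![X x, Y x] (s x) =
        cov D (fun y => cov D s y (Y y)) x (X x) - cov D (fun y => cov D s y (X y)) x (Y x)
          - cov D s x (VectorField.mlieBracket 𝓘(ℝ, H) X Y x)

/-- The covariant derivative of a section `A` of `End(E)`, applied to the section `s` of `E`:
`(D^A_X A) s = D^A_X (A s) - A (D^A_X s)`. -/
def covEnd (D : GenConnection H F E) (A : (x : M) → Module.End ℂ (E x)) (s : (x : M) → E x)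
    (x : M) (v : Tan H x) : E x :=
  cov D (fun y => A y (s y)) x v - A x (cov D s x v)

/-- `Ψ = d^A Φ`, the exterior covariant derivative of an `End(E)`-valued mixed form, by the
invariant formula `(d^A Φ)(X₀, …, X_q) = ∑_i (-1)^i D^A_{X_i} (Φ(X₀, …, X̂_i, …, X_q))
+ ∑_{i < j} (-1)^{i + j} Φ([X_i, X_j], X₀, …, X̂_i, …, X̂_j, …, X_q)`. In the second sum the
pair `i ≤ j` below stands for the pair `i < j + 1` of indices, which reverses the sign. -/
structure IsExtCovDeriv (D : GenConnection H F E)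
    (Φ Ψ : (x : M) → MixedForm (Tan H x) (Module.End ℂ (E x))) : Prop where
  zero : ∀ x, Ψ x 0 = 0
  one : ∀ (X : (x : M) → Tan H x) (s : (x : M) → E x), SmoothVF X → SmoothSection H F s → ∀ x,
    Ψ x 1 ![X x] (s x) = covEnd D (fun y => Φ y 0 ![]) s x (X x)
  add_two : ∀ (p : ℕ) (X : Fin (p + 2) → (x : M) → Tan H x) (s : (x : M) → E x),
    (∀ i, SmoothVF (X i)) → SmoothSection H F s → ∀ x,
      Ψ x (p + 2) (fun i => X i x) (s x) =
        (∑ i : Fin (p + 2), (-1 : ℂ) ^ (i : ℕ) •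
          covEnd D (fun y => Φ y (p + 1) (i.removeNth (fun k => X k y))) s x (X i x)) -
        ∑ i : Fin (p + 1), ∑ j ∈ Finset.Ici i, (-1 : ℂ) ^ ((i : ℕ) + (j : ℕ)) •
          Φ x (p + 1) (Matrix.vecCons
            (VectorField.mlieBracket 𝓘(ℝ, H) (X i.castSucc) (X j.succ) x)
            (j.removeNth (i.castSucc.removeNth (fun k => X k x)))) (s x)

/-- `𝓕` is the curvature `ℱ_𝒜(ψ) = F_A · ψ + d^A (V · ψ) + (1/2) [V · V] · ψ` of the generalized
connection `𝒟 = D^A + V`. The tensors `V`, `F_A` and `d^A (V · ψ)` are determined by `𝒟`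
and `ψ`. -/
def IsGenCurvature (D : GenConnection H F E) (ψ : (x : M) → MixedForm (Tan H x) ℂ)
    (𝓕 : (x : M) → MixedForm (Tan H x) (Module.End ℂ (E x))) : Prop :=
  ∃ (V : (x : M) → Module.End ℂ (E x) ⊗[ℝ] Tan H x)
    (R : (x : M) → Tan H x [⋀^Fin 2]→ₗ[ℝ] Module.End ℂ (E x))
    (Ψ : (x : M) → MixedForm (Tan H x) (Module.End ℂ (E x))),
    IsVectorPart D V ∧ IsCurvature D R ∧ IsExtCovDeriv D (fun x => vecAct (ψ x) (V x)) Ψ ∧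
      ∀ x, 𝓕 x = wedgeTwoMixed (R x) (ψ x) + Ψ x
        + (1 / 2 : ℂ) • bracketAct (ψ x) (V x) (V x)

/-- `K` is the mean curvature `𝒦_𝒜(ψ)`, the Hermitian part of the component of `ℱ_𝒜(ψ)` in
`End(E) ⊗ U^{-n} = End(E) ⊗ ψ`, along `End(E) ⊗ U^{-n+2}`: it is Hermitian, and that
component is `(K + N) ⊗ ψ` with `N` skew-Hermitian. -/
def IsMeanCurvature (h : HermitianMetric H F E) (D : GenConnection H F E)
    (ψ : (x : M) → MixedForm (Tan H x) ℂ) (K : (x : M) → Module.End ℂ (E x)) : Prop :=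
  ∃ 𝓕 : (x : M) → MixedForm (Tan H x) (Module.End ℂ (E x)), IsGenCurvature D ψ 𝓕 ∧
    ∀ x, (∀ v w, h.form x (K x v) w = h.form x v (K x w)) ∧
      ∃ N : Module.End ℂ (E x), (∀ v w, h.form x (N v) w = -h.form x v (N w)) ∧
        𝓕 x - tensMixed (K x + N) (ψ x) ∈ UTwo (Module.End ℂ (E x)) (ψ x)

/-- The Einstein-Hermitian condition `𝒦_𝒜(ψ) = λ id_E`. -/
def IsEinsteinHermitian (h : HermitianMetric H F E) (D : GenConnection H F E)
    (ψ : (x : M) → MixedForm (Tan H x) ℂ) (lam : ℝ) : Prop :=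
  IsMeanCurvature h D ψ (fun _ => (lam : ℂ) • LinearMap.id)

end Bundle

end GenKahler

end

noncomputable section

namespace GenKahler

set_option linter.unusedSectionVars false

/-! ### The spinor `e^β` in low degrees and the projection to its line -/

section FormAlgebra

variable {T : Type*} [AddCommGroup T] [Module ℝ T]
variable {W : Type*} [AddCommGroup W] [Module ℂ W]

/-! The proof is a Bochner formula for |s|², followed by Hopf's strong maximum principle; nothing is
integrated. Write β = b - √-1 Ω, so that ψ = e^β and ker ψ consists of the X - i_X β with X a
complex vector, and let G = -J Jψ be the generalized metric.

The component of the curvature along ψ can be read off from degrees 0 and 2: it is Φ₀ + (√-1/4)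
tr(Φ₂ - Φ₀ β), where the trace is taken against the inverse of Ω (`spinorCoeff`,
`spinorCoeff_eq_zero_of_mem_UTwo`). For the curvature of 𝒟, the 2-form Φ₂ - Φ₀ β is the commutator
curvature along ker ψ (`genCurvature_two_apply`), and Φ₀ is a sum of commutators of derivatives
along covectors (`genCurvature_zero_apply`). The Einstein-Hermitian condition thus becomes an
identity between second derivatives of s.

If 𝒟^{0,1} s = 0, then 𝒟_{Ja} s = √-1 𝒟_a s, and Jψ = J G gives 𝒟_{Jψ a} s = √-1 𝒟_{Ga} s. This
absorbs the factors √-1 and replaces parts of the commutators by second derivatives 𝒟_a 𝒟_{Gc} s.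
Now pair with s and take real parts. The skew-Hermitian part of the coefficient drops out, and so
does every commutator with a covector, because covectors differentiate no function. What remains is
L|s|² = -8λ|s|² + 4 ∑ |𝒟_{A_k} s|², where A_k is orthonormal for 2⟨G·,·⟩ and L is a real
second-order operator without zeroth-order term (`bochner_identity`). Its principal symbol is a
trace with respect to G over the vector parts of the A_k, which span the tangent space, so L is
elliptic (`exists_trace_frame`, `bochner_elliptic`).

For λ ≤ 0 the right side is nonnegative. On each connected component |s|² attains its maximum by
compactness, and the maximum principle (`eventually_eq_of_isMax`) makes it locally constant. The
left side is then zero, so both nonnegative terms on the right vanish: λ|s|² = 0 and 𝒟s = 0. -/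

theorem removeNth_succ_vec {n : ℕ} (i : Fin (n + 1)) (x : T) (v : Fin (n + 1) → T) :
    (i.succ).removeNth (Matrix.vecCons x v) = Matrix.vecCons x (i.removeNth v) := by
  ext j
  refine Fin.cases ?_ (fun j => ?_) j <;> simp [Fin.removeNth]

theorem removeNth_one_vec {n : ℕ} (x : T) (v : Fin (n + 1) → T) :
    (1 : Fin (n + 2)).removeNth (Matrix.vecCons x v) =
      Matrix.vecCons x ((0 : Fin (n + 1)).removeNth v) :=
  removeNth_succ_vec 0 x v

theorem removeNth_two_vec {n : ℕ} (x : T) (v : Fin (n + 2) → T) :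
    (2 : Fin (n + 3)).removeNth (Matrix.vecCons x v) =
      Matrix.vecCons x ((1 : Fin (n + 2)).removeNth v) :=
  removeNth_succ_vec 1 x v

theorem removeNth_three_vec {n : ℕ} (x : T) (v : Fin (n + 3) → T) :
    (3 : Fin (n + 4)).removeNth (Matrix.vecCons x v) =
      Matrix.vecCons x ((2 : Fin (n + 3)).removeNth v) :=
  removeNth_succ_vec 2 x v

theorem wedgeTwo_apply (B : T [⋀^Fin 2]→ₗ[ℝ] W) {p : ℕ} (α : T [⋀^Fin p]→ₗ[ℝ] ℂ)
    (v : Fin (p + 2) → T) :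
    wedgeTwo B α v = (1 / 2 : ℝ) • ∑ i : Fin (p + 2), (-1 : ℤ) ^ (i : ℕ) •
      wedgeOne (slot B (v i)) α (i.removeNth v) := by
  simp [wedgeTwo, AlternatingMap.alternatizeUncurryFin_apply]

theorem alt_swap {N : Type*} [AddCommGroup N] [Module ℝ N] (B : T [⋀^Fin 2]→ₗ[ℝ] N) (x y : T) : B ![x, y] = -B ![y, x] := by
  have := B.map_swap ![y, x] (i := 0) (j := 1) (by simp)
  rw [← this]
  congr 1
  ext i; fin_cases i <;> simp

theorem wedgeTwo_const (B : T [⋀^Fin 2]→ₗ[ℝ] W) (x y : T) :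
    wedgeTwo B (AlternatingMap.constOfIsEmpty ℝ T (Fin 0) (1 : ℂ)) ![x, y] = B ![x, y] := by
  simp only [wedgeTwo_apply, wedgeOne_apply, Fin.sum_univ_succ, Fin.sum_univ_zero]
  simp [removeNth_one_vec]
  rw [alt_swap B y x, smul_neg, neg_neg, ← two_smul ℝ, smul_smul]
  norm_num

theorem expForm_zero_apply (β : T [⋀^Fin 2]→ₗ[ℝ] ℂ) (v : Fin 0 → T) : expForm β 0 v = 1 := rfl

theorem expForm_two_apply (β : T [⋀^Fin 2]→ₗ[ℝ] ℂ) (x y : T) :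
    expForm β 2 ![x, y] = β ![x, y] := by
  have : expForm β 2 = (2 / ((0 : ℕ) + 2 : ℂ)) • wedgeTwo β (expForm β 0) := rfl
  rw [this, AlternatingMap.smul_apply]
  have h0 : expForm β 0 = AlternatingMap.constOfIsEmpty ℝ T (Fin 0) 1 := rfl
  rw [h0, wedgeTwo_const]
  norm_num

/-- Degree four is the highest one needed: two interior products lower it to degree two, where the
curvature is read. -/
theorem expForm_four_apply (β : T [⋀^Fin 2]→ₗ[ℝ] ℂ) (x y z w : T) :
    expForm β 4 ![x, y, z, w] =
      β ![x, y] * β ![z, w] - β ![x, z] * β ![y, w] + β ![x, w] * β ![y, z] := by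
  have : expForm β 4 = (2 / ((2 : ℕ) + 2 : ℂ)) • wedgeTwo β (expForm β 2) := rfl
  rw [this, AlternatingMap.smul_apply]
  simp only [wedgeTwo_apply, wedgeOne_apply, Fin.sum_univ_succ, Fin.sum_univ_zero]
  simp [removeNth_one_vec, removeNth_two_vec, removeNth_three_vec, expForm_two_apply]
  rw [alt_swap β y x, alt_swap β z x, alt_swap β w x, alt_swap β z y, alt_swap β w y,
    alt_swap β w z]
  ring

variable [TopologicalSpace T]

theorem spinAct_zero (φ : MixedForm T ℂ) (a : GenTangent T) (v : Fin 0 → T) :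
    spinAct φ a 0 v = φ 1 ![a.1] := by
  have : v = ![] := Subsingleton.elim _ _
  subst this
  simp [spinAct, wedgeCovector, interior_apply]

theorem spinAct_one (φ : MixedForm T ℂ) (a : GenTangent T) (x : T) :
    spinAct φ a 1 ![x] = φ 2 ![a.1, x] + φ 0 ![] * (a.2 x : ℂ) := by
  simp [spinAct, wedgeCovector, interior_apply, wedgeOne_apply]

theorem spinAct_two (φ : MixedForm T ℂ) (a : GenTangent T) (x y : T) :
    spinAct φ a 2 ![x, y] =
      φ 3 ![a.1, x, y] + (φ 1 ![y] * (a.2 x : ℂ) - φ 1 ![x] * (a.2 y : ℂ)) := by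
  simp [spinAct, wedgeCovector, interior_apply, wedgeOne_apply,
    removeNth_one_vec, Fin.sum_univ_succ]
  ring

theorem spinAct_three (φ : MixedForm T ℂ) (a : GenTangent T) (x y z : T) :
    spinAct φ a 3 ![x, y, z] =
      φ 4 ![a.1, x, y, z] + (φ 2 ![y, z] * (a.2 x : ℂ) - φ 2 ![x, z] * (a.2 y : ℂ)
        + φ 2 ![x, y] * (a.2 z : ℂ)) := by
  simp [spinAct, wedgeCovector, interior_apply, wedgeOne_apply,
    removeNth_one_vec, removeNth_two_vec, Fin.sum_univ_succ]
  ring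

/-- The `1`-form `i_v β + ξ`, for which `(v + ξ) · e^β = (i_v β + ξ) ∧ e^β`. -/
def spinCovector (β : T [⋀^Fin 2]→ₗ[ℝ] ℂ) (a : GenTangent T) (x : T) : ℂ :=
  β ![a.1, x] + (a.2 x : ℂ)

theorem spinAct_expForm_one (β : T [⋀^Fin 2]→ₗ[ℝ] ℂ) (a : GenTangent T) (x : T) :
    spinAct (expForm β) a 1 ![x] = spinCovector β a x := by
  rw [spinAct_one, expForm_two_apply, expForm_zero_apply, one_mul]; rfl

theorem spinAct_expForm_three (β : T [⋀^Fin 2]→ₗ[ℝ] ℂ) (a : GenTangent T) (x y z : T) :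
    spinAct (expForm β) a 3 ![x, y, z] = spinCovector β a x * β ![y, z]
      - spinCovector β a y * β ![x, z] + spinCovector β a z * β ![x, y] := by
  rw [spinAct_three, expForm_four_apply, expForm_two_apply, expForm_two_apply, expForm_two_apply]
  simp only [spinCovector]
  ring

theorem exists_cpx (e : ℂ ⊗[ℝ] GenTangent T) : ∃ a a', e = cpx a a' := by
  induction e using TensorProduct.induction_on with
  | zero => exact ⟨0, 0, by simp [cpx]⟩
  | tmul z a =>
    refine ⟨z.re • a, z.im • a, ?_⟩
    rw [cpx, TensorProduct.tmul_smul, TensorProduct.tmul_smul, TensorProduct.smul_tmul',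
      TensorProduct.smul_tmul', ← TensorProduct.add_tmul]
    congr 1
    rw [Complex.real_smul, Complex.real_smul, mul_one, Complex.re_add_im]
  | add x y hx hy =>
    obtain ⟨a, a', rfl⟩ := hx
    obtain ⟨c, c', rfl⟩ := hy
    refine ⟨a + c, a' + c', ?_⟩
    simp only [cpx, TensorProduct.tmul_add]
    abel

theorem spinActC_cpx (φ : MixedForm T ℂ) (a a' : GenTangent T) :
    spinActC φ (cpx a a') = spinAct φ a + Complex.I • spinAct φ a' := by
  simp [spinActC, cpx]

theorem spinAct_conj_one (β : T [⋀^Fin 2]→ₗ[ℝ] ℂ) (a : GenTangent T) (x : T) :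
    spinAct (conjForm (expForm β)) a 1 ![x] = starRingEnd ℂ (β ![a.1, x]) + (a.2 x : ℂ) := by
  rw [spinAct_one]
  simp [conjForm, expForm_two_apply, expForm_zero_apply]

theorem annihilator_conj_expForm {β : T [⋀^Fin 2]→ₗ[ℝ] ℂ} {a a' : GenTangent T}
    (h : cpx a a' ∈ annihilator (conjForm (expForm β))) (x : T) :
    starRingEnd ℂ (β ![a.1, x]) + (a.2 x : ℂ)
      + Complex.I * (starRingEnd ℂ (β ![a'.1, x]) + (a'.2 x : ℂ)) = 0 := by
  rw [annihilator, LinearMap.mem_ker, spinActC_cpx] at h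
  have := congrArg (fun φ : MixedForm T ℂ => φ 1 ![x]) h
  simpa [spinAct_conj_one] using this

theorem annihilator_expForm {β : T [⋀^Fin 2]→ₗ[ℝ] ℂ} {a a' : GenTangent T}
    (h : cpx a a' ∈ annihilator (expForm β)) (x : T) :
    spinCovector β a x + Complex.I * spinCovector β a' x = 0 := by
  rw [annihilator, LinearMap.mem_ker, spinActC_cpx] at h
  have := congrArg (fun φ : MixedForm T ℂ => φ 1 ![x]) h
  simpa [spinAct_expForm_one] using this

/-- The complex `2`-form `b - √-1 Ω`. -/
def complexForm (b Ω : T [⋀^Fin 2]→ₗ[ℝ] ℝ) : T [⋀^Fin 2]→ₗ[ℝ] ℂ :=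
  Complex.ofRealCLM.toLinearMap.compAlternatingMap b -
    Complex.I • Complex.ofRealCLM.toLinearMap.compAlternatingMap Ω

@[simp] theorem complexForm_apply (b Ω : T [⋀^Fin 2]→ₗ[ℝ] ℝ) (v : Fin 2 → T) :
    complexForm b Ω v = (b v : ℂ) - Complex.I * (Ω v : ℂ) := rfl

/-- The component along `W ⊗ e^β` of `Φ ∈ W ⊗ (U^{-n} ⊕ U^{-n+2})`, read off from the components of
degrees `0` and `2`; the `X j`, `Y j` form a frame and its symplectic dual. -/
def spinorCoeff {ι : Type*} [Fintype ι] (β : T [⋀^Fin 2]→ₗ[ℝ] ℂ) (X Y : ι → T) :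
    MixedForm T W →ₗ[ℂ] W where
  toFun Φ := Φ 0 ![] + (Complex.I / 4) •
    ∑ j, (Φ 2 ![X j, Y j] - β ![X j, Y j] • Φ 0 ![])
  map_add' Φ Φ' := by
    simp only [Pi.add_apply, AlternatingMap.add_apply, smul_add, Finset.sum_sub_distrib,
      Finset.sum_add_distrib, smul_sub]
    abel
  map_smul' c Φ := by
    simp only [Pi.smul_apply, AlternatingMap.smul_apply, RingHom.id_apply, smul_add,
      Finset.smul_sum, smul_sub]
    congr 1
    refine Finset.sum_congr rfl fun j _ => ?_
    rw [smul_comm c, smul_comm c (Complex.I / 4), smul_comm c]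

theorem spinorCoeff_apply {ι : Type*} [Fintype ι] (β : T [⋀^Fin 2]→ₗ[ℝ] ℂ) (X Y : ι → T)
    (Φ : MixedForm T W) : spinorCoeff β X Y Φ = Φ 0 ![] + (Complex.I / 4) •
    ∑ j, (Φ 2 ![X j, Y j] - β ![X j, Y j] • Φ 0 ![]) := rfl

theorem spinorCoeff_tensMixed {ι : Type*} [Fintype ι] (β : T [⋀^Fin 2]→ₗ[ℝ] ℂ) (X Y : ι → T)
    (A : W) : spinorCoeff β X Y (tensMixed A (expForm β)) = A := by
  simp [spinorCoeff_apply, tensMixed, expForm_zero_apply, expForm_two_apply]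

/-- If eᵢ · e^β = γᵢ ∧ e^β, then Φ = e₁ · e₂ · e^β satisfies Φ₂ - Φ₀ β = γ₁ ∧ γ₂. For eᵢ in the
conjugate of ker ψ the covector γᵢ is a multiple of Ω contracted with the vector part of eᵢ, so the
trace of γ₁ ∧ γ₂ against the inverse of Ω is proportional to Φ₀. The constant √-1/4 in `spinorCoeff`
is the one that cancels it. -/
theorem spinorCoeff_eq_zero_of_mem_UTwo {ι : Type*} [Fintype ι] (b Ω : T [⋀^Fin 2]→ₗ[ℝ] ℝ)
    (X Y : ι → T) (θ : ι → T →L[ℝ] ℝ) (hθ : ∀ v, ∑ j, θ j v • X j = v)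
    (hY : ∀ v j, Ω ![v, Y j] = θ j v) {Φ : MixedForm T W}
    (hΦ : Φ ∈ UTwo W (expForm (complexForm b Ω))) :
    spinorCoeff (complexForm b Ω) X Y Φ = 0 := by
  set β := complexForm b Ω with hβ
  have hlin : ∀ (g : T →ₗ[ℝ] ℂ) (v : T), ∑ j, (θ j v : ℂ) * g (X j) = g v := by
    intro g v
    conv_rhs => rw [← hθ v]
    simp [map_sum]
  let γ : GenTangent T → T →ₗ[ℝ] ℂ := fun a =>
    slot β a.1 + Complex.ofRealCLM.toLinearMap ∘ₗ a.2.toLinearMap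
  have hγ : ∀ a x, spinCovector β a x = γ a x := fun a x => by simp [γ, spinCovector]
  refine Submodule.span_induction ?_ (map_zero _) (fun x y _ _ hx hy => by simp [hx, hy])
    (fun c x _ hx => by simp [hx]) hΦ
  rintro _ ⟨A, e₁, h₁, e₂, h₂, rfl⟩
  obtain ⟨a, a', rfl⟩ := exists_cpx e₁
  obtain ⟨c, c', rfl⟩ := exists_cpx e₂
  -- An element v + ξ of the conjugate of ker ψ has ξ equal to minus the contraction of v with the
  -- conjugate of β, so i_v β + ξ is i_v of β minus its conjugate, which is -2√-1 i_v Ω.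
  have key : ∀ (d d' : GenTangent T), cpx d d' ∈ annihilator (conjForm (expForm β)) → ∀ x,
      γ d x + Complex.I * γ d' x
        = -2 * Complex.I * (Ω ![d.1, x] + Complex.I * Ω ![d'.1, x]) := by
    intro d d' hd x
    have := annihilator_conj_expForm hd x
    simp only [hβ, complexForm_apply, map_sub, map_mul, Complex.conj_ofReal, Complex.conj_I]
      at this
    simp only [γ, hβ, LinearMap.add_apply, slot_apply, complexForm_apply, LinearMap.comp_apply,
      ContinuousLinearMap.coe_coe, Complex.ofRealCLM_apply]
    linear_combination this
  have k₁ := key a a' h₁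
  have k₂ := key c c' h₂
  set P : MixedForm T ℂ := spinActC (expForm β) (cpx c c') with hP
  have P1 : ∀ x, P 1 ![x] = γ c x + Complex.I * γ c' x := by
    intro x
    rw [hP, spinActC_cpx, ← hγ, ← hγ, ← spinAct_expForm_one, ← spinAct_expForm_one]; rfl
  have P3 : ∀ x y z, P 3 ![x, y, z] = P 1 ![x] * β ![y, z] - P 1 ![y] * β ![x, z]
      + P 1 ![z] * β ![x, y] := by
    intro x y z
    have : P 3 ![x, y, z] = spinAct (expForm β) c 3 ![x, y, z]
      + Complex.I * spinAct (expForm β) c' 3 ![x, y, z] := by rw [hP, spinActC_cpx]; rfl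
    rw [this, P1, P1, P1, spinAct_expForm_three, spinAct_expForm_three]
    simp only [hγ]
    ring
  set Q : MixedForm T ℂ := spinActC P (cpx a a') with hQ
  have Q0 : Q 0 ![] = P 1 ![a.1] + Complex.I * P 1 ![a'.1] := by
    rw [hQ, spinActC_cpx, ← spinAct_zero P a ![], ← spinAct_zero P a' ![]]; rfl
  have Q2 : ∀ x y, Q 2 ![x, y] - β ![x, y] * Q 0 ![] =
      (γ a x + Complex.I * γ a' x) * P 1 ![y] - (γ a y + Complex.I * γ a' y) * P 1 ![x] := by
    intro x y
    have : Q 2 ![x, y] = spinAct P a 2 ![x, y] + Complex.I * spinAct P a' 2 ![x, y] := by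
      rw [hQ, spinActC_cpx]; rfl
    rw [this, spinAct_two, spinAct_two, P3, P3, Q0]
    simp only [← hγ, spinCovector]
    ring
  -- With vector parts v₁, v₂ of the two elements, the two halves of the trace of γ₁ ∧ γ₂ are
  -- -4Ω(v₁, v₂) and 4Ω(v₁, v₂); their difference -8Ω(v₁, v₂) is 4√-1 times Q₀ = 2√-1 Ω(v₁, v₂).
  have hsum : ∑ j, (Q 2 ![X j, Y j] - β ![X j, Y j] * Q 0 ![]) = 4 * Complex.I * Q 0 ![] := by
    have y₁ : ∀ j, γ a (Y j) + Complex.I * γ a' (Y j) =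
        -2 * Complex.I * ((θ j a.1 : ℂ) + Complex.I * (θ j a'.1 : ℂ)) := fun j => by
      rw [k₁, hY, hY]
    have y₂ : ∀ j, γ c (Y j) + Complex.I * γ c' (Y j) =
        -2 * Complex.I * ((θ j c.1 : ℂ) + Complex.I * (θ j c'.1 : ℂ)) := fun j => by
      rw [k₂, hY, hY]
    simp only [Q2]
    simp only [Q0, P1, y₁, y₂]
    rw [Finset.sum_sub_distrib]
    have e1 : ∑ j, (γ a (X j) + Complex.I * γ a' (X j)) *
        (-2 * Complex.I * ((θ j c.1 : ℂ) + Complex.I * (θ j c'.1 : ℂ)))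
        = -2 * Complex.I * ((γ a c.1 + Complex.I * γ a' c.1)
          + Complex.I * (γ a c'.1 + Complex.I * γ a' c'.1)) := by
      rw [← hlin (γ a) c.1, ← hlin (γ a') c.1, ← hlin (γ a) c'.1, ← hlin (γ a') c'.1]
      simp only [Finset.mul_sum, ← Finset.sum_add_distrib]
      exact Finset.sum_congr rfl fun j _ => by ring
    have e2 : ∑ j, (-2 * Complex.I * ((θ j a.1 : ℂ) + Complex.I * (θ j a'.1 : ℂ))) *
        (γ c (X j) + Complex.I * γ c' (X j))
        = -2 * Complex.I * ((γ c a.1 + Complex.I * γ c' a.1)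
          + Complex.I * (γ c a'.1 + Complex.I * γ c' a'.1)) := by
      rw [← hlin (γ c) a.1, ← hlin (γ c') a.1, ← hlin (γ c) a'.1, ← hlin (γ c') a'.1]
      simp only [Finset.mul_sum, ← Finset.sum_add_distrib]
      exact Finset.sum_congr rfl fun j _ => by ring
    rw [e1, e2, k₁ c.1, k₁ c'.1, k₂ a.1, k₂ a'.1, alt_swap Ω a.1 c.1, alt_swap Ω a'.1 c.1,
      alt_swap Ω a.1 c'.1, alt_swap Ω a'.1 c'.1]
    push_cast
    ring
  have : spinorCoeff β X Y (tensMixed A Q) =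
      (Q 0 ![] + (Complex.I / 4) * ∑ j, (Q 2 ![X j, Y j] - β ![X j, Y j] * Q 0 ![])) • A := by
    simp only [spinorCoeff_apply, tensMixed, tensForm_apply, add_smul, mul_smul, Finset.sum_smul,
      sub_smul]
  rw [this, hsum]
  have : Q 0 ![] + Complex.I / 4 * (4 * Complex.I * Q 0 ![]) = 0 := by
    linear_combination Q 0 ![] * Complex.I_mul_I
  rw [this, zero_smul]

end FormAlgebra

end GenKahler

end

noncomputable section

namespace GenKahler

set_option linter.unusedSectionVars false

/-! ### Contraction of endomorphism-valued vectors with covectors, and the structure Jψ -/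

section VectorCoefficients

variable {T : Type*} [AddCommGroup T] [Module ℝ T]
variable {W : Type*} [AddCommGroup W] [Module ℂ W]

/-- Contraction of a `W`-valued vector with a complex covector, `A ⊗ v ↦ g(v) A`. -/
def coeff (g : T →ₗ[ℝ] ℂ) : W ⊗[ℝ] T →ₗ[ℝ] W :=
  TensorProduct.lift (LinearMap.mk₂ ℝ (fun (A : W) (v : T) => g v • A)
    (fun A B v => smul_add _ _ _) (fun r A v => smul_comm _ _ _)
    (fun A u v => by rw [map_add, add_smul]) (fun r A v => by rw [map_smul, smul_assoc]))

@[simp] theorem coeff_tmul (g : T →ₗ[ℝ] ℂ) (A : W) (v : T) : coeff g (A ⊗ₜ[ℝ] v) = g v • A := rfl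

theorem coeff_add (g g' : T →ₗ[ℝ] ℂ) (t : W ⊗[ℝ] T) :
    coeff (g + g') t = coeff g t + coeff g' t := by
  induction t using TensorProduct.induction_on with
  | zero => simp
  | tmul A v => simp [add_smul]
  | add x y hx hy => simp only [map_add, hx, hy]; abel

theorem coeff_smul (c : ℂ) (g : T →ₗ[ℝ] ℂ) (t : W ⊗[ℝ] T) :
    coeff (c • g) t = c • coeff g t := by
  induction t using TensorProduct.induction_on with
  | zero => simp
  | tmul A v => simp [mul_smul]
  | add x y hx hy => simp only [map_add, hx, hy, smul_add]

theorem interior_one_apply (v y : T) (φ : MixedForm T ℂ) : interior v φ 1 ![y] = φ 2 ![v, y] := rfl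

theorem interior_interior_zero_apply (v w : T) (φ : MixedForm T ℂ) :
    interior v (interior w φ) 0 ![] = φ 2 ![w, v] := rfl

theorem interior_interior_two_apply (v w x y : T) (φ : MixedForm T ℂ) :
    interior v (interior w φ) 2 ![x, y] = φ 4 ![w, v, x, y] := rfl

theorem vecAct_expForm_one (β : T [⋀^Fin 2]→ₗ[ℝ] ℂ) (V : W ⊗[ℝ] T) (y : T) :
    vecAct (expForm β) V 1 ![y] = -coeff (slot β y) V := by
  induction V using TensorProduct.induction_on with
  | zero => simp
  | tmul A v =>
    have : vecAct (expForm β) (A ⊗ₜ[ℝ] v) = tensMixed A (interior v (expForm β)) := rfl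
    rw [this]
    simp only [tensMixed, tensForm_apply, interior_one_apply, expForm_two_apply, coeff_tmul,
      slot_apply]
    rw [alt_swap β v y, neg_smul]
  | add x y hx hy => simp only [map_add, Pi.add_apply, AlternatingMap.add_apply, hx, hy]; abel

variable {S : Type*} [AddCommGroup S] [Module ℂ S]

theorem bracketAct_add_left (φ : MixedForm T ℂ) (V V' U : Module.End ℂ S ⊗[ℝ] T) :
    bracketAct φ (V + V') U = bracketAct φ V U + bracketAct φ V' U := by
  simp [bracketAct]

theorem bracketAct_zero_left (φ : MixedForm T ℂ) (U : Module.End ℂ S ⊗[ℝ] T) :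
    bracketAct φ 0 U = 0 := by
  simp [bracketAct]

theorem bracketAct_tmul_left (φ : MixedForm T ℂ) (A : Module.End ℂ S) (v : T)
    (U : Module.End ℂ S ⊗[ℝ] T) : bracketAct φ (A ⊗ₜ[ℝ] v) U = bracketActAux φ A v U := rfl

/-- The degree zero part of i_v i_w e^β is β(w, v). Expanding v in the frame splits this into
contractions of the two factors with separate covectors, which later become derivatives of sections
along those covectors. -/
theorem bracketAct_expForm_zero {ι : Type*} [Fintype ι] (β : T [⋀^Fin 2]→ₗ[ℝ] ℂ)
    (X : ι → T) (θ : ι → T →ₗ[ℝ] ℂ) (hθ : ∀ (g : T →ₗ[ℝ] ℂ) v, ∑ j, θ j v * g (X j) = g v)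
    (V U : Module.End ℂ S ⊗[ℝ] T) :
    bracketAct (expForm β) V U 0 ![] =
      ∑ j, (coeff (slot β (X j)) U * coeff (θ j) V - coeff (θ j) V * coeff (slot β (X j)) U) := by
  induction V using TensorProduct.induction_on with
  | zero => simp [bracketAct_zero_left]
  | tmul A v =>
    rw [bracketAct_tmul_left]
    induction U using TensorProduct.induction_on with
    | zero => simp
    | tmul B w =>
      rw [bracketActAux_tmul]
      simp only [tensMixed, tensForm_apply, interior_interior_zero_apply, expForm_two_apply,
        coeff_tmul]
      have h := hθ (slot β w) v
      have e : ∀ j, slot β (X j) w = -slot β w (X j) := fun j => alt_swap β _ _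
      have : ∀ j, slot β (X j) w • B * θ j v • A - θ j v • A * slot β (X j) w • B =
          (θ j v * slot β w (X j)) • (A * B - B * A) := by
        intro j
        rw [e]
        simp only [smul_mul_assoc, mul_smul_comm, smul_smul, smul_sub]
        module
      rw [Finset.sum_congr rfl fun j _ => this j, ← Finset.sum_smul, h]
      rfl
    | add x y hx hy =>
      simp only [map_add, Pi.add_apply, AlternatingMap.add_apply, hx, hy,
        ← Finset.sum_add_distrib]
      exact Finset.sum_congr rfl fun j _ => by noncomm_ring
  | add x y hx hy =>
    simp only [bracketAct_add_left, map_add, Pi.add_apply, AlternatingMap.add_apply, hx, hy,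
      ← Finset.sum_add_distrib]
    exact Finset.sum_congr rfl fun j _ => by noncomm_ring

/-- In the degree four part β²/2 of e^β, one of the three products pairs v with w and x with y;
subtracting β(x, y) times degree zero removes exactly that one. The other two are products of
contractions with i_x β and i_y β. -/
theorem bracketAct_expForm_two (β : T [⋀^Fin 2]→ₗ[ℝ] ℂ) (x y : T)
    (V U : Module.End ℂ S ⊗[ℝ] T) :
    bracketAct (expForm β) V U 2 ![x, y] - β ![x, y] • bracketAct (expForm β) V U 0 ![] =
      (coeff (slot β x) V * coeff (slot β y) U - coeff (slot β y) U * coeff (slot β x) V) -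
      (coeff (slot β y) V * coeff (slot β x) U - coeff (slot β x) U * coeff (slot β y) V) := by
  induction V using TensorProduct.induction_on with
  | zero => simp [bracketAct_zero_left]
  | tmul A v =>
    rw [bracketAct_tmul_left]
    induction U using TensorProduct.induction_on with
    | zero => simp
    | tmul B w =>
      rw [bracketActAux_tmul]
      simp only [tensMixed, tensForm_apply, interior_interior_zero_apply,
        interior_interior_two_apply, expForm_two_apply, expForm_four_apply, coeff_tmul, slot_apply]
      rw [alt_swap β w x, alt_swap β w y, alt_swap β v x, alt_swap β v y]
      simp only [smul_mul_assoc, mul_smul_comm]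
      module
    | add x y hx hy =>
      simp only [map_add, Pi.add_apply, AlternatingMap.add_apply, smul_add, mul_add, add_mul]
      rw [add_sub_add_comm, hx, hy]
      noncomm_ring
  | add x y hx hy =>
    simp only [bracketAct_add_left, map_add, Pi.add_apply, AlternatingMap.add_apply, smul_add,
      mul_add, add_mul]
    rw [add_sub_add_comm, hx, hy]
    noncomm_ring

variable [TopologicalSpace T]

theorem contract_tmul (a : GenTangent T) (w : W) (c : GenTangent T) :
    contract a (w ⊗ₜ[ℝ] c) = (2 * pairing a c) • w := rfl

theorem contract_covector (ξ : T →L[ℝ] ℝ) (t : W ⊗[ℝ] GenTangent T) :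
    contract ((0, ξ) : GenTangent T) t = coeff (Complex.ofRealCLM.toLinearMap ∘ₗ ξ.toLinearMap)
      (LinearMap.lTensor W (LinearMap.fst ℝ T (T →L[ℝ] ℝ)) t) := by
  induction t using TensorProduct.induction_on with
  | zero => simp
  | tmul A v => simp [contract_tmul, pairing]
  | add x y hx hy => simp only [map_add, hx, hy]

theorem coeff_rTensor_apply (g : T →ₗ[ℝ] ℂ) (s : S) (V : Module.End ℂ S ⊗[ℝ] T) :
    coeff g (LinearMap.rTensor T
      ((LinearMap.applyₗ s : Module.End ℂ S →ₗ[ℂ] S).restrictScalars ℝ) V) = coeff g V s := by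
  induction V using TensorProduct.induction_on with
  | zero => simp
  | tmul A v => simp
  | add x y hx hy => simp only [map_add, hx, hy, LinearMap.add_apply]

theorem contract_add (a c : GenTangent T) (t : W ⊗[ℝ] GenTangent T) :
    contract (a + c) t = contract a t + contract c t := by
  induction t using TensorProduct.induction_on with
  | zero => simp
  | tmul A v => simp only [contract_tmul, pairing, ← add_smul]; congr 1; simp; ring
  | add x y hx hy => simp only [map_add, hx, hy]; abel

theorem contract_smul (r : ℝ) (a : GenTangent T) (t : W ⊗[ℝ] GenTangent T) :
    contract (r • a) t = r • contract a t := by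
  induction t using TensorProduct.induction_on with
  | zero => simp
  | tmul A v => simp only [contract_tmul, pairing, smul_smul]; congr 1; simp; ring
  | add x y hx hy => simp only [map_add, hx, hy, smul_add]

theorem contract_neg (a : GenTangent T) (t : W ⊗[ℝ] GenTangent T) :
    contract (-a) t = -contract a t := by
  rw [← neg_one_smul ℝ a, contract_smul, neg_one_smul]

theorem contract_complex_smul (z : ℂ) (a : GenTangent T) (t : W ⊗[ℝ] GenTangent T) :
    contract a (z • t) = z • contract a t := by
  induction t using TensorProduct.induction_on with
  | zero => simp
  | tmul A v => rw [TensorProduct.smul_tmul', contract_tmul, contract_tmul, smul_comm]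
  | add x y hx hy => simp only [map_add, hx, hy, smul_add]

/-- An orthogonal complex structure is skew for the pairing. -/
theorem pairing_skew {J : GenTangent T →ₗ[ℝ] GenTangent T} (hsq : ∀ a, J (J a) = -a)
    (horth : ∀ a c, pairing (J a) (J c) = pairing a c) (a c : GenTangent T) :
    pairing (J a) c = -pairing a (J c) := by
  rw [← horth (J a) c, hsq]
  simp only [pairing, Prod.fst_neg, Prod.snd_neg, _root_.neg_apply, map_neg]
  ring

theorem contract_lTensor {J : GenTangent T →ₗ[ℝ] GenTangent T} (hsq : ∀ a, J (J a) = -a)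
    (horth : ∀ a c, pairing (J a) (J c) = pairing a c) (a : GenTangent T)
    (t : W ⊗[ℝ] GenTangent T) :
    contract a (LinearMap.lTensor W J t) = -contract (J a) t := by
  induction t using TensorProduct.induction_on with
  | zero => simp
  | tmul A v =>
    rw [LinearMap.lTensor_tmul, contract_tmul, contract_tmul, pairing_skew hsq horth, ← neg_smul]
    congr 1; ring
  | add x y hx hy => simp only [map_add, hx, hy]; abel

/-- If the `(0,1)`-part of `t` vanishes, contraction with `t` is complex linear for `J`. -/
theorem contract_of_proj01_eq_zero {J : GenTangent T →ₗ[ℝ] GenTangent T}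
    (hsq : ∀ a, J (J a) = -a) (horth : ∀ a c, pairing (J a) (J c) = pairing a c)
    {t : W ⊗[ℝ] GenTangent T} (ht : proj01 J t = 0) (a : GenTangent T) :
    contract (J a) t = Complex.I • contract a t := by
  have h1 : t = Complex.I • LinearMap.lTensor W J t := by
    have := (smul_eq_zero.mp ht).resolve_left (by norm_num)
    exact sub_eq_zero.mp this
  conv_rhs => rw [h1]
  rw [contract_complex_smul, contract_lTensor hsq horth, smul_smul, Complex.I_mul_I, smul_neg,
    neg_one_smul, neg_neg]

theorem cpx_mem_eigL {J : GenTangent T →ₗ[ℝ] GenTangent T} (hsq : ∀ a, J (J a) = -a)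
    (a : GenTangent T) : cpx a (J a) ∈ eigL J := by
  rw [eigL, Module.End.mem_eigenspace_iff]
  simp [cpx, hsq, TensorProduct.smul_tmul', TensorProduct.tmul_neg, add_comm,
    TensorProduct.neg_tmul]

/-- The complex structure with `-√-1`-eigenspace in the annihilator of `e^{b - √-1 Ω}`. -/
theorem induced_apply (b Ω : T [⋀^Fin 2]→ₗ[ℝ] ℝ) {J : GenTangent T →ₗ[ℝ] GenTangent T}
    (hsq : ∀ a, J (J a) = -a) (hJ : eigL J ≤ annihilator (expForm (complexForm b Ω)))
    (a : GenTangent T) (x : T) :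
    Ω ![(J a).1, x] = -(a.2 x + b ![a.1, x]) ∧
      (J a).2 x = Ω ![a.1, x] - b ![(J a).1, x] := by
  -- a + √-1 J a lies in ker e^β, so its covector i_v β + ξ is zero; the real and imaginary parts of
  -- this equation are the two claims.
  have h := annihilator_expForm (hJ (cpx_mem_eigL hsq a)) x
  simp only [spinCovector, complexForm_apply] at h
  have hr := congrArg Complex.re h
  have hi := congrArg Complex.im h
  simp at hr hi
  constructor <;> linarith

end VectorCoefficients

/-! ### Traces with respect to the generalized metric -/

section Trace

theorem exists_orthonormal_expansion {V : Type*} [AddCommGroup V] [Module ℝ V]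
    [FiniteDimensional ℝ V] (g : LinearMap.BilinForm ℝ V) (hs : LinearMap.IsSymm g)
    (hpos : ∀ v, v ≠ 0 → 0 < g v v) :
    ∃ A : Fin (Module.finrank ℝ V) → V, ∀ u, ∑ i, g u (A i) • A i = u := by
  obtain ⟨v, hv⟩ := LinearMap.BilinForm.exists_orthogonal_basis hs
  have hvv : ∀ i, 0 < g (v i) (v i) := fun i => hpos _ (v.ne_zero i)
  refine ⟨fun i => (Real.sqrt (g (v i) (v i)))⁻¹ • v i, fun u => ?_⟩
  have hu : ∀ i, g u (v i) = v.repr u i * g (v i) (v i) := by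
    intro i
    conv_lhs => rw [← v.sum_repr u]
    rw [map_sum, LinearMap.sum_apply, Finset.sum_eq_single i]
    · simp
    · intro j _ hj
      have : g (v j) (v i) = 0 := hv hj
      simp [this]
    · simp
  conv_rhs => rw [← v.sum_repr u]
  refine Finset.sum_congr rfl fun i _ => ?_
  rw [map_smul, smul_smul, smul_eq_mul, hu]
  congr 1
  have := Real.mul_self_sqrt (hvv i).le
  have h0 : Real.sqrt (g (v i) (v i)) ≠ 0 := (Real.sqrt_pos.mpr (hvv i)).ne'
  field_simp
  rw [← this]; ring_nf; rw [Real.sqrt_sq (Real.sqrt_nonneg _)]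

variable {T : Type*} [AddCommGroup T] [Module ℝ T] [TopologicalSpace T]

/-- The `1`-form `B(u, ·)` of a real `2`-form `B`. -/
def slotReal (B : T [⋀^Fin 2]→ₗ[ℝ] ℝ) (u : T) : T →ₗ[ℝ] ℝ :=
  Complex.reLm ∘ₗ slot (complexForm B 0) u

@[simp] theorem slotReal_apply (B : T [⋀^Fin 2]→ₗ[ℝ] ℝ) (u w : T) :
    slotReal B u w = B ![u, w] := by
  simp [slotReal]

/-- The pairing `2⟨Q a, c⟩` as a bilinear form. -/
def pairingForm (Q : GenTangent T →ₗ[ℝ] GenTangent T) : LinearMap.BilinForm ℝ (GenTangent T) :=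
  LinearMap.mk₂ ℝ (fun a c => 2 * pairing (Q a) c)
    (fun a a' c => by simp [pairing]; ring) (fun r a c => by simp [pairing]; ring)
    (fun a c c' => by simp [pairing]; ring) (fun r a c => by simp [pairing]; ring)

/-- The generalized metric `G = -J₁ J₂`. -/
def genMetric (J₁ J₂ : GenTangent T →ₗ[ℝ] GenTangent T) : GenTangent T →ₗ[ℝ] GenTangent T :=
  -(J₁ ∘ₗ J₂)

theorem genMetric_apply (J₁ J₂ : GenTangent T →ₗ[ℝ] GenTangent T) (a : GenTangent T) :
    genMetric J₁ J₂ a = -J₁ (J₂ a) := rfl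

/-- A `G`-orthonormal family `A` computes the traces of bilinear forms with respect to `G` in any
frame `X j`, `θ j`. -/
theorem exists_trace_frame [FiniteDimensional ℝ (GenTangent T)]
    {J₁ J₂ : GenTangent T →ₗ[ℝ] GenTangent T}
    (hsq₁ : ∀ a, J₁ (J₁ a) = -a) (hsq₂ : ∀ a, J₂ (J₂ a) = -a)
    (horth₁ : ∀ a c, pairing (J₁ a) (J₁ c) = pairing a c)
    (horth₂ : ∀ a c, pairing (J₂ a) (J₂ c) = pairing a c)
    (hcomm : ∀ a, J₁ (J₂ a) = J₂ (J₁ a))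
    (hpos : ∀ a, a ≠ 0 → 0 < pairing (-(J₁ (J₂ a))) a) (b : T [⋀^Fin 2]→ₗ[ℝ] ℝ) :
    ∃ A : Fin (Module.finrank ℝ (GenTangent T)) → GenTangent T,
      (∃ c : Fin (Module.finrank ℝ (GenTangent T)) → GenTangent T,
        ∀ u, ∑ k, (2 * pairing (c k) u) • A k = u) ∧
      ∀ {ι : Type} [Fintype ι] (X' θ' : ι → GenTangent T),
        (∀ v, ∑ j, (θ' j).2 v • (X' j).1 = v) → (∀ j v, (X' j).2 v = -b ![(X' j).1, v]) →
        (∀ j, (θ' j).1 = 0) → ∀ B : GenTangent T →ₗ[ℝ] GenTangent T →ₗ[ℝ] ℝ,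
          ∑ j, (B (X' j) (genMetric J₁ J₂ (θ' j)) + B (θ' j) (genMetric J₁ J₂ (X' j))) =
            ∑ k, B (A k) (A k) := by
  have hsymm : ∀ a c : GenTangent T, pairing a c = pairing c a := fun a c => by
    simp only [pairing]; ring
  have hneg : ∀ a c : GenTangent T, pairing (-a) c = -pairing a c := fun a c => by
    simp [pairing]; ring
  -- Both structures are skew for the pairing and they commute, so G is self-adjoint and G² = 1.
  have hG : ∀ a c, pairing (genMetric J₁ J₂ a) c = pairing a (genMetric J₁ J₂ c) := by
    intro a c
    rw [genMetric_apply, genMetric_apply, hneg, pairing_skew hsq₁ horth₁,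
      pairing_skew hsq₂ horth₂, ← hcomm, hsymm a (-_), hneg, hsymm a]
    ring
  have hGG : ∀ a, genMetric J₁ J₂ (genMetric J₁ J₂ a) = a := by
    intro a
    simp only [genMetric_apply, map_neg, neg_neg]
    rw [← hcomm (J₂ a), hsq₂, hsq₁, neg_neg]
  obtain ⟨A, hA⟩ := exists_orthonormal_expansion (pairingForm (genMetric J₁ J₂))
    ⟨fun a c => by
      change 2 * pairing _ _ = 2 * pairing _ _
      rw [hG, hsymm]⟩
    (fun a ha => by
      have := hpos a ha
      change 0 < 2 * pairing _ _
      rw [genMetric_apply]; linarith)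
  have hA' : ∀ u, ∑ k, (2 * pairing (genMetric J₁ J₂ u) (A k)) • A k = u := hA
  refine ⟨A, ?_, ?_⟩
  · exact ⟨fun k => genMetric J₁ J₂ (A k), fun u => by
      conv_rhs => rw [← hA' u]
      exact Finset.sum_congr rfl fun k _ => by rw [hG, hsymm]⟩
  · intro ι _ X' θ' hid hX' hθ B
    -- The X - i_X b span an isotropic complement of the covectors, so these families reconstruct u
    -- through the neutral pairing; the terms containing b cancel because b is alternating.
    have hexp : ∀ u, ∑ j, ((2 * pairing (θ' j) u) • X' j + (2 * pairing (X' j) u) • θ' j) = u := by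
      intro u
      have hb : ∀ z y, ∑ j, (θ' j).2 z * b ![(X' j).1, y] = b ![z, y] := by
        intro z y
        have h1 := congrArg (fun v => slotReal b y v) (hid z)
        simp only [map_sum, map_smul, smul_eq_mul, slotReal_apply] at h1
        rw [alt_swap b z y, ← h1, ← Finset.sum_neg_distrib]
        exact Finset.sum_congr rfl fun j _ => by rw [alt_swap b _ y, mul_neg]
      have hl : ∀ y, ∑ j, (θ' j).2 y * u.2 (X' j).1 = u.2 y := by
        intro y
        conv_rhs => rw [← hid y]
        simp
      refine Prod.ext ?_ (ContinuousLinearMap.ext fun y => ?_)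
      · simp only [Prod.fst_sum, Prod.fst_add, Prod.smul_fst, hθ, smul_zero, add_zero, pairing]
        conv_rhs => rw [← hid u.1]
        exact Finset.sum_congr rfl fun j _ => by
          congr 1
          simp
      · simp only [Prod.snd_sum, Prod.snd_add, Prod.smul_snd, _root_.sum_apply,
          _root_.add_apply, _root_.smul_apply, smul_eq_mul, pairing, hθ, hX', map_zero]
        have e : ∀ j, 2 * (1 / 2 * ((θ' j).2 u.1 + 0)) * -b ![(X' j).1, y] +
            2 * (1 / 2 * (-b ![(X' j).1, u.1] + u.2 (X' j).1)) * (θ' j).2 y =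
            -((θ' j).2 u.1 * b ![(X' j).1, y]) + (θ' j).2 y * u.2 (X' j).1
              - (θ' j).2 y * b ![(X' j).1, u.1] := fun j => by ring
        rw [Finset.sum_congr rfl fun j _ => e j, Finset.sum_sub_distrib, Finset.sum_add_distrib,
          Finset.sum_neg_distrib, hb u.1 y, hl, hb y u.1, alt_swap b y u.1]
        ring
    -- The orthonormal expansion of Ga has coefficients 2⟨GGa, A_k⟩ = 2⟨a, A_k⟩. Substituting it
    -- turns the trace in the frame into the sum over A_k.
    have hG2 : ∀ a, genMetric J₁ J₂ a = ∑ k, (2 * pairing a (A k)) • A k := by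
      intro a
      conv_lhs => rw [← hA' (genMetric J₁ J₂ a)]
      rw [hGG]
    have : ∀ j, B (X' j) (genMetric J₁ J₂ (θ' j)) + B (θ' j) (genMetric J₁ J₂ (X' j)) =
        ∑ k, B ((2 * pairing (θ' j) (A k)) • X' j + (2 * pairing (X' j) (A k)) • θ' j) (A k) := by
      intro j
      rw [hG2 (θ' j), hG2 (X' j)]
      simp [Finset.sum_add_distrib]
    rw [Finset.sum_congr rfl fun j _ => this j, Finset.sum_comm]
    refine Finset.sum_congr rfl fun k _ => ?_
    rw [← LinearMap.sum_apply, ← map_sum, hexp]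

end Trace

end GenKahler

end

noncomputable section

namespace GenKahler

set_option linter.unusedSectionVars false

/-! ### Derivatives of |s|² for a generalized Hermitian connection -/

section Bochner

variable {H : Type*} [NormedAddCommGroup H] [NormedSpace ℝ H]
variable {M : Type*} [TopologicalSpace M] [ChartedSpace H M] [IsManifold 𝓘(ℝ, H) ∞ M]
variable {F : Type*} [NormedAddCommGroup F] [NormedSpace ℂ F]
variable {E : M → Type*} [∀ x, AddCommGroup (E x)] [∀ x, Module ℂ (E x)]
  [∀ x, TopologicalSpace (E x)] [TopologicalSpace (Bundle.TotalSpace F E)] [FiberBundle F E]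

/-- The derivative `𝒟_a s` along a section `a` of `TM ⊕ T*M`. -/
def along (D : GenConnection H F E) (a : (x : M) → GenTangent (Tan H x)) (s : (x : M) → E x)
    (x : M) : E x :=
  contract (a x) (D.toFun s x)

/-- The `1`-form `B(u, ·)` of a real `2`-form `B`. -/
def contractTwo {T : Type*} [AddCommGroup T] [Module ℝ T] [TopologicalSpace T]
    (B : T [⋀^Fin 2]→L[ℝ] ℝ) (u : T) : T →L[ℝ] ℝ :=
  B.toContinuousMultilinearMap.toContinuousLinearMap ![u, 0] 1

@[simp] theorem contractTwo_apply {T : Type*} [AddCommGroup T] [Module ℝ T] [TopologicalSpace T]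
    (B : T [⋀^Fin 2]→L[ℝ] ℝ) (u v : T) : contractTwo B u v = B ![u, v] := by
  change B (Function.update ![u, 0] 1 v) = B ![u, v]
  congr 1
  ext i; fin_cases i <;> simp

/-- The covector field `i_X B`, as a section of `TM ⊕ T*M`. -/
def covectorOf (B : (x : M) → Tan H x [⋀^Fin 2]→L[ℝ] ℝ) (X : (x : M) → Tan H x) (x : M) :
    GenTangent (Tan H x) :=
  (0, contractTwo (B x) (X x))

/-- The vector field `X`, as a section of `TM ⊕ T*M`. -/
def vectorOf (X : (x : M) → Tan H x) (x : M) : GenTangent (Tan H x) := (X x, 0)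

theorem smoothVF_zero : SmoothVF (fun x : M => (0 : Tan H x)) :=
  Bundle.contMDiff_zeroSection ℝ (TangentSpace 𝓘(ℝ, H) : M → Type _)

theorem SmoothVF.neg {X : (x : M) → Tan H x} (hX : SmoothVF X) : SmoothVF (fun x => -X x) :=
  ContMDiff.neg_section hX

theorem SmoothOneForm.neg {ξ : (x : M) → Tan H x →L[ℝ] ℝ} (hξ : SmoothOneForm ξ) :
    SmoothOneForm (fun x => -ξ x) :=
  fun X hX => (hξ X hX).neg

theorem smoothOneForm_zero : SmoothOneForm (fun x : M => (0 : Tan H x →L[ℝ] ℝ)) :=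
  fun _ _ => contMDiff_const

theorem SmoothGen.neg {a : (x : M) → GenTangent (Tan H x)} (ha : SmoothGen a) :
    SmoothGen (fun x => -a x) :=
  ⟨ha.1.neg, ha.2.neg⟩

theorem smoothGen_vectorOf {X : (x : M) → Tan H x} (hX : SmoothVF X) : SmoothGen (vectorOf X) :=
  ⟨hX, smoothOneForm_zero⟩

theorem smoothGen_covector {ξ : (x : M) → Tan H x →L[ℝ] ℝ} (hξ : SmoothOneForm ξ) :
    SmoothGen (fun x => ((0, ξ x) : GenTangent (Tan H x))) :=
  ⟨smoothVF_zero, hξ⟩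

theorem SmoothTwoForm.contract {B : (x : M) → Tan H x [⋀^Fin 2]→L[ℝ] ℝ} (hB : SmoothTwoForm B)
    {X : (x : M) → Tan H x} (hX : SmoothVF X) :
    SmoothOneForm (fun x => contractTwo (B x) (X x)) := fun Y hY => by
  simpa using hB X Y hX hY

theorem smoothGen_covectorOf {B : (x : M) → Tan H x [⋀^Fin 2]→L[ℝ] ℝ} (hB : SmoothTwoForm B)
    {X : (x : M) → Tan H x} (hX : SmoothVF X) : SmoothGen (covectorOf B X) :=
  smoothGen_covector (hB.contract hX)

theorem smoothVF_mlieBracket [CompleteSpace H] {X Y : (x : M) → Tan H x} (hX : SmoothVF X) (hY : SmoothVF Y) :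
    SmoothVF (VectorField.mlieBracket 𝓘(ℝ, H) X Y) := by
  intro x
  have : IsManifold 𝓘(ℝ, H) (minSmoothness ℝ 2) M := by
    rw [minSmoothness_of_isRCLikeNormedField]
    exact IsManifold.of_le (n := ∞) ENat.LEInfty.out
  have : IsManifold 𝓘(ℝ, H) (((⊤ : ℕ∞) : WithTop ℕ∞) + 1) M := ‹IsManifold 𝓘(ℝ, H) ∞ M›
  exact ContMDiffAt.mlieBracket_vectorField (m := ⊤) (n := ⊤) (hX x) (hY x) (by simp)

variable (D : GenConnection H F E) (h : HermitianMetric H F E)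

theorem smooth_along {a : (x : M) → GenTangent (Tan H x)} {s : (x : M) → E x} (ha : SmoothGen a)
    (hs : SmoothSection H F s) : SmoothSection H F (along D a s) :=
  D.smooth a s ha hs

/-- The real part of the Hermitian metric. -/
def reForm (x : M) (v w : E x) : ℝ := (h.form x v w).re

theorem reForm_comm (x : M) (v w : E x) : reForm h x v w = reForm h x w v := by
  rw [reForm, reForm, h.conj_symm x v w, Complex.conj_re]

theorem reForm_add_left (x : M) (v v' w : E x) :
    reForm h x (v + v') w = reForm h x v w + reForm h x v' w := by simp [reForm]

theorem reForm_sub_left (x : M) (v v' w : E x) :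
    reForm h x (v - v') w = reForm h x v w - reForm h x v' w := by simp [reForm]

theorem reForm_smul_left (x : M) (r : ℝ) (v w : E x) :
    reForm h x (r • v) w = r * reForm h x v w := by
  rw [reForm, ← Complex.coe_smul, map_smul, LinearMap.smul_apply, smul_eq_mul,
    Complex.re_ofReal_mul, reForm]

theorem reForm_sum_left {ι : Type*} (t : Finset ι) (x : M) (v : ι → E x) (w : E x) :
    reForm h x (∑ j ∈ t, v j) w = ∑ j ∈ t, reForm h x (v j) w := by
  simp [reForm, LinearMap.sum_apply]

/-- The real part of the Hermitian metric as a bilinear form. -/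
def reBilin (x : M) : E x →ₗ[ℝ] E x →ₗ[ℝ] ℝ :=
  LinearMap.mk₂ ℝ (reForm h x) (reForm_add_left h x) (reForm_smul_left h x)
    (fun v w w' => by
      rw [reForm_comm, reForm_add_left, reForm_comm h x w, reForm_comm h x w'])
    (fun r v w => by rw [reForm_comm, reForm_smul_left, reForm_comm h x w]; rfl)

theorem reForm_skew {x : M} {N : Module.End ℂ (E x)}
    (hN : ∀ v w, h.form x (N v) w = -h.form x v (N w)) (v : E x) : reForm h x (N v) v = 0 := by
  have h1 : reForm h x (N v) v = -reForm h x v (N v) := by rw [reForm, hN]; rfl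
  rw [reForm_comm h x v] at h1
  linarith

/-- The function `|s|²`. -/
def normSq (s : (x : M) → E x) (x : M) : ℝ := reForm h x (s x) (s x)

theorem contMDiff_reForm {s t : (x : M) → E x} (hs : SmoothSection H F s)
    (ht : SmoothSection H F t) :
    ContMDiff 𝓘(ℝ, H) 𝓘(ℝ, ℝ) ∞ (fun x => reForm h x (s x) (t x)) :=
  Complex.reCLM.contMDiff.comp (h.smooth s t hs ht)

theorem mvfderiv_re {g : M → ℂ} {x : M} (hg : MDifferentiableAt 𝓘(ℝ, H) 𝓘(ℝ, ℂ) g x)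
    (v : Tan H x) :
    mvfderiv 𝓘(ℝ, H) (fun y => (g y).re) x v = (mvfderiv 𝓘(ℝ, H) g x v).re := by
  have := (Complex.reCLM.hasFDerivAt.hasMFDerivAt.comp x hg.hasMFDerivAt).mfderiv
  change (mfderiv 𝓘(ℝ, H) 𝓘(ℝ, ℝ) (Complex.reCLM ∘ g) x : Tan H x → ℝ) v = _
  rw [this]
  rfl

variable {D h} in
theorem mvfderiv_reForm (hD : IsHermitianConnection h D) {s t : (x : M) → E x}
    (hs : SmoothSection H F s) (ht : SmoothSection H F t) (x : M)
    (a : (x : M) → GenTangent (Tan H x)) :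
    mvfderiv 𝓘(ℝ, H) (fun y => reForm h y (s y) (t y)) x (a x).1 =
      reForm h x (along D a s x) (t x) + reForm h x (s x) (along D a t x) := by
  have h1 := mvfderiv_re (((h.smooth s t hs ht) x).mdifferentiableAt (by simp)) (a x).1
  refine h1.trans ?_
  have h2 := congrArg Complex.re (hD s t hs ht x (a x))
  rw [Complex.add_re] at h2
  exact h2

variable {D h} in
theorem mvfderiv_normSq (hD : IsHermitianConnection h D) {s : (x : M) → E x}
    (hs : SmoothSection H F s) (x : M) (a : (x : M) → GenTangent (Tan H x)) :
    mvfderiv 𝓘(ℝ, H) (normSq h s) x (a x).1 = 2 * reForm h x (along D a s x) (s x) := by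
  have := mvfderiv_reForm hD hs hs x a
  rw [reForm_comm h x (s x)] at this
  rw [two_mul]
  exact this

variable {D h} in
/-- The second derivative of `|s|²` along two sections of `TM ⊕ T*M`. -/
theorem mvfderiv_mvfderiv_normSq (hD : IsHermitianConnection h D) {s : (x : M) → E x}
    (hs : SmoothSection H F s) (x : M) {a c : (x : M) → GenTangent (Tan H x)}
    (hc : SmoothGen c) :
    mvfderiv 𝓘(ℝ, H) (fun y => mvfderiv 𝓘(ℝ, H) (normSq h s) y (c y).1) x (a x).1 =
      2 * reForm h x (along D a (along D c s) x) (s x)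
        + 2 * reForm h x (along D a s x) (along D c s x) := by
  have e : (fun y => mvfderiv 𝓘(ℝ, H) (normSq h s) y (c y).1) =
      fun y => reForm h y (along D c s y) (s y) + reForm h y (along D c s y) (s y) := by
    funext y; rw [mvfderiv_normSq hD hs, two_mul]
  have hc' := smooth_along D hc hs
  have hd : MDifferentiableAt 𝓘(ℝ, H) 𝓘(ℝ, ℝ) (fun y => reForm h y (along D c s y) (s y)) x :=
    (contMDiff_reForm h hc' hs x).mdifferentiableAt (by simp)
  rw [e, mvfderiv_fun_add hd hd, _root_.add_apply, mvfderiv_reForm hD hc' hs,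
    reForm_comm h x (along D c s x)]
  ring

variable {D h} in
/-- The curvature along a covector and a section of `TM ⊕ T*M` is skew-Hermitian. -/
theorem reForm_commutator_covector (hD : IsHermitianConnection h D) {s : (x : M) → E x}
    (hs : SmoothSection H F s) (x : M) {a c : (x : M) → GenTangent (Tan H x)}
    (ha : SmoothGen a) (hc : SmoothGen c) (hc0 : ∀ y, (c y).1 = 0) :
    reForm h x (along D a (along D c s) x) (s x) =
      reForm h x (along D c (along D a s) x) (s x) := by
  -- Both iterated derivatives of |s|² vanish, as c has no vector part. The products of first
  -- derivatives in them agree by symmetry, hence so do the second-order terms.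
  have h1 := mvfderiv_mvfderiv_normSq hD hs x (a := a) hc
  have h2 := mvfderiv_mvfderiv_normSq hD hs x (a := c) ha
  simp only [hc0, map_zero] at h1 h2
  rw [mvfderiv_const] at h1
  rw [_root_.zero_apply] at h1
  rw [reForm_comm h x (along D c s x)] at h2
  linarith

end Bochner

end GenKahler

end

noncomputable section

namespace GenKahler

set_option linter.unusedSectionVars false

/-! ### The generalized curvature as commutators of derivatives -/

section Curvature

variable {H : Type*} [NormedAddCommGroup H] [NormedSpace ℝ H]
variable {M : Type*} [TopologicalSpace M] [ChartedSpace H M] [IsManifold 𝓘(ℝ, H) ∞ M]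
variable {F : Type*} [NormedAddCommGroup F] [NormedSpace ℂ F]
variable {E : M → Type*} [∀ x, AddCommGroup (E x)] [∀ x, Module ℂ (E x)]
  [∀ x, TopologicalSpace (E x)] [TopologicalSpace (Bundle.TotalSpace F E)] [FiberBundle F E]

/-- The complex form `b - √-1 Ω` at a point. -/
def complexFormAt (b Ω : (x : M) → Tan H x [⋀^Fin 2]→L[ℝ] ℝ) (x : M) : Tan H x [⋀^Fin 2]→ₗ[ℝ] ℂ :=
  complexForm (b x).toAlternatingMap (Ω x).toAlternatingMap

theorem psi_eq (b Ω : (x : M) → Tan H x [⋀^Fin 2]→L[ℝ] ℝ) (x : M) :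
    psi b Ω x = expForm (complexFormAt b Ω x) := rfl

variable (D : GenConnection H F E) (b Ω : (x : M) → Tan H x [⋀^Fin 2]→L[ℝ] ℝ)

/-- The derivative along the complex covector `-i_X (b - √-1 Ω)`. -/
def alongCovector (X : (x : M) → Tan H x) (t : (x : M) → E x) (x : M) : E x :=
  -along D (covectorOf b X) t x + Complex.I • along D (covectorOf Ω X) t x

/-- The derivative along the element `X - i_X (b - √-1 Ω)` of `ker ψ`. -/
def alongKer (X : (x : M) → Tan H x) (t : (x : M) → E x) (x : M) : E x :=
  along D (vectorOf X) t x + alongCovector D b Ω X t x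

variable {D} {V : (x : M) → Module.End ℂ (E x) ⊗[ℝ] Tan H x}

/-- A covector pairs only with the vector part of 𝒟t, so the derivative along it is of order zero
and is given by V. This translates the algebra of V into derivatives of sections. -/
theorem IsVectorPart.coeff_apply (hV : IsVectorPart D V) {t : (x : M) → E x}
    (ht : SmoothSection H F t) (x : M) (ξ : Tan H x →L[ℝ] ℝ) :
    coeff (Complex.ofRealCLM.toLinearMap ∘ₗ ξ.toLinearMap) (V x) (t x) =
      contract ((0, ξ) : GenTangent (Tan H x)) (D.toFun t x) := by
  rw [contract_covector, ← hV t ht x, coeff_rTensor_apply]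

theorem slot_complexFormAt (x : M) (v : Tan H x) : slot (complexFormAt b Ω x) v =
    Complex.ofRealCLM.toLinearMap ∘ₗ (contractTwo (b x) v).toLinearMap +
      (-Complex.I) • (Complex.ofRealCLM.toLinearMap ∘ₗ (contractTwo (Ω x) v).toLinearMap) := by
  ext w
  simp [complexFormAt]
  ring

theorem IsVectorPart.coeff_slot (hV : IsVectorPart D V) {t : (x : M) → E x}
    (ht : SmoothSection H F t) (X : (x : M) → Tan H x) (x : M) :
    coeff (slot (complexFormAt b Ω x) (X x)) (V x) (t x) = -alongCovector D b Ω X t x := by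
  rw [slot_complexFormAt, coeff_add, coeff_smul, LinearMap.add_apply, LinearMap.smul_apply,
    hV.coeff_apply ht, hV.coeff_apply ht, alongCovector, along, along, covectorOf, covectorOf]
  module

theorem IsVectorPart.vecAct_apply (hV : IsVectorPart D V) {t : (x : M) → E x}
    (ht : SmoothSection H F t) (X : (x : M) → Tan H x) (x : M) :
    vecAct (psi b Ω x) (V x) 1 ![X x] (t x) = alongCovector D b Ω X t x := by
  rw [psi_eq, vecAct_expForm_one, LinearMap.neg_apply, hV.coeff_slot b Ω ht, neg_neg]

theorem along_add_section {s t : (x : M) → E x} (hs : SmoothSection H F s)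
    (ht : SmoothSection H F t) (a : (x : M) → GenTangent (Tan H x)) (x : M) :
    along D a (fun y => s y + t y) x = along D a s x + along D a t x := by
  rw [along, D.add s t hs ht, map_add]; rfl

theorem along_smul_section (c : ℂ) {s : (x : M) → E x} (hs : SmoothSection H F s)
    (a : (x : M) → GenTangent (Tan H x)) (x : M) :
    along D a (fun y => c • s y) x = c • along D a s x := by
  rw [along, D.smul c s hs, contract_complex_smul]; rfl

/-- `ℱ_2 - ℱ_0 β` is the curvature of the generalized connection along `ker ψ`. -/
theorem genCurvature_two_apply {R : (x : M) → Tan H x [⋀^Fin 2]→ₗ[ℝ] Module.End ℂ (E x)}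
    {Ψ 𝓕 : (x : M) → MixedForm (Tan H x) (Module.End ℂ (E x))}
    (hV : IsVectorPart D V) (hR : IsCurvature D R)
    (hΨ : IsExtCovDeriv D (fun x => vecAct (psi b Ω x) (V x)) Ψ)
    (h𝓕 : ∀ x, 𝓕 x = wedgeTwoMixed (R x) (psi b Ω x) + Ψ x
      + (1 / 2 : ℂ) • bracketAct (psi b Ω x) (V x) (V x))
    {s : (x : M) → E x} (hs : SmoothSection H F s)
    (hcov : ∀ X : (x : M) → Tan H x, SmoothVF X → SmoothSection H F (alongCovector D b Ω X s))
    {X Y : (x : M) → Tan H x} (hX : SmoothVF X) (hY : SmoothVF Y) (x : M) :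
    (𝓕 x 2 ![X x, Y x] - complexFormAt b Ω x ![X x, Y x] • 𝓕 x 0 ![]) (s x) =
      alongKer D b Ω X (alongKer D b Ω Y s) x - alongKer D b Ω Y (alongKer D b Ω X s) x
        - alongKer D b Ω (VectorField.mlieBracket 𝓘(ℝ, H) X Y) s x := by
  have hXs := smooth_along D (smoothGen_vectorOf hX) hs
  have hYs := smooth_along D (smoothGen_vectorOf hY) hs
  have hR2 : wedgeTwoMixed (R x) (psi b Ω x) 2 ![X x, Y x] (s x) =
      along D (vectorOf X) (along D (vectorOf Y) s) x
        - along D (vectorOf Y) (along D (vectorOf X) s) x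
        - along D (vectorOf (VectorField.mlieBracket 𝓘(ℝ, H) X Y)) s x := by
    have : wedgeTwoMixed (R x) (psi b Ω x) 2 ![X x, Y x] = R x ![X x, Y x] :=
      wedgeTwo_const (R x) (X x) (Y x)
    rw [this]
    exact hR X Y s hX hY hs x
  have hcovEnd : ∀ Z W : (x : M) → Tan H x, SmoothVF Z → SmoothVF W →
      covEnd D (fun y => vecAct (psi b Ω y) (V y) 1 ![Z y]) s x (W x) =
        along D (vectorOf W) (alongCovector D b Ω Z s) x
          - alongCovector D b Ω Z (along D (vectorOf W) s) x := by
    intro Z W hZ hW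
    have e1 : (fun y => vecAct (psi b Ω y) (V y) 1 ![Z y] (s y)) = alongCovector D b Ω Z s :=
      funext fun y => hV.vecAct_apply b Ω hs Z y
    have e2 := hV.vecAct_apply b Ω (smooth_along D (smoothGen_vectorOf hW) hs) Z x
    rw [covEnd, e1, ← e2]
    rfl
  have hΨ2 : Ψ x 2 ![X x, Y x] (s x) =
      (along D (vectorOf X) (alongCovector D b Ω Y s) x
        - alongCovector D b Ω Y (along D (vectorOf X) s) x)
      - (along D (vectorOf Y) (alongCovector D b Ω X s) x
        - alongCovector D b Ω X (along D (vectorOf Y) s) x)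
      - alongCovector D b Ω (VectorField.mlieBracket 𝓘(ℝ, H) X Y) s x := by
    have h2 := hΨ.add_two 0 ![X, Y] s (by intro i; fin_cases i <;> assumption) hs x
    have e : (fun i => (![X, Y] : Fin 2 → (x : M) → Tan H x) i x) = ![X x, Y x] := by
      ext i; fin_cases i <;> rfl
    rw [e] at h2
    refine h2.trans ?_
    have e0 : ∀ y, (0 : Fin 2).removeNth (fun k => (![X, Y] : Fin 2 → (x : M) → Tan H x) k y)
        = ![Y y] := by
      intro y; ext i; fin_cases i; rfl
    have e1 : ∀ y, (1 : Fin 2).removeNth (fun k => (![X, Y] : Fin 2 → (x : M) → Tan H x) k y)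
        = ![X y] := by
      intro y; ext i; fin_cases i; rfl
    rw [← hcovEnd Y X hY hX, ← hcovEnd X Y hX hY,
      ← hV.vecAct_apply b Ω hs (VectorField.mlieBracket 𝓘(ℝ, H) X Y) x]
    rw [Fin.sum_univ_two, Fin.sum_univ_one]
    simp only [e0, e1]
    have e2 : (Finset.Ici (0 : Fin 1)) = {0} := by decide
    rw [e2, Finset.sum_singleton]
    have e3 : (Matrix.vecCons (VectorField.mlieBracket 𝓘(ℝ, H)
        ((![X, Y] : Fin 2 → (x : M) → Tan H x) (Fin.castSucc 0))
        ((![X, Y] : Fin 2 → (x : M) → Tan H x) (Fin.succ 0)) x)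
        ((0 : Fin 1).removeNth ((Fin.castSucc (0 : Fin 1)).removeNth ![X x, Y x]))) =
        ![VectorField.mlieBracket 𝓘(ℝ, H) X Y x] := by
      ext i; fin_cases i; rfl
    rw [e3]
    simp [sub_eq_add_neg]
  -- F_A supplies the commutator of derivatives along vectors, d^A (V · ψ) the mixed terms, and
  -- (1/2)[V · V] the commutator along covectors: with both arguments equal to V the bracket formula
  -- gives twice that commutator. These are the four kinds of terms in the expansion of derivatives
  -- along ker ψ.
  have hB := congrArg (fun A : Module.End ℂ (E x) => A (s x))
    (bracketAct_expForm_two (complexFormAt b Ω x) (X x) (Y x) (V x) (V x))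
  have hcc : ∀ Z W : (x : M) → Tan H x, SmoothVF Z → SmoothVF W →
      coeff (slot (complexFormAt b Ω x) (W x)) (V x)
        (coeff (slot (complexFormAt b Ω x) (Z x)) (V x) (s x)) =
      alongCovector D b Ω W (alongCovector D b Ω Z s) x := by
    intro Z W hZ _
    rw [hV.coeff_slot b Ω hs, map_neg, hV.coeff_slot b Ω (hcov Z hZ), neg_neg]
  have hK : ∀ Z W : (x : M) → Tan H x, SmoothVF Z → SmoothVF W →
      alongKer D b Ω Z (alongKer D b Ω W s) x =
        along D (vectorOf Z) (along D (vectorOf W) s) x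
        + along D (vectorOf Z) (alongCovector D b Ω W s) x
        + alongCovector D b Ω Z (along D (vectorOf W) s) x
        + alongCovector D b Ω Z (alongCovector D b Ω W s) x := by
    intro Z W _ hW
    have hWs := smooth_along D (smoothGen_vectorOf hW) hs
    have e : alongKer D b Ω W s =
      fun y => along D (vectorOf W) s y + alongCovector D b Ω W s y := rfl
    rw [alongKer, e, along_add_section hWs (hcov W hW), alongCovector,
      along_add_section hWs (hcov W hW), along_add_section hWs (hcov W hW), alongCovector,
      alongCovector]
    module
  have h0 : 𝓕 x 0 ![] = (1 / 2 : ℂ) • bracketAct (psi b Ω x) (V x) (V x) 0 ![] := by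
    rw [h𝓕, Pi.add_apply, Pi.add_apply, hΨ.zero]
    simp [wedgeTwoMixed]
  have h2 : 𝓕 x 2 ![X x, Y x] = wedgeTwoMixed (R x) (psi b Ω x) 2 ![X x, Y x]
      + Ψ x 2 ![X x, Y x] + (1 / 2 : ℂ) • bracketAct (psi b Ω x) (V x) (V x) 2 ![X x, Y x] := by
    rw [h𝓕]; rfl
  rw [h0, h2, hK X Y hX hY, hK Y X hY hX]
  simp only [LinearMap.sub_apply, LinearMap.smul_apply, Module.End.mul_apply, hcc X Y hX hY,
    hcc Y X hY hX, ← psi_eq] at hB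
  simp only [LinearMap.sub_apply, LinearMap.add_apply, LinearMap.smul_apply, hR2, hΨ2]
  have hB' := congrArg (fun v => (1 / 2 : ℂ) • v) hB
  simp only [smul_sub] at hB'
  rw [smul_comm (1 / 2 : ℂ)] at hB'
  rw [alongKer]
  rw [add_sub_assoc, hB']
  module

/-- In degree zero only (1/2)[V · V] survives: wedging with F_A raises the degree by two, and d^A
raises it by one. -/
theorem genCurvature_zero_apply {R : (x : M) → Tan H x [⋀^Fin 2]→ₗ[ℝ] Module.End ℂ (E x)}
    {Ψ 𝓕 : (x : M) → MixedForm (Tan H x) (Module.End ℂ (E x))}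
    (hV : IsVectorPart D V) 
    (hΨ : IsExtCovDeriv D (fun x => vecAct (psi b Ω x) (V x)) Ψ)
    (h𝓕 : ∀ x, 𝓕 x = wedgeTwoMixed (R x) (psi b Ω x) + Ψ x
      + (1 / 2 : ℂ) • bracketAct (psi b Ω x) (V x) (V x))
    {s : (x : M) → E x} (hs : SmoothSection H F s)
    (hcov : ∀ X : (x : M) → Tan H x, SmoothVF X → SmoothSection H F (alongCovector D b Ω X s))
    {ι : Type*} [Fintype ι] {X : ι → (x : M) → Tan H x} (hX : ∀ j, SmoothVF (X j))
    {θ : ι → (x : M) → Tan H x →L[ℝ] ℝ} (hθ : ∀ j, SmoothOneForm (θ j)) (x : M)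
    (hid : ∀ v : Tan H x, ∑ j, θ j x v • X j x = v) :
    𝓕 x 0 ![] (s x) = (1 / 2 : ℂ) • ∑ j,
      (along D (fun y => (0, θ j y)) (alongCovector D b Ω (X j) s) x
        - alongCovector D b Ω (X j) (along D (fun y => (0, θ j y)) s) x) := by
  have h0 : 𝓕 x 0 ![] = (1 / 2 : ℂ) • bracketAct (psi b Ω x) (V x) (V x) 0 ![] := by
    rw [h𝓕, Pi.add_apply, Pi.add_apply, hΨ.zero]
    simp [wedgeTwoMixed]
  rw [h0, psi_eq, bracketAct_expForm_zero (complexFormAt b Ω x) (fun j => X j x)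
    (fun j => Complex.ofRealCLM.toLinearMap ∘ₗ (θ j x).toLinearMap)
    (fun g v => by
      conv_rhs => rw [← hid v]
      simp [map_sum])]
  rw [LinearMap.smul_apply, LinearMap.sum_apply]
  congr 1
  refine Finset.sum_congr rfl fun j _ => ?_
  rw [LinearMap.sub_apply, Module.End.mul_apply, Module.End.mul_apply, hV.coeff_apply hs,
    hV.coeff_slot b Ω hs, map_neg, hV.coeff_apply (hcov _ (hX j))]
  have := hV.coeff_slot b Ω (smooth_along D (smoothGen_covector (hθ j)) hs) (X j) x
  rw [along] at this
  rw [this, along]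
  abel

end Curvature

end GenKahler

end

noncomputable section

namespace GenKahler

set_option linter.unusedSectionVars false

/-! ### The Bochner identity for holomorphic sections -/

section BochnerIdentity

variable {H : Type*} [NormedAddCommGroup H] [NormedSpace ℝ H]
variable {M : Type*} [TopologicalSpace M] [ChartedSpace H M] [IsManifold 𝓘(ℝ, H) ∞ M]
variable {F : Type*} [NormedAddCommGroup F] [NormedSpace ℂ F]
variable {E : M → Type*} [∀ x, AddCommGroup (E x)] [∀ x, Module ℂ (E x)]
  [∀ x, TopologicalSpace (E x)] [TopologicalSpace (Bundle.TotalSpace F E)] [FiberBundle F E]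

theorem SmoothGen.add {a c : (x : M) → GenTangent (Tan H x)} (ha : SmoothGen a)
    (hc : SmoothGen c) : SmoothGen (fun x => a x + c x) :=
  ⟨ContMDiff.add_section ha.1 hc.1, fun X hX => (ha.2 X hX).add (hc.2 X hX)⟩

/-- The section `X - i_X b` of `TM ⊕ T*M`. -/
def shear (b : (x : M) → Tan H x [⋀^Fin 2]→L[ℝ] ℝ) (X : (x : M) → Tan H x) (x : M) :
    GenTangent (Tan H x) :=
  (X x, -contractTwo (b x) (X x))

theorem smoothGen_shear {b : (x : M) → Tan H x [⋀^Fin 2]→L[ℝ] ℝ} (hb : SmoothTwoForm b)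
    {X : (x : M) → Tan H x} (hX : SmoothVF X) : SmoothGen (shear b X) :=
  ⟨hX, (hb.contract hX).neg⟩

theorem alongKer_eq (D : GenConnection H F E) (b Ω : (x : M) → Tan H x [⋀^Fin 2]→L[ℝ] ℝ)
    (X : (x : M) → Tan H x) (t : (x : M) → E x) (x : M) :
    alongKer D b Ω X t x =
      along D (shear b X) t x + Complex.I • along D (covectorOf Ω X) t x := by
  have e : shear b X x = vectorOf X x + -covectorOf b X x := by
    simp [shear, vectorOf, covectorOf]
  have : along D (shear b X) t x = along D (vectorOf X) t x + -along D (covectorOf b X) t x := by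
    rw [along, e, contract_add, contract_neg]; rfl
  rw [this, alongKer, alongCovector]
  abel

variable {J Jψ : (x : M) → GenTangent (Tan H x) →ₗ[ℝ] GenTangent (Tan H x)}
  {b Ω : (x : M) → Tan H x [⋀^Fin 2]→L[ℝ] ℝ}

/-- The image of `a` under the generalized metric `-J Jψ`. -/
def metricOf (J Jψ : (x : M) → GenTangent (Tan H x) →ₗ[ℝ] GenTangent (Tan H x))
    (a : (x : M) → GenTangent (Tan H x)) (x : M) : GenTangent (Tan H x) :=
  genMetric (J x) (Jψ x) (a x)

theorem smoothGen_metricOf (hGK : IsGenKahler J Jψ) {a : (x : M) → GenTangent (Tan H x)}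
    (ha : SmoothGen a) : SmoothGen (metricOf J Jψ a) :=
  (hGK.genComplex₁.smooth _ (hGK.genComplex₂.smooth _ ha)).neg

/-- The section `Jψ ξ` for a covector field `ξ`. -/
def dualOf (Jψ : (x : M) → GenTangent (Tan H x) →ₗ[ℝ] GenTangent (Tan H x))
    (ξ : (x : M) → Tan H x →L[ℝ] ℝ) (x : M) : GenTangent (Tan H x) :=
  Jψ x (0, ξ x)

/-- The element X - i_X β of ker ψ has real part X - i_X b and imaginary part i_X Ω, and in the
-√-1-eigenspace the imaginary part is Jψ of the real part. -/
theorem induced_shear (hΩ : IsSymplectic Ω) (hJψ : IsInducedBy Jψ (psi b Ω))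
    (hsq : ∀ x a, Jψ x (Jψ x a) = -a) (X : (x : M) → Tan H x) (x : M) :
    Jψ x (shear b X x) = covectorOf Ω X x := by
  have h := induced_apply (b x).toAlternatingMap (Ω x).toAlternatingMap (hsq x)
    (hJψ x).1.le (shear b X x)
  have h1 : (Jψ x (shear b X x)).1 = 0 := by
    refine hΩ.nondegenerate x _ fun w => ?_
    refine (h w).1.trans ?_
    simp [shear]
  refine Prod.ext h1 (ContinuousLinearMap.ext fun w => ?_)
  refine (h w).2.trans ?_
  have h0 : b x ![(0 : Tan H x), w] = 0 := (b x).map_coord_zero 0 rfl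
  rw [h1]
  simp [shear, covectorOf, h0]

/-- Applying Jψ to a frame X - i_X b, ξ produces i_X Ω and Y - i_Y b, a pair of the same shape with
the roles of vectors and covectors exchanged. Here Y is the symplectic dual of ξ up to sign. -/
theorem induced_dualOf (hJψ : IsInducedBy Jψ (psi b Ω))
    (hsq : ∀ x a, Jψ x (Jψ x a) = -a) (ξ : (x : M) → Tan H x →L[ℝ] ℝ) (x : M) :
    dualOf Jψ ξ x = shear b (fun y => (dualOf Jψ ξ y).1) x ∧
      covectorOf Ω (fun y => (dualOf Jψ ξ y).1) x = -(0, ξ x) := by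
  have h := induced_apply (b x).toAlternatingMap (Ω x).toAlternatingMap (hsq x)
    (hJψ x).1.le ((0, ξ x) : GenTangent (Tan H x))
  have h0 : ∀ w, b x ![(0 : Tan H x), w] = 0 := fun w => (b x).map_coord_zero 0 rfl
  have h0' : ∀ w, Ω x ![(0 : Tan H x), w] = 0 := fun w => (Ω x).map_coord_zero 0 rfl
  constructor
  · refine Prod.ext rfl (ContinuousLinearMap.ext fun w => ?_)
    refine (h w).2.trans ?_
    simp [shear, h0', dualOf]
  · refine Prod.ext (by simp [covectorOf]) (ContinuousLinearMap.ext fun w => ?_)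
    have := (h w).1
    simp only [ContinuousAlternatingMap.coe_toAlternatingMap, h0, add_zero] at this
    simpa [covectorOf, dualOf] using this

variable {D : GenConnection H F E} {h : HermitianMetric H F E}

/-- The Bochner identity for `|s|²`, where `𝒟^{0,1} s = 0`, in a frame `X j`, `θ j`. -/
theorem bochner_identity [CompleteSpace H] (hb : SmoothTwoForm b) (hΩ : IsSymplectic Ω)
    (hJψ : IsInducedBy Jψ (psi b Ω)) (hGK : IsGenKahler J Jψ)
    (hD : IsHermitianConnection h D) {lam : ℝ}
    (hEH : IsEinsteinHermitian h D (psi b Ω) lam)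
    {s : (x : M) → E x} (hs : SmoothSection H F s) (hs01 : ∀ x, D01 J D s x = 0)
    {ι : Type*} [Fintype ι] {X : ι → (x : M) → Tan H x} (hX : ∀ j, SmoothVF (X j))
    {θ : ι → (x : M) → Tan H x →L[ℝ] ℝ} (hθ : ∀ j, SmoothOneForm (θ j)) (x : M)
    (hid : ∀ v : Tan H x, ∑ j, θ j x v • X j x = v) :
    (∑ j, (mvfderiv 𝓘(ℝ, H) (fun y => mvfderiv 𝓘(ℝ, H) (normSq h s) y
          (metricOf J Jψ (fun z => (0, θ j z)) y).1) x (X j x)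
        + mvfderiv 𝓘(ℝ, H) (fun y => mvfderiv 𝓘(ℝ, H) (normSq h s) y
          (metricOf J Jψ (covectorOf Ω (X j)) y).1) x (dualOf Jψ (θ j) x).1))
      + ∑ j, mvfderiv 𝓘(ℝ, H) (normSq h s) x (J x (shear b (VectorField.mlieBracket 𝓘(ℝ, H) (X j)
          (fun y => (dualOf Jψ (θ j) y).1)) x)).1 =
    -8 * lam * normSq h s x + 2 * ∑ j,
      ((reForm h x (along D (shear b (X j)) s x)
          (along D (metricOf J Jψ (fun z => (0, θ j z))) s x)
        + reForm h x (along D (fun z => (0, θ j z)) s x)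
          (along D (metricOf J Jψ (shear b (X j))) s x))
      + (reForm h x (along D (dualOf Jψ (θ j)) s x)
          (along D (metricOf J Jψ (covectorOf Ω (X j))) s x)
        + reForm h x (along D (covectorOf Ω (X j)) s x)
          (along D (metricOf J Jψ (dualOf Jψ (θ j))) s x))) := by
  have hsq₁ := hGK.genComplex₁.sq
  have hsq₂ := hGK.genComplex₂.sq
  set th : ι → (x : M) → GenTangent (Tan H x) := fun j z => (0, θ j z) with hth
  set X' : ι → (x : M) → GenTangent (Tan H x) := fun j => shear b (X j) with hX'
  set w : ι → (x : M) → GenTangent (Tan H x) := fun j => covectorOf Ω (X j) with hw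
  set Y' : ι → (x : M) → GenTangent (Tan H x) := fun j => dualOf Jψ (θ j) with hY'
  set Y : ι → (x : M) → Tan H x := fun j y => (dualOf Jψ (θ j) y).1 with hY
  set Z : ι → (x : M) → Tan H x := fun j => VectorField.mlieBracket 𝓘(ℝ, H) (X j) (Y j) with hZ
  set G : ((x : M) → GenTangent (Tan H x)) → (x : M) → GenTangent (Tan H x) :=
    metricOf J Jψ with hG
  -- smoothness
  have sth : ∀ j, SmoothGen (th j) := fun j => smoothGen_covector (hθ j)
  have sX' : ∀ j, SmoothGen (X' j) := fun j => smoothGen_shear hb (hX j)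
  have sw : ∀ j, SmoothGen (w j) := fun j => smoothGen_covectorOf hΩ.smooth (hX j)
  have sY' : ∀ j, SmoothGen (Y' j) := fun j => hGK.genComplex₂.smooth _ (sth j)
  have sY : ∀ j, SmoothVF (Y j) := fun j => (sY' j).1
  have sZ : ∀ j, SmoothVF (Z j) := fun j => smoothVF_mlieBracket (hX j) (sY j)
  have sG : ∀ {a}, SmoothGen a → SmoothGen (G a) := fun ha => smoothGen_metricOf hGK ha
  -- the structure of the frame
  have fw : ∀ j y, Jψ y (X' j y) = w j y := fun j y => induced_shear hΩ hJψ hsq₂ (X j) y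
  have fY : ∀ j, shear b (Y j) = Y' j := fun j => funext fun y =>
    (induced_dualOf hJψ hsq₂ (θ j) y).1.symm
  have fwY : ∀ j y, covectorOf Ω (Y j) y = -th j y := fun j y =>
    (induced_dualOf hJψ hsq₂ (θ j) y).2
  -- holomorphic sections
  have hol : ∀ a : (x : M) → GenTangent (Tan H x),
      along D (fun y => J y (a y)) s = fun y => Complex.I • along D a s y := fun a =>
    funext fun y => contract_of_proj01_eq_zero (hsq₁ y) (hGK.genComplex₁.orthogonal y) (hs01 y) _
  have aneg : ∀ (a : (x : M) → GenTangent (Tan H x)) (t : (x : M) → E x),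
      along D (fun y => -a y) t = fun y => (-1 : ℂ) • along D a t y := fun a t =>
    funext fun y => by rw [along, contract_neg, neg_one_smul]; rfl
  have sI : ∀ {a}, SmoothGen a → SmoothSection H F (fun y => Complex.I • along D a s y) := by
    intro a ha
    rw [← hol]
    exact smooth_along D (hGK.genComplex₁.smooth _ ha) hs
  -- Holomorphy replaces √-1 𝒟_{i_X Ω} s by 𝒟_{J(i_X Ω)} s, so the derivative along a complex
  -- covector becomes one along a real section of TM ⊕ T*M, whose smoothness is part of the
  -- definition of 𝒟.
  have hcov : ∀ X : (x : M) → Tan H x, SmoothVF X →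
      SmoothSection H F (alongCovector D b Ω X s) := by
    intro X hX
    have s1 := (smoothGen_covectorOf hb hX).neg
    have s2 := hGK.genComplex₁.smooth _ (smoothGen_covectorOf hΩ.smooth hX)
    have : alongCovector D b Ω X s =
        along D (fun y => -covectorOf b X y + J y (covectorOf Ω X y)) s := by
      funext y
      have h2 := congrFun (hol (covectorOf Ω X)) y
      rw [along] at h2
      rw [along, contract_add, contract_neg, h2]
      rfl
    rw [this]
    exact smooth_along D (s1.add s2) hs
  set P : ((x : M) → GenTangent (Tan H x)) → ((x : M) → GenTangent (Tan H x)) → E x :=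
    fun a c => along D a (along D c s) x with hP
  have PJ : ∀ a {c}, SmoothGen c → P a (fun y => J y (c y)) = Complex.I • P a c := by
    intro a c hc
    rw [hP]; dsimp only
    rw [hol, along_smul_section _ (smooth_along D hc hs)]
  -- Jψ = J G because J² = -1; this is where the generalized metric enters.
  have PJψ : ∀ a {c}, SmoothGen c → P a (fun y => Jψ y (c y)) = Complex.I • P a (G c) := by
    intro a c hc
    have e : (fun y => Jψ y (c y)) = fun y => J y (G c y) := by
      funext y
      simp [hG, metricOf, genMetric_apply, hsq₁]
    rw [e, PJ a (sG hc)]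
  have Pneg : ∀ a {c}, SmoothGen c → P a (fun y => -c y) = -P a c := by
    intro a c hc
    rw [hP]; dsimp only
    rw [aneg, along_smul_section _ (smooth_along D hc hs), neg_one_smul]
  have Pneg' : ∀ a c, P (fun y => -a y) c = -P a c := by
    intro a c
    rw [hP]; dsimp only
    rw [aneg]; dsimp only
    rw [neg_one_smul]
  -- the curvature terms
  obtain ⟨𝓕, ⟨V, R, Ψ, hV, hR, hΨ, h𝓕⟩, hK⟩ := hEH
  obtain ⟨-, N, hN, hU⟩ := hK x
  have hYid : ∀ v j, Ω x ![v, Y j x] = θ j x v := by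
    intro v j
    have := congrArg (fun a : GenTangent (Tan H x) => a.2 v) (fwY j x)
    simp only [covectorOf, contractTwo_apply, hth, Prod.snd_neg, _root_.neg_apply] at this
    have h2 := alt_swap (Ω x).toAlternatingMap v (Y j x)
    simp only [ContinuousAlternatingMap.coe_toAlternatingMap] at h2
    rw [h2, this, neg_neg]
  -- Projecting the curvature to the line of ψ turns the Einstein-Hermitian condition into an
  -- equation between endomorphisms, to be applied to s.
  have hcoef := spinorCoeff_eq_zero_of_mem_UTwo (b x).toAlternatingMap (Ω x).toAlternatingMap
    (fun j => X j x) (fun j => Y j x) (fun j => θ j x) hid hYid hU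
  rw [map_sub, sub_eq_zero, psi_eq] at hcoef
  have hcoef2 := hcoef.trans (spinorCoeff_tensMixed (complexFormAt b Ω x) (fun j => X j x)
    (fun j => Y j x) _)
  have happ := congrArg (fun A : Module.End ℂ (E x) => A (s x)) hcoef2
  have e2 := fun j => genCurvature_two_apply b Ω hV hR hΨ h𝓕 hs hcov (hX j) (sY j) x
  have e0 := genCurvature_zero_apply b Ω hV hΨ h𝓕 hs hcov hX hθ x hid
  have kX : ∀ j, alongKer D b Ω (X j) s =
      fun y => along D (X' j) s y + Complex.I • along D (w j) s y := fun j =>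
    funext fun y => alongKer_eq D b Ω (X j) s y
  have kY : ∀ j, alongKer D b Ω (Y j) s =
      fun y => along D (Y' j) s y + Complex.I • along D (fun z => -th j z) s y := fun j => by
    funext y
    rw [alongKer_eq, fY, show covectorOf Ω (Y j) = fun z => -th j z from funext (fwY j)]
  have kXY : ∀ j, alongKer D b Ω (X j) (alongKer D b Ω (Y j) s) x =
      P (X' j) (Y' j) - Complex.I • P (X' j) (th j) + Complex.I • P (w j) (Y' j)
        + P (w j) (th j) := by
    intro j
    have sa := smooth_along D (sY' j) hs
    have sb := sI (sth j).neg
    have sc := smooth_along D (sth j).neg hs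
    rw [alongKer_eq, kY, along_add_section sa sb, along_add_section sa sb,
      along_smul_section _ sc, along_smul_section _ sc]
    change P (X' j) (Y' j) + Complex.I • P (X' j) (fun z => -th j z) +
      Complex.I • (P (w j) (Y' j) + Complex.I • P (w j) (fun z => -th j z)) = _
    rw [Pneg _ (sth j), Pneg _ (sth j), smul_add, smul_smul, Complex.I_mul_I]
    module
  have kYX : ∀ j, alongKer D b Ω (Y j) (alongKer D b Ω (X j) s) x =
      P (Y' j) (X' j) + Complex.I • P (Y' j) (w j) - Complex.I • P (th j) (X' j)
        + P (th j) (w j) := by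
    intro j
    have sa := smooth_along D (sX' j) hs
    have sb := sI (sw j)
    have sc := smooth_along D (sw j) hs
    rw [alongKer_eq, kX, along_add_section sa sb, along_add_section sa sb,
      along_smul_section _ sc, along_smul_section _ sc, fY,
      show covectorOf Ω (Y j) = fun z => -th j z from funext (fwY j)]
    change P (Y' j) (X' j) + Complex.I • P (Y' j) (w j) +
      Complex.I • (P (fun z => -th j z) (X' j) + Complex.I • P (fun z => -th j z) (w j)) = _
    rw [Pneg', Pneg', smul_add, smul_smul, Complex.I_mul_I]
    module
  have k1 : ∀ j, along D (th j) (alongCovector D b Ω (X j) s) x =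
      -P (th j) (covectorOf b (X j)) + Complex.I • P (th j) (w j) := by
    intro j
    have e : alongCovector D b Ω (X j) s = fun y =>
        along D (fun z => -covectorOf b (X j) z) s y + Complex.I • along D (w j) s y := by
      funext y
      rw [aneg]
      simp only [neg_one_smul]
      rfl
    rw [e, along_add_section (smooth_along D (smoothGen_covectorOf hb (hX j)).neg hs)
      (sI (sw j)), along_smul_section _ (smooth_along D (sw j) hs)]
    change P (th j) (fun z => -covectorOf b (X j) z) + _ = _
    rw [Pneg _ (smoothGen_covectorOf hb (hX j))]
  have k2 : ∀ j, alongCovector D b Ω (X j) (along D (th j) s) x =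
      -P (covectorOf b (X j)) (th j) + Complex.I • P (w j) (th j) := fun j => rfl
  have i1 : ∀ j, Complex.I • P (th j) (w j) = -P (th j) (G (X' j)) := by
    intro j
    rw [show w j = fun y => Jψ y (X' j y) from (funext (fw j)).symm, PJψ _ (sX' j), smul_smul,
      Complex.I_mul_I, neg_one_smul]
  have i2 : ∀ j, Complex.I • P (w j) (th j) = P (w j) (G (Y' j)) := by
    intro j
    have e : th j = fun y => -(Jψ y (Y' j y)) := by
      funext y
      rw [hY']
      simp only [dualOf]
      rw [hsq₂, neg_neg]
    rw [e, Pneg _ (hGK.genComplex₂.smooth _ (sY' j)), PJψ _ (sY' j), smul_neg, smul_smul,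
      Complex.I_mul_I, neg_one_smul, neg_neg]
  have i3 : ∀ j, Complex.I • P (X' j) (Y' j) = -P (X' j) (G (th j)) := by
    intro j
    rw [show Y' j = fun y => Jψ y (th j y) from rfl, PJψ _ (sth j), smul_smul,
      Complex.I_mul_I, neg_one_smul]
  have i4 : ∀ j, Complex.I • P (Y' j) (X' j) = P (Y' j) (G (w j)) := by
    intro j
    have e : X' j = fun y => -(Jψ y (w j y)) := by
      funext y
      rw [← fw, hsq₂, neg_neg]
    rw [e, Pneg _ (hGK.genComplex₂.smooth _ (sw j)), PJψ _ (sw j), smul_neg, smul_smul,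
      Complex.I_mul_I, neg_one_smul, neg_neg]
  have i5 : ∀ j, Complex.I • along D (shear b (Z j)) s x =
      along D (fun y => J y (shear b (Z j) y)) s x := fun j => by rw [hol]
  -- The factor 4 clears √-1/4 from the trace and leaves coefficient 2 on the degree zero
  -- commutators. The terms still multiplied by √-1 are rewritten by holomorphy; the commutators
  -- kept on the right all involve a covector.
  have hvec : (4 : ℂ) • ((lam : ℂ) • s x + N (s x)) =
      ∑ j, ((2 : ℂ) • (P (covectorOf b (X j)) (th j) - P (th j) (covectorOf b (X j)))
        + (P (X' j) (th j) - P (th j) (X' j)) + (P (Y' j) (w j) - P (w j) (Y' j))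
        - P (th j) (G (X' j)) - P (w j) (G (Y' j)) - P (X' j) (G (th j)) - P (Y' j) (G (w j))
        - along D (fun y => J y (shear b (Z j) y)) s x + along D (covectorOf Ω (Z j)) s x) := by
    have h4 : 𝓕 x 0 ![] (s x) + (Complex.I / 4) • ∑ j,
        (alongKer D b Ω (X j) (alongKer D b Ω (Y j) s) x
          - alongKer D b Ω (Y j) (alongKer D b Ω (X j) s) x - alongKer D b Ω (Z j) s x) =
        (lam : ℂ) • s x + N (s x) := by
      rw [← Finset.sum_congr rfl fun j _ => e2 j]
      simp only [spinorCoeff_apply, LinearMap.add_apply, LinearMap.smul_apply,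
        LinearMap.sum_apply] at happ
      exact happ
    rw [← h4, e0, smul_add, smul_smul, smul_smul, Finset.smul_sum, Finset.smul_sum,
      ← Finset.sum_add_distrib]
    refine Finset.sum_congr rfl fun j _ => ?_
    have hI : ∀ v : E x, Complex.I • Complex.I • v = -v := fun v => by
      rw [smul_smul, Complex.I_mul_I, neg_one_smul]
    rw [kXY, kYX, alongKer_eq, k1, k2]
    linear_combination (norm := module) i1 j - i2 j + i3 j - i4 j - i5 j
      - hI (P (X' j) (th j)) + hI (P (w j) (Y' j)) - hI (P (Y' j) (w j)) + hI (P (th j) (X' j))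
      - hI (along D (covectorOf Ω (Z j)) s x)
  have hre := congrArg (fun v => reForm h x v (s x)) hvec
  simp only [reForm_sum_left, reForm_add_left, reForm_sub_left] at hre
  have r4 : reForm h x ((4 : ℂ) • ((lam : ℂ) • s x + N (s x))) (s x) =
      4 * (lam * normSq h s x) := by
    have h1 : (4 : ℂ) • ((lam : ℂ) • s x + N (s x)) =
        (4 : ℝ) • (lam • s x + N (s x)) := by
      rw [← Complex.coe_smul, ← Complex.coe_smul]; norm_num
    rw [h1, reForm_smul_left, reForm_add_left, reForm_smul_left, reForm_skew h hN, add_zero]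
    rfl
  have r2 : ∀ v v' : E x, reForm h x ((2 : ℂ) • (v - v')) (s x) =
      2 * (reForm h x v (s x) - reForm h x v' (s x)) := by
    intro v v'
    have h1 : (2 : ℂ) • (v - v') = (2 : ℝ) • (v - v') := by
      rw [← Complex.coe_smul]; norm_num
    rw [h1, reForm_smul_left, reForm_sub_left]
  rw [r4] at hre
  simp only [r2] at hre
  have d1 : ∀ j, mvfderiv 𝓘(ℝ, H) (fun y => mvfderiv 𝓘(ℝ, H) (normSq h s) y (G (th j) y).1) x
      (X j x) = 2 * reForm h x (P (X' j) (G (th j))) (s x)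
        + 2 * reForm h x (along D (X' j) s x) (along D (G (th j)) s x) := fun j =>
    mvfderiv_mvfderiv_normSq hD hs x (a := X' j) (sG (sth j))
  have d2 : ∀ j, mvfderiv 𝓘(ℝ, H) (fun y => mvfderiv 𝓘(ℝ, H) (normSq h s) y (G (w j) y).1) x
      (Y' j x).1 = 2 * reForm h x (P (Y' j) (G (w j))) (s x)
        + 2 * reForm h x (along D (Y' j) s x) (along D (G (w j)) s x) := fun j =>
    mvfderiv_mvfderiv_normSq hD hs x (a := Y' j) (sG (sw j))
  -- The outer derivative is along a covector, hence zero. These cases contribute no second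
  -- derivative of |s|² but supply the products of first derivatives that complete the G-trace.
  have d3 : ∀ j, 0 = 2 * reForm h x (P (th j) (G (X' j))) (s x)
        + 2 * reForm h x (along D (th j) s x) (along D (G (X' j)) s x) := fun j =>
    (map_zero _).symm.trans (mvfderiv_mvfderiv_normSq hD hs x (a := th j) (sG (sX' j)))
  have d4 : ∀ j, 0 = 2 * reForm h x (P (w j) (G (Y' j))) (s x)
        + 2 * reForm h x (along D (w j) s x) (along D (G (Y' j)) s x) := fun j =>
    (map_zero _).symm.trans (mvfderiv_mvfderiv_normSq hD hs x (a := w j) (sG (sY' j)))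
  have d5 : ∀ j, mvfderiv 𝓘(ℝ, H) (normSq h s) x (J x (shear b (Z j) x)).1 =
      2 * reForm h x (along D (fun y => J y (shear b (Z j) y)) s x) (s x) := fun j =>
    mvfderiv_normSq hD hs x (fun y => J y (shear b (Z j) y))
  have d6 : ∀ j, 0 = 2 * reForm h x (along D (covectorOf Ω (Z j)) s x) (s x) := fun j =>
    (map_zero _).symm.trans (mvfderiv_normSq hD hs x (covectorOf Ω (Z j)))
  have v1 : ∀ j, reForm h x (P (covectorOf b (X j)) (th j)) (s x) =
      reForm h x (P (th j) (covectorOf b (X j))) (s x) := fun j =>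
    reForm_commutator_covector hD hs x (smoothGen_covectorOf hb (hX j)) (sth j) fun _ => rfl
  have v2 : ∀ j, reForm h x (P (X' j) (th j)) (s x) = reForm h x (P (th j) (X' j)) (s x) :=
    fun j => reForm_commutator_covector hD hs x (sX' j) (sth j) fun _ => rfl
  have v3 : ∀ j, reForm h x (P (Y' j) (w j)) (s x) = reForm h x (P (w j) (Y' j)) (s x) :=
    fun j => reForm_commutator_covector hD hs x (sY' j) (sw j) fun _ => rfl
  have e8 : -8 * lam * normSq h s x = -2 * (4 * (lam * normSq h s x)) := by ring
  rw [e8, hre, Finset.mul_sum, Finset.mul_sum, ← Finset.sum_add_distrib, ← Finset.sum_add_distrib]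
  refine Finset.sum_congr rfl fun j _ => ?_
  rw [d1, d2, d5]
  linear_combination d3 j + d4 j + 4 * v1 j + 2 * v2 j + 2 * v3 j - d6 j

end BochnerIdentity

end GenKahler

end

noncomputable section

namespace GenKahler

set_option linter.unusedSectionVars false

/-! ### Ellipticity of the Bochner equation -/

section TraceInequality

/-- An expansion of T ⊕ T* in the family A, with coefficients given by the pairing, reconstructs t
from its contractions with the c k. -/
theorem eq_zero_of_contract_eq_zero {T W : Type*} [AddCommGroup T] [Module ℝ T]
    [TopologicalSpace T] [AddCommGroup W] [Module ℂ W] {κ : Type*} [Fintype κ]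
    {A c : κ → GenTangent T} (hA : ∀ u, ∑ k, (2 * pairing (c k) u) • A k = u)
    {t : W ⊗[ℝ] GenTangent T} (ht : ∀ a, contract a t = 0) : t = 0 := by
  have key : ∀ t : W ⊗[ℝ] GenTangent T, t = ∑ k, contract (c k) t ⊗ₜ[ℝ] A k := by
    intro t
    induction t using TensorProduct.induction_on with
    | zero => simp
    | tmul w u =>
      conv_lhs => rw [← hA u]
      rw [TensorProduct.tmul_sum]
      refine Finset.sum_congr rfl fun k _ => ?_
      rw [contract_tmul, TensorProduct.tmul_smul, TensorProduct.smul_tmul']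
    | add x y hx hy =>
      conv_lhs => rw [hx, hy]
      simp only [map_add, TensorProduct.add_tmul, Finset.sum_add_distrib]
  rw [key t]
  simp [ht]

variable {H : Type*} [NormedAddCommGroup H] [NormedSpace ℝ H] [FiniteDimensional ℝ H]
variable {M : Type*} [TopologicalSpace M] [ChartedSpace H M] [IsManifold 𝓘(ℝ, H) ∞ M]
variable {F : Type*} [NormedAddCommGroup F] [NormedSpace ℂ F]
variable {E : M → Type*} [∀ x, AddCommGroup (E x)] [∀ x, Module ℂ (E x)]
  [∀ x, TopologicalSpace (E x)] [TopologicalSpace (Bundle.TotalSpace F E)] [FiberBundle F E]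
variable {J Jψ : (x : M) → GenTangent (Tan H x) →ₗ[ℝ] GenTangent (Tan H x)}
  {b Ω : (x : M) → Tan H x [⋀^Fin 2]→L[ℝ] ℝ}
  {D : GenConnection H F E} {h : HermitianMetric H F E}

instance (x : M) : FiniteDimensional ℝ (GenTangent (Tan H x)) :=
  inferInstanceAs (FiniteDimensional ℝ (H × (H →L[ℝ] ℝ)))

/-- The traces of bilinear forms on `T ⊕ T*` with respect to the generalized metric. -/
theorem exists_trace_frame_at (hΩ : IsSymplectic Ω) (hJψ : IsInducedBy Jψ (psi b Ω))
    (hGK : IsGenKahler J Jψ) {ι : Type} [Fintype ι] (X : ι → (x : M) → Tan H x)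
    (θ : ι → (x : M) → Tan H x →L[ℝ] ℝ) (x : M)
    (hid : ∀ v : Tan H x, ∑ j, θ j x v • X j x = v) :
    ∃ A c : Fin (Module.finrank ℝ (GenTangent (Tan H x))) → GenTangent (Tan H x),
      (∀ u, ∑ k, (2 * pairing (c k) u) • A k = u) ∧
      ∀ B : GenTangent (Tan H x) →ₗ[ℝ] GenTangent (Tan H x) →ₗ[ℝ] ℝ,
        ∑ j, ((B (shear b (X j) x) (metricOf J Jψ (fun z => (0, θ j z)) x)
          + B (0, θ j x) (metricOf J Jψ (shear b (X j)) x))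
        + (B (dualOf Jψ (θ j) x) (metricOf J Jψ (covectorOf Ω (X j)) x)
          + B (covectorOf Ω (X j) x) (metricOf J Jψ (dualOf Jψ (θ j)) x))) =
          2 * ∑ k, B (A k) (A k) := by
  obtain ⟨A, ⟨c, hc⟩, hA⟩ := exists_trace_frame (hGK.genComplex₁.sq x) (hGK.genComplex₂.sq x)
    (hGK.genComplex₁.orthogonal x) (hGK.genComplex₂.orthogonal x) (hGK.commute x) (hGK.pos x)
    (b x).toAlternatingMap
  refine ⟨A, c, hc, fun B => ?_⟩
  have hd := fun j => induced_dualOf hJψ hGK.genComplex₂.sq (θ j) x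
  have h1 := hA (fun j => shear b (X j) x) (fun j => (0, θ j x)) hid
    (fun j v => by simp [shear]) (fun j => rfl) B
  -- The frame obtained by applying Jψ has the same G-trace. Its expansion of v is checked by
  -- contracting with Ω, which is nondegenerate.
  have h2 := hA (fun j => dualOf Jψ (θ j) x) (fun j => covectorOf Ω (X j) x)
    (by
      intro v
      refine sub_eq_zero.mp (hΩ.nondegenerate x _ fun w => ?_)
      have hY : ∀ j, (Ω x).toAlternatingMap ![(dualOf Jψ (θ j) x).1, w] = -θ j x w := by
        intro j
        have := congrArg (fun a : GenTangent (Tan H x) => a.2 w) (hd j).2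
        simpa [covectorOf] using this
      have e1 : ∀ j, slotReal (Ω x).toAlternatingMap w (dualOf Jψ (θ j) x).1 = θ j x w := by
        intro j
        rw [slotReal_apply, alt_swap, hY, neg_neg]
      have e2 : slotReal (Ω x).toAlternatingMap w v =
          ∑ j, θ j x w * (covectorOf Ω (X j) x).2 v := by
        rw [slotReal_apply, alt_swap, ← slotReal_apply]
        conv_lhs => rw [← hid w]
        rw [map_sum, ← Finset.sum_neg_distrib]
        refine Finset.sum_congr rfl fun j _ => ?_
        rw [map_smul, smul_eq_mul, slotReal_apply, alt_swap, mul_neg, neg_neg]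
        simp [covectorOf]
      change (Ω x).toAlternatingMap ![_, w] = 0
      rw [alt_swap, neg_eq_zero, ← slotReal_apply, map_sub, map_sum, e2, sub_eq_zero]
      refine Finset.sum_congr rfl fun j _ => ?_
      rw [map_smul, e1, smul_eq_mul, mul_comm])
    (fun j v => by
      rw [(hd j).1]; simp [shear]) (fun j => rfl) B
  rw [Finset.sum_add_distrib, two_mul]
  exact congrArg₂ (· + ·) h1 h2

/-- Near each point `|s|²` satisfies an elliptic equation, where `𝒟^{0,1} s = 0`. -/
theorem bochner_elliptic (hb : SmoothTwoForm b) (hΩ : IsSymplectic Ω)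
    (hJψ : IsInducedBy Jψ (psi b Ω)) (hGK : IsGenKahler J Jψ)
    (hD : IsHermitianConnection h D) {lam : ℝ}
    (hEH : IsEinsteinHermitian h D (psi b Ω) lam)
    {s : (x : M) → E x} (hs : SmoothSection H F s) (hs01 : ∀ x, D01 J D s x = 0)
    {ι : Type} [Fintype ι] {X : ι → (x : M) → Tan H x} (hX : ∀ j, SmoothVF (X j))
    {θ : ι → (x : M) → Tan H x →L[ℝ] ℝ} (hθ : ∀ j, SmoothOneForm (θ j)) :
    ∃ (P Q : ι ⊕ ι → (x : M) → Tan H x) (Z : ι → (x : M) → Tan H x),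
      (∀ i, SmoothVF (P i)) ∧ (∀ i, SmoothVF (Q i)) ∧ (∀ j, SmoothVF (Z j)) ∧
      ∀ x, (∀ v : Tan H x, ∑ j, θ j x v • X j x = v) →
        (∃ S : ℝ, 0 ≤ S ∧ (S = 0 → D.toFun s x = 0) ∧
          ∑ i, mvfderiv 𝓘(ℝ, H) (fun y => mvfderiv 𝓘(ℝ, H) (normSq h s) y (Q i y)) x (P i x)
            + ∑ j, mvfderiv 𝓘(ℝ, H) (normSq h s) x (Z j x) = -8 * lam * normSq h s x + S) ∧
        ∃ (m : ℕ) (C : Fin m → Tan H x), (∀ l : Tan H x →ₗ[ℝ] ℝ, (∀ k, l (C k) = 0) → l = 0) ∧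
          ∀ B : Tan H x →ₗ[ℝ] Tan H x →ₗ[ℝ] ℝ,
            ∑ i, B (P i x) (Q i x) = 2 * ∑ k, B (C k) (C k) := by
  have sth : ∀ j, SmoothGen (fun z => ((0, θ j z) : GenTangent (Tan H z))) :=
    fun j => smoothGen_covector (hθ j)
  have sY : ∀ j, SmoothGen (dualOf Jψ (θ j)) := fun j => hGK.genComplex₂.smooth _ (sth j)
  have : CompleteSpace H := FiniteDimensional.complete ℝ H
  refine ⟨Sum.elim X (fun j x => (dualOf Jψ (θ j) x).1),
    Sum.elim (fun j x => (metricOf J Jψ (fun z => (0, θ j z)) x).1)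
      (fun j x => (metricOf J Jψ (covectorOf Ω (X j)) x).1),
    fun j x => (J x (shear b (VectorField.mlieBracket 𝓘(ℝ, H) (X j)
          (fun y => (dualOf Jψ (θ j) y).1)) x)).1, ?_, ?_, ?_, fun x hid => ?_⟩
  · rintro (j | j)
    · exact hX j
    · exact (sY j).1
  · rintro (j | j)
    · exact (smoothGen_metricOf hGK (sth j)).1
    · exact (smoothGen_metricOf hGK (smoothGen_covectorOf hΩ.smooth (hX j))).1
  · intro j
    exact (hGK.genComplex₁.smooth _
      (smoothGen_shear hb (smoothVF_mlieBracket (hX j) (sY j).1))).1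
  obtain ⟨A, c, hc, hA⟩ := exists_trace_frame_at hΩ hJψ hGK X θ x hid
  have hspan : ∀ l : GenTangent (Tan H x) →ₗ[ℝ] ℝ, (∀ k, l (A k) = 0) → l = 0 := by
    intro l hl
    refine LinearMap.ext fun u => ?_
    rw [← hc u, map_sum]
    simp [hl]
  have hcon : ∀ t : E x ⊗[ℝ] GenTangent (Tan H x), ∃ L : GenTangent (Tan H x) →ₗ[ℝ] E x,
      ∀ a, L a = contract a t := fun t =>
    ⟨{ toFun := fun a => contract a t
       map_add' := fun a c => contract_add a c t
       map_smul' := fun r a => contract_smul r a t }, fun _ => rfl⟩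
  obtain ⟨L, hL⟩ := hcon (D.toFun s x)
  constructor
  · have hpos : ∀ v : E x, 0 ≤ reForm h x v v := by
      intro v
      by_cases hv : v = 0
      · simp [hv, reForm]
      · exact (h.pos x v hv).le
    -- One factor 2 comes from differentiating |s|² twice, the other from the two frames, each of
    -- which yields the full G-trace.
    refine ⟨4 * ∑ k, reForm h x (L (A k)) (L (A k)),
      mul_nonneg (by norm_num) (Finset.sum_nonneg fun k _ => hpos _), ?_, ?_⟩
    · intro h0
      have h1 : ∀ k, L (A k) = 0 := by
        intro k
        have := (Finset.sum_eq_zero_iff_of_nonneg fun k _ => hpos (L (A k))).mp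
          ((mul_eq_zero.mp h0).resolve_left (by norm_num)) k (Finset.mem_univ _)
        by_contra hne
        exact (h.pos x _ hne).ne' this
      refine eq_zero_of_contract_eq_zero hc fun a => ?_
      rw [← hL, ← hc a, map_sum]
      simp [h1]
    · have hB := hA ((reBilin h x).compl₁₂ L L)
      have hbo := bochner_identity hb hΩ hJψ hGK hD hEH hs hs01 hX hθ x hid
      have hB2 : ∑ j,
      ((reForm h x (along D (shear b (X j)) s x)
          (along D (metricOf J Jψ (fun z => (0, θ j z))) s x)
        + reForm h x (along D (fun z => (0, θ j z)) s x)
          (along D (metricOf J Jψ (shear b (X j))) s x))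
      + (reForm h x (along D (dualOf Jψ (θ j)) s x)
          (along D (metricOf J Jψ (covectorOf Ω (X j))) s x)
        + reForm h x (along D (covectorOf Ω (X j)) s x)
          (along D (metricOf J Jψ (dualOf Jψ (θ j))) s x))) =
          2 * ∑ k, reForm h x (L (A k)) (L (A k)) := by
        rw [← show _ = 2 * ∑ k, reForm h x (L (A k)) (L (A k)) from hB]
        refine Finset.sum_congr rfl fun j _ => ?_
        simp only [LinearMap.compl₁₂_apply, hL]
        rfl
      rw [hB2] at hbo
      rw [Fintype.sum_sum_type, ← Finset.sum_add_distrib]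
      refine hbo.trans ?_
      ring
  -- The symbol is the G-trace of B pulled back to vector parts. The terms with a covector in the
  -- first slot vanish, leaving exactly the pairs P, Q.
  · refine ⟨_, fun k => (A k).1, fun l hl => ?_, fun B => ?_⟩
    · have h0 := hspan (l ∘ₗ LinearMap.fst ℝ _ _) hl
      refine LinearMap.ext fun v => ?_
      exact congrArg (fun f => f ((v, 0) : GenTangent (Tan H x))) h0
    · have hB := hA (B.compl₁₂ (LinearMap.fst ℝ _ _) (LinearMap.fst ℝ _ _))
      rw [← show _ = 2 * ∑ k, B (A k).1 (A k).1 from hB, Fintype.sum_sum_type,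
        ← Finset.sum_add_distrib]
      refine Finset.sum_congr rfl fun j _ => ?_
      simp only [LinearMap.compl₁₂_apply, LinearMap.fst_apply, Sum.elim_inl, Sum.elim_inr,
        covectorOf, map_zero, LinearMap.zero_apply, add_zero]
      rfl

end TraceInequality

end GenKahler

end

noncomputable section

namespace GenKahler

/-! ### Hopf's strong maximum principle in Euclidean space -/

section MaximumPrinciple

open Topology Filter Set

/-- Restrict to the line through z in the direction a. A positive second derivative would make z a
local minimum as well, so the restriction would be locally constant and its second derivative zero.
-/
theorem fderiv_fderiv_nonpos_of_isLocalMax {V : Type*} [NormedAddCommGroup V] [NormedSpace ℝ V]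
    {v : V → ℝ} {z : V} (hv : ContDiffAt ℝ 2 v z) (hmax : IsLocalMax v z) (a : V) :
    fderiv ℝ (fderiv ℝ v) z a a ≤ 0 := by
  by_contra! hpos
  let l : ℝ → V := fun t => z + t • a
  have hl : ∀ t, HasDerivAt l a t := fun t =>
    (((hasDerivAt_id t).smul_const a).const_add z).congr_deriv (one_smul _ _)
  have l0 : l 0 = z := by simp [l]
  have hlc : Continuous l := by fun_prop
  have hdiff : ∀ᶠ y in 𝓝 z, DifferentiableAt ℝ v y :=
    (hv.eventually (by simp)).mono fun y hy => hy.differentiableAt (by simp)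
  have hlt : Tendsto l (𝓝 0) (𝓝 z) := by simpa [l0] using hlc.tendsto 0
  have hd1 : ∀ᶠ t in 𝓝 (0 : ℝ), HasDerivAt (v ∘ l) (fderiv ℝ v (l t) a) t :=
    (hlt.eventually hdiff).mono fun t ht => ht.hasFDerivAt.comp_hasDerivAt t (hl t)
  have he : deriv (v ∘ l) =ᶠ[𝓝 0] fun t => fderiv ℝ v (l t) a := hd1.mono fun t ht => ht.deriv
  have hf2 : DifferentiableAt ℝ (fderiv ℝ v) z :=
    (hv.fderiv_right (m := 1) (by norm_num)).differentiableAt (by simp)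
  have hd2 : HasDerivAt (fun t => fderiv ℝ v (l t) a) (fderiv ℝ (fderiv ℝ v) z a a) 0 := by
    have h1 : HasFDerivAt (fderiv ℝ v) (fderiv ℝ (fderiv ℝ v) z) (l 0) := by
      rw [l0]; exact hf2.hasFDerivAt
    have h2 := h1.comp_hasDerivAt 0 (hl 0)
    exact h2.clm_apply (hasDerivAt_const 0 a) |>.congr_deriv (by simp)
  have hdd : deriv (deriv (v ∘ l)) 0 = fderiv ℝ (fderiv ℝ v) z a a := by
    rw [he.deriv_eq, hd2.deriv]
  have hmaxl : IsLocalMax (v ∘ l) 0 := by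
    have := hlt.eventually hmax
    simpa [IsLocalMax, IsMaxFilter, l0] using this
  have hcont : ContinuousAt (v ∘ l) 0 := by
    refine ContinuousAt.comp ?_ hlc.continuousAt
    rw [l0]; exact hv.continuousAt
  have hmin := isLocalMin_of_deriv_deriv_pos (by rw [hdd]; exact hpos) hmaxl.deriv_eq_zero hcont
  have hconst : (v ∘ l) =ᶠ[𝓝 0] fun _ => (v ∘ l) 0 := by
    filter_upwards [hmin, hmaxl] with t h1 h2 using le_antisymm h2 h1
  have h0 : deriv (deriv (v ∘ l)) 0 = 0 := by
    have : deriv (v ∘ l) =ᶠ[𝓝 0] fun _ => 0 := by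
      have := hconst.deriv
      simpa using this
    rw [this.deriv_eq, deriv_const]
  rw [hdd] at h0
  exact hpos.ne' h0

/-- The traces of bilinear forms over the pairs `P i`, `Q i` are those over a spanning family. -/
def IsElliptic {V : Type*} [AddCommGroup V] [Module ℝ V] {κ : Type*} [Fintype κ]
    (P Q : κ → V) : Prop :=
  ∃ (m : ℕ) (C : Fin m → V), (∀ l : V →ₗ[ℝ] ℝ, (∀ k, l (C k) = 0) → l = 0) ∧
    ∀ B : V →ₗ[ℝ] V →ₗ[ℝ] ℝ, ∑ i, B (P i) (Q i) = 2 * ∑ k, B (C k) (C k)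

theorem IsElliptic.map {V V' : Type*} [AddCommGroup V] [Module ℝ V] [AddCommGroup V']
    [Module ℝ V'] {κ : Type*} [Fintype κ] {P Q : κ → V} (h : IsElliptic P Q) (e : V →ₗ[ℝ] V')
    (he : Function.Surjective e) : IsElliptic (fun i => e (P i)) (fun i => e (Q i)) := by
  obtain ⟨m, C, hC, hB⟩ := h
  refine ⟨m, fun k => e (C k), fun l hl => ?_, fun B => hB (B.compl₁₂ e e)⟩
  have := hC (l ∘ₗ e) hl
  refine LinearMap.ext fun v => ?_
  obtain ⟨w, rfl⟩ := he v
  exact congrArg (fun f => f w) this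

/-- Testing on l ⊗ l gives twice the sum of the l(C_k)², and a nonzero l cannot vanish on a spanning
family. This is positivity of the principal symbol, applied below to the gradient direction of the
barrier. -/
theorem IsElliptic.sum_mul_pos {V : Type*} [AddCommGroup V] [Module ℝ V] {κ : Type*} [Fintype κ]
    {P Q : κ → V} (h : IsElliptic P Q) {l : V →ₗ[ℝ] ℝ} (hl : l ≠ 0) :
    0 < ∑ i, l (P i) * l (Q i) := by
  obtain ⟨m, C, hC, hB⟩ := h
  have h1 := hB ((LinearMap.mul ℝ ℝ).compl₁₂ l l)
  simp only [LinearMap.compl₁₂_apply, LinearMap.mul_apply'] at h1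
  rw [h1]
  have hex : ∃ k, l (C k) ≠ 0 := by
    by_contra! hall
    exact hl (hC l hall)
  obtain ⟨k, hk⟩ := hex
  exact mul_pos two_pos (Finset.sum_pos' (fun k _ => mul_self_nonneg _)
    ⟨k, Finset.mem_univ _, mul_self_pos.mpr hk⟩)

variable {V : Type*} [NormedAddCommGroup V] [InnerProductSpace ℝ V]

theorem IsElliptic.sum_fderiv_nonpos {V : Type*} [NormedAddCommGroup V] [NormedSpace ℝ V]
    {κ : Type*} [Fintype κ] {P Q : κ → V} (h : IsElliptic P Q)
    {v : V → ℝ} {z : V} (hv : ContDiffAt ℝ 2 v z) (hmax : IsLocalMax v z) :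
    ∑ i, fderiv ℝ (fderiv ℝ v) z (P i) (Q i) ≤ 0 := by
  obtain ⟨m, C, -, hB⟩ := h
  have h1 := hB (LinearMap.mk₂ ℝ (fun a c => fderiv ℝ (fderiv ℝ v) z a c)
    (by simp) (by simp) (by simp) (by simp))
  simp only [LinearMap.mk₂_apply] at h1
  rw [h1]
  have : ∑ k, fderiv ℝ (fderiv ℝ v) z (C k) (C k) ≤ 0 :=
    Finset.sum_nonpos fun k _ => fderiv_fderiv_nonpos_of_isLocalMax hv hmax _
  linarith

/-- The barrier function of Hopf. -/
def barrier (α : ℝ) (y : V) (z : V) : ℝ := Real.exp (-α * ‖z - y‖ ^ 2)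

theorem hasFDerivAt_barrier (α : ℝ) (y z : V) :
    HasFDerivAt (barrier α y) ((-(2 * α) * barrier α y z) • innerSL ℝ (z - y)) z := by
  have h1 : HasFDerivAt (fun z : V => ‖z - y‖ ^ 2) (2 • innerSL ℝ (z - y)) z := by
    have := (HasFDerivAt.norm_sq ((hasFDerivAt_id z).sub_const y))
    simpa using this
  have h2 := ((h1.const_mul (-α)).exp)
  refine h2.congr_fderiv ?_
  ext v
  simp [barrier]
  ring

theorem hasFDerivAt_fderiv_barrier (α : ℝ) (y z : V) (a c : V) :
    fderiv ℝ (fderiv ℝ (barrier α y)) z a c =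
      barrier α y z * (4 * α ^ 2 * (inner ℝ (z - y) a * inner ℝ (z - y) c)
        - 2 * α * inner ℝ a c) := by
  have h0 : fderiv ℝ (barrier α y) =
      fun z => (-(2 * α) * barrier α y z) • innerSL ℝ (z - y) :=
    funext fun z => (hasFDerivAt_barrier α y z).fderiv
  have h1 : HasFDerivAt (fun z : V => innerSL ℝ (z - y)) (innerSL ℝ : V →L[ℝ] V →L[ℝ] ℝ) z :=
    (innerSL ℝ : V →L[ℝ] V →L[ℝ] ℝ).hasFDerivAt.comp z ((hasFDerivAt_id z).sub_const y)
  have h2 := ((hasFDerivAt_barrier α y z).const_mul (-(2 * α))).smul h1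
  have h3 : HasFDerivAt (fun z => (-(2 * α) * barrier α y z) • innerSL ℝ (z - y)) _ z := h2
  rw [h0, h3.fderiv]
  change (-(2 * α) * barrier α y z) * inner ℝ a c
    + (-(2 * α) * ((-(2 * α) * barrier α y z) * inner ℝ (z - y) a)) * inner ℝ (z - y) c = _
  ring

theorem contDiff_barrier (α : ℝ) (y : V) : ContDiff ℝ 2 (barrier α y) := by
  exact (contDiff_const.mul ((contDiff_id.sub contDiff_const).norm_sq ℝ)).exp

/-- Hopf's argument at a boundary point p of a ball on which u < u(p) elsewhere. A small multiple of
the barrier makes the differential inequality strict near p, while the perturbed function stays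
below u(p) on a small sphere about p; it then has an interior maximum, where the operator cannot be
positive. -/
theorem barrier_comparison {O : Set V} (hO : IsOpen O) {u : V → ℝ} (hu : ContDiffOn ℝ 2 u O)
    {κ : Type*} [Fintype κ] {P Q : κ → V → V} {w : V → V}
    (hP : ∀ i, ContinuousOn (P i) O) (hQ : ∀ i, ContinuousOn (Q i) O) (hw : ContinuousOn w O)
    (hell : ∀ z ∈ O, IsElliptic (fun i => P i z) (fun i => Q i z))
    (hsub : ∀ z ∈ O, 0 ≤ ∑ i, fderiv ℝ (fderiv ℝ u) z (P i z) (Q i z) + fderiv ℝ u z (w z))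
    [FiniteDimensional ℝ V] {p y : V} {ρ : ℝ} (hp : p ∈ O) (hρ : 0 < ρ) (hpy : ‖p - y‖ = ρ)
    (hlt : ∀ z ∈ O, z ∈ Metric.closedBall y ρ → z ≠ p → u z < u p)
    (hmax : ∀ z ∈ O, u z ≤ u p) : False := by
  let g₁ : V → ℝ := fun z => ∑ i, inner ℝ (z - y) (P i z) * inner ℝ (z - y) (Q i z)
  let g₂ : V → ℝ := fun z => ∑ i, inner ℝ (P i z) (Q i z) + inner ℝ (z - y) (w z)
  have hg₁ : ContinuousOn g₁ O := by
    refine continuousOn_finsetSum _ fun i _ => ?_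
    exact ((continuousOn_id.sub continuousOn_const).inner (hP i)).mul
      ((continuousOn_id.sub continuousOn_const).inner (hQ i))
  have hg₂ : ContinuousOn g₂ O := by
    refine (continuousOn_finsetSum _ fun i _ => (hP i).inner (hQ i)).add ?_
    exact (continuousOn_id.sub continuousOn_const).inner hw
  have hpos : 0 < g₁ p := by
    have hl : (innerSL ℝ (p - y) : V →L[ℝ] ℝ).toLinearMap ≠ 0 := by
      intro h0
      have h1 : inner ℝ (p - y) (p - y) = 0 := congrArg (fun l => l (p - y)) h0
      rw [real_inner_self_eq_norm_sq, hpy] at h1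
      exact (pow_pos hρ 2).ne' h1
    exact (hell p hp).sum_mul_pos hl
  -- Near p one has g₁ > c and g₂ < K. With α = K / c this gives 4α² g₁ > 4αK > 2α g₂, so the
  -- operator is positive on the barrier.
  set c := g₁ p / 2 with hc
  set K := |g₂ p| + 1 with hK
  have hc0 : 0 < c := half_pos hpos
  have hK0 : 0 < K := by positivity
  set α := K / c with hα
  have hα0 : 0 < α := div_pos hK0 hc0
  have hαc : α * c = K := div_mul_cancel₀ _ hc0.ne'
  have hLb : ∀ z, ∑ i, fderiv ℝ (fderiv ℝ (barrier α y)) z (P i z) (Q i z)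
      + fderiv ℝ (barrier α y) z (w z)
      = barrier α y z * (4 * α ^ 2 * g₁ z - 2 * α * g₂ z) := by
    intro z
    rw [(hasFDerivAt_barrier α y z).fderiv]
    simp only [hasFDerivAt_fderiv_barrier, g₁, g₂, _root_.smul_apply, innerSL_apply_apply,
      smul_eq_mul]
    rw [← Finset.mul_sum, Finset.sum_sub_distrib, ← Finset.mul_sum, ← Finset.mul_sum]
    ring
  have hev : ∀ᶠ z in 𝓝 p, z ∈ O ∧ 0 < ∑ i, fderiv ℝ (fderiv ℝ (barrier α y)) z (P i z) (Q i z)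
      + fderiv ℝ (barrier α y) z (w z) := by
    have hOp := hO.mem_nhds hp
    filter_upwards [hOp, (hg₁.continuousAt hOp).eventually (lt_mem_nhds (half_lt_self hpos)),
      (hg₂.continuousAt hOp).eventually (gt_mem_nhds
        (show g₂ p < K from lt_of_le_of_lt (le_abs_self _) (lt_add_one _)))] with z hz h1 h2
    refine ⟨hz, ?_⟩
    rw [hLb]
    refine mul_pos (Real.exp_pos _) ?_
    have h3 : α * K < α * (α * g₁ z) := by
      rw [← hαc]
      exact mul_lt_mul_of_pos_left (mul_lt_mul_of_pos_left h1 hα0) hα0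
    have h4 : α * g₂ z < α * K := mul_lt_mul_of_pos_left h2 hα0
    have h5 : 0 < α * K := mul_pos hα0 hK0
    nlinarith
  obtain ⟨δ, hδ, hball⟩ := Metric.nhds_basis_closedBall.eventually_iff.mp hev
  have hφp : barrier α y p = Real.exp (-α * ρ ^ 2) := by rw [barrier, hpy]
  let S := Metric.sphere p δ ∩ Metric.closedBall y ρ
  have hS : IsCompact S := (isCompact_sphere p δ).inter_right Metric.isClosed_closedBall
  have hSO : S ⊆ O := fun z hz => (hball (Metric.sphere_subset_closedBall hz.1)).1
  have hSp : ∀ z ∈ Metric.sphere p δ, z ≠ p := by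
    rintro z hz rfl
    simp at hz
    exact hδ.ne hz
  obtain ⟨ε, hε, hεS⟩ : ∃ ε : ℝ, 0 < ε ∧ ∀ z ∈ S, u z + ε < u p := by
    rcases S.eq_empty_or_nonempty with he | hne
    · exact ⟨1, one_pos, by simp [he]⟩
    · obtain ⟨z₁, hz₁, hz₁max⟩ := hS.exists_isMaxOn hne (hu.continuousOn.mono hSO)
      have h1 := hlt z₁ (hSO hz₁) hz₁.2 (hSp z₁ hz₁.1)
      refine ⟨(u p - u z₁) / 2, by linarith, fun z hz => ?_⟩
      have : u z ≤ u z₁ := hz₁max hz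
      linarith
  -- The perturbation vanishes at p. On the part of the small sphere inside the closed ball it is
  -- less than the gap ε, by compactness; outside the ball it is negative.
  let v : V → ℝ := fun z => u z + ε * (barrier α y z - Real.exp (-α * ρ ^ 2))
  have hvp : v p = u p := by simp [v, hφp]
  have hvS : ∀ z ∈ Metric.sphere p δ, v z < u p := by
    intro z hz
    by_cases hzy : z ∈ Metric.closedBall y ρ
    · have h1 := hεS z ⟨hz, hzy⟩
      have h2 : barrier α y z ≤ 1 := by
        rw [barrier, Real.exp_le_one_iff]
        have := mul_nonneg hα0.le (sq_nonneg ‖z - y‖)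
        linarith
      have h3 := mul_le_mul_of_nonneg_left
        (show barrier α y z - Real.exp (-α * ρ ^ 2) ≤ 1 by
          linarith [Real.exp_pos (-α * ρ ^ 2)]) hε.le
      simp only [v]
      linarith
    · have h1 : ρ < ‖z - y‖ := by simpa [dist_eq_norm] using hzy
      have h2 : barrier α y z < Real.exp (-α * ρ ^ 2) := by
        rw [barrier, Real.exp_lt_exp]
        have : ρ ^ 2 < ‖z - y‖ ^ 2 := by gcongr
        have := mul_lt_mul_of_pos_left this hα0
        linarith
      have h3 := hmax z (hball (Metric.sphere_subset_closedBall hz)).1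
      have h4 := mul_pos hε (sub_pos.mpr h2)
      simp only [v]
      linarith
  have hvC : ∀ z ∈ O, ContDiffAt ℝ 2 v z := fun z hz =>
    (hu.contDiffAt (hO.mem_nhds hz)).add
      (contDiffAt_const.mul ((contDiff_barrier α y).contDiffAt.sub contDiffAt_const))
  have hvcont : ContinuousOn v (Metric.closedBall p δ) := fun z hz =>
    (hvC z (hball hz).1).continuousAt.continuousWithinAt
  obtain ⟨q, hq, hqmax⟩ := (isCompact_closedBall p δ).exists_isMaxOn
    ⟨p, Metric.mem_closedBall_self hδ.le⟩ hvcont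
  have hqp : u p ≤ v q := hvp ▸ hqmax (Metric.mem_closedBall_self hδ.le)
  have hqball : q ∈ Metric.ball p δ := by
    refine lt_of_le_of_ne (Metric.mem_closedBall.mp hq) fun he => ?_
    exact absurd (hvS q he) (not_lt.mpr hqp)
  have hloc : IsLocalMax v q := by
    filter_upwards [Metric.isOpen_ball.mem_nhds hqball] with z hz
    exact hqmax (Metric.ball_subset_closedBall hz)
  obtain ⟨hqO, hqL⟩ := hball hq
  have hderiv : ∀ z ∈ O, fderiv ℝ v z = fderiv ℝ u z + ε • fderiv ℝ (barrier α y) z := by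
    intro z hz
    have h1 : HasFDerivAt u (fderiv ℝ u z) z :=
      ((hu.contDiffAt (hO.mem_nhds hz)).differentiableAt (by simp)).hasFDerivAt
    have h2 : HasFDerivAt (barrier α y) (fderiv ℝ (barrier α y) z) z :=
      ((contDiff_barrier α y).differentiable (by simp) z).hasFDerivAt
    exact (h1.add ((h2.sub_const _).const_mul ε)).fderiv
  have hderiv2 : fderiv ℝ (fderiv ℝ v) q
      = fderiv ℝ (fderiv ℝ u) q + ε • fderiv ℝ (fderiv ℝ (barrier α y)) q := by
    have he : fderiv ℝ v =ᶠ[𝓝 q] fun z => fderiv ℝ u z + ε • fderiv ℝ (barrier α y) z := by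
      filter_upwards [hO.mem_nhds hqO] with z hz using hderiv z hz
    have h1 : DifferentiableAt ℝ (fderiv ℝ u) q :=
      ((hu.contDiffAt (hO.mem_nhds hqO)).fderiv_right (m := 1)
        (by norm_num)).differentiableAt (by simp)
    have h2 : DifferentiableAt ℝ (fderiv ℝ (barrier α y)) q :=
      ((contDiff_barrier α y).contDiffAt.fderiv_right (m := 1)
        (by norm_num)).differentiableAt (by simp)
    rw [he.fderiv_eq]
    exact (h1.hasFDerivAt.add (h2.hasFDerivAt.const_smul ε)).fderiv
  have hD0 := hloc.fderiv_eq_zero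
  rw [hderiv q hqO] at hD0
  have hD0w := congrArg (fun l => l (w q)) hD0
  simp only [_root_.add_apply, _root_.smul_apply, smul_eq_mul, _root_.zero_apply] at hD0w
  have hle := (hell q hqO).sum_fderiv_nonpos (hvC q hqO) hloc
  rw [hderiv2] at hle
  simp only [_root_.add_apply, _root_.smul_apply, smul_eq_mul, Finset.sum_add_distrib,
    ← Finset.mul_sum] at hle
  have h1 := hsub q hqO
  have h2 := mul_pos hε hqL
  linarith

/-- The strong maximum principle of Hopf. -/
theorem eventually_eq_of_isMax {O : Set V} (hO : IsOpen O) {u : V → ℝ} (hu : ContDiffOn ℝ 2 u O)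
    {κ : Type*} [Fintype κ] {P Q : κ → V → V} {w : V → V}
    (hP : ∀ i, ContinuousOn (P i) O) (hQ : ∀ i, ContinuousOn (Q i) O) (hw : ContinuousOn w O)
    (hell : ∀ z ∈ O, IsElliptic (fun i => P i z) (fun i => Q i z))
    (hsub : ∀ z ∈ O, 0 ≤ ∑ i, fderiv ℝ (fderiv ℝ u) z (P i z) (Q i z) + fderiv ℝ u z (w z))
    [FiniteDimensional ℝ V] {z₀ : V} (hz₀ : z₀ ∈ O) (hmax : ∀ z ∈ O, u z ≤ u z₀) :
    ∀ᶠ z in 𝓝 z₀, u z = u z₀ := by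
  obtain ⟨r, hr, hrO⟩ := Metric.isOpen_iff.mp hO z₀ hz₀
  filter_upwards [Metric.ball_mem_nhds z₀ (half_pos hr)] with y hy
  by_contra hne
  rw [Metric.mem_ball] at hy
  have hsubO : Metric.closedBall y (r / 2) ⊆ O := fun z hz => hrO <| by
    rw [Metric.mem_closedBall] at hz
    rw [Metric.mem_ball]
    linarith [dist_triangle z y z₀]
  let A := Metric.closedBall y (r / 2) ∩ u ⁻¹' {u z₀}
  have hA : IsCompact A := by
    refine (isCompact_closedBall y (r / 2)).of_isClosed_subset ?_ inter_subset_left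
    exact (hu.continuousOn.mono hsubO).preimage_isClosed_of_isClosed Metric.isClosed_closedBall
      isClosed_singleton
  have hz₀A : z₀ ∈ A := ⟨by rw [Metric.mem_closedBall, dist_comm]; exact hy.le, rfl⟩
  obtain ⟨p, hpA, hpmin⟩ := hA.exists_isMinOn ⟨z₀, hz₀A⟩
    (continuous_id.dist continuous_const : Continuous fun z => dist z y).continuousOn
  have hup : u p = u z₀ := hpA.2
  have hR : 0 < dist p y := by
    rw [dist_pos]
    rintro rfl
    exact hne hup
  have hlt : ∀ z, dist z y < dist p y → u z < u p := by
    intro z hz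
    have hzb : z ∈ Metric.closedBall y (r / 2) := hz.le.trans hpA.1
    refine lt_of_le_of_ne (hup ▸ hmax z (hsubO hzb)) fun he => ?_
    have : dist p y ≤ dist z y := hpmin ⟨hzb, he.trans hup⟩
    linarith
  -- The ball about y reaching its nearest maximum point p may meet other maximum points on its
  -- boundary. The ball of half the radius, tangent to it from inside at p, meets none but p.
  refine barrier_comparison hO hu hP hQ hw hell hsub (p := p) (y := midpoint ℝ y p)
    (ρ := dist p y / 2) (hsubO hpA.1) (half_pos hR) ?_ ?_ (fun z hz => hup ▸ hmax z hz)
  · rw [← dist_eq_norm, dist_right_midpoint, dist_comm]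
    norm_num
    ring
  · intro z _ hz hzp
    refine hlt z ?_
    -- Apollonius: in the smaller ball |z - y|² + |z - p|² ≤ |p - y|², so z ≠ p lies strictly inside
    -- the larger one.
    have h1 := EuclideanGeometry.dist_sq_add_dist_sq_eq_two_mul_dist_midpoint_sq_add_half_dist_sq
      z y p
    have h2 : 0 < dist z p := dist_pos.mpr hzp
    rw [Metric.mem_closedBall] at hz
    have h3 : dist z (midpoint ℝ y p) ^ 2 ≤ (dist p y / 2) ^ 2 := by gcongr
    rw [dist_comm y p] at h1
    refine lt_of_pow_lt_pow_left₀ 2 hR.le ?_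
    nlinarith

end MaximumPrinciple

end GenKahler

end

noncomputable section

namespace GenKahler

set_option linter.unusedSectionVars false

/-! ### Transfer of the maximum principle to the manifold -/

section ManifoldMaximumPrinciple

open Topology Filter Set

variable {H : Type*} [NormedAddCommGroup H] [NormedSpace ℝ H] [FiniteDimensional ℝ H]
variable {M : Type*} [TopologicalSpace M] [ChartedSpace H M] [IsManifold 𝓘(ℝ, H) ∞ M]

/-- The trivialization of the tangent bundle at `x₀`, as a family of linear maps. -/
def tangentCoord (x₀ y : M) : Tan H y →L[ℝ] H :=
  (trivializationAt H (TangentSpace 𝓘(ℝ, H) : M → Type _) x₀).continuousLinearMapAt ℝ y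

theorem contMDiffOn_tangentCoord (x₀ : M) {X : (x : M) → Tan H x} (hX : SmoothVF X) :
    ContMDiffOn 𝓘(ℝ, H) 𝓘(ℝ, H) ∞ (fun y => tangentCoord x₀ y (X y)) (chartAt H x₀).source := by
  have h1 := ((trivializationAt H (TangentSpace 𝓘(ℝ, H) : M → Type _) x₀).contMDiffOn_section_iff
    (IB := 𝓘(ℝ, H)) (n := ∞) (s := X) (a := (chartAt H x₀).source) (chartAt H x₀).open_source
    (by simp)).mp (hX.contMDiffOn)
  refine h1.congr fun y hy => ?_
  exact congrFun ((trivializationAt H (TangentSpace 𝓘(ℝ, H) : M → Type _)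
    x₀).coe_linearMapAt_of_mem (R := ℝ) (by simpa using hy)) (X y)

/-- A frame of a trivialization and its coframe, multiplied by a bump function to become global
sections. The expansion holds only where the bump function is 1, which suffices as the argument is
local. -/
theorem exists_smooth_frame [T2Space M] (x₀ : M) :
    ∃ (X : Fin (Module.finrank ℝ H) → (x : M) → Tan H x)
      (θ : Fin (Module.finrank ℝ H) → (x : M) → Tan H x →L[ℝ] ℝ),
      (∀ j, SmoothVF (X j)) ∧ (∀ j, SmoothOneForm (θ j)) ∧
        ∀ᶠ y in 𝓝 x₀, ∀ v : Tan H y, ∑ j, θ j y v • X j y = v := by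
  let e := trivializationAt H (TangentSpace 𝓘(ℝ, H) : M → Type _) x₀
  have hbase : e.baseSet = (chartAt H x₀).source := by simp [e]
  let β := Module.finBasis ℝ H
  let χ : SmoothBumpFunction 𝓘(ℝ, H) x₀ :=
    Classical.choice inferInstance
  have hsupp : tsupport χ ⊆ e.baseSet := hbase ▸ χ.tsupport_subset_chartAt_source
  refine ⟨fun j => (χ : M → ℝ) • fun y => e.symmL ℝ y (β j),
    fun j y => χ y • ((β.coord j).toContinuousLinearMap ∘L tangentCoord x₀ y), fun j => ?_,
    fun j X hX => ?_, ?_⟩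
  · refine ContMDiffOn.smul_section_of_tsupport (χ.contMDiff.contMDiffOn) e.open_baseSet hsupp ?_
    rw [e.contMDiffOn_section_iff e.open_baseSet subset_rfl]
    refine (contMDiffOn_const (c := β j)).congr fun y hy => ?_
    rw [e.symmL_apply, e.apply_mk_symm hy]
    exact hy
  · refine contMDiff_of_tsupport fun y hy => ?_
    have hy1 : y ∈ tsupport χ := closure_mono (fun z hz => by
      contrapose hz
      simp only [Function.mem_support, not_not] at hz ⊢
      simp [hz]) hy
    have hy2 : y ∈ (chartAt H x₀).source := hbase ▸ hsupp hy1
    have h1 := ((contMDiffOn_tangentCoord x₀ hX) y hy2).contMDiffAt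
      ((chartAt H x₀).open_source.mem_nhds hy2)
    have h2 := ((β.coord j).toContinuousLinearMap.contMDiff (n := ∞)).contMDiffAt.comp y h1
    exact χ.contMDiffAt.mul h2
  · filter_upwards [χ.eventuallyEq_one, e.open_baseSet.mem_nhds
      (FiberBundle.mem_baseSet_trivializationAt' x₀)] with y hχ hy v
    have hχ' : χ y = 1 := hχ
    simp only [Pi.smul_apply', hχ', one_smul]
    have h1 := β.sum_repr (tangentCoord x₀ y v)
    have h2 := congrArg (e.symmL ℝ y) h1
    rw [map_sum] at h2
    simp only [map_smul] at h2
    refine Eq.trans ?_ (h2.trans (e.symmL_continuousLinearMapAt hy v))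
    rfl

/-- The inverse of the chart at `x₀`, on a Euclidean space. -/
def chartInv (x₀ : M) (z : EuclideanSpace ℝ (Fin (Module.finrank ℝ H))) : M :=
  (extChartAt 𝓘(ℝ, H) x₀).symm (toEuclidean.symm z)

/-- The domain of `chartInv x₀`. -/
def chartDom (x₀ : M) : Set (EuclideanSpace ℝ (Fin (Module.finrank ℝ H))) :=
  (toEuclidean (E := H)).symm ⁻¹' (extChartAt 𝓘(ℝ, H) x₀).target

/-- The vector field `X` in the chart at `x₀`. -/
def chartVF (x₀ : M) (X : (x : M) → Tan H x) (z : EuclideanSpace ℝ (Fin (Module.finrank ℝ H))) :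
    EuclideanSpace ℝ (Fin (Module.finrank ℝ H)) :=
  toEuclidean (tangentCoord x₀ (chartInv x₀ z) (X (chartInv x₀ z)))

theorem isOpen_chartDom (x₀ : M) : IsOpen (chartDom (H := H) x₀) :=
  (isOpen_extChartAt_target x₀).preimage (toEuclidean (E := H)).symm.continuous

theorem chartInv_mem_source (x₀ : M) {z : EuclideanSpace ℝ (Fin (Module.finrank ℝ H))}
    (hz : z ∈ chartDom (H := H) x₀) : chartInv x₀ z ∈ (chartAt H x₀).source := by
  rw [← extChartAt_source 𝓘(ℝ, H)]
  exact (extChartAt 𝓘(ℝ, H) x₀).map_target hz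

theorem contMDiffOn_chartInv (x₀ : M) :
    ContMDiffOn 𝓘(ℝ, EuclideanSpace ℝ (Fin (Module.finrank ℝ H))) 𝓘(ℝ, H) ∞
      (chartInv (H := H) x₀) (chartDom x₀) :=
  (contMDiffOn_extChartAt_symm x₀).comp
    (toEuclidean (E := H)).symm.toContinuousLinearMap.contMDiff.contMDiffOn (fun _ hz => hz)

theorem contDiffOn_comp_chartInv (x₀ : M) {f : M → ℝ} (hf : ContMDiff 𝓘(ℝ, H) 𝓘(ℝ, ℝ) ∞ f) :
    ContDiffOn ℝ ∞ (f ∘ chartInv (H := H) x₀) (chartDom x₀) :=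
  contMDiffOn_iff_contDiffOn.mp (hf.comp_contMDiffOn (contMDiffOn_chartInv x₀))

theorem contDiffOn_chartVF (x₀ : M) {X : (x : M) → Tan H x} (hX : SmoothVF X) :
    ContDiffOn ℝ ∞ (chartVF x₀ X) (chartDom x₀) := by
  have h1 := (contMDiffOn_tangentCoord x₀ hX).comp (contMDiffOn_chartInv x₀)
    (fun z hz => chartInv_mem_source x₀ hz)
  exact (toEuclidean (E := H)).contDiff.comp_contDiffOn (contMDiffOn_iff_contDiffOn.mp h1)

/-- The trivialization of the tangent bundle at x₀ is the differential of the chart at x₀, so this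
is the chain rule. -/
theorem mvfderiv_chartInv (x₀ : M) {f : M → ℝ} (X : (x : M) → Tan H x)
    {z : EuclideanSpace ℝ (Fin (Module.finrank ℝ H))} (hz : z ∈ chartDom (H := H) x₀)
    (hf : DifferentiableAt ℝ (f ∘ chartInv (H := H) x₀) z) :
    mvfderiv 𝓘(ℝ, H) f (chartInv x₀ z) (X (chartInv x₀ z))
      = fderiv ℝ (f ∘ chartInv x₀) z (chartVF x₀ X z) := by
  set y := chartInv x₀ z with hy
  have hys : y ∈ (chartAt H x₀).source := chartInv_mem_source x₀ hz
  let κ : M → EuclideanSpace ℝ (Fin (Module.finrank ℝ H)) :=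
    fun y => toEuclidean (extChartAt 𝓘(ℝ, H) x₀ y)
  have hκz : κ y = z := by
    simp only [κ, hy, chartInv]
    rw [(extChartAt 𝓘(ℝ, H) x₀).right_inv hz]
    exact (toEuclidean (E := H)).apply_symm_apply z
  have hc : MDifferentiableAt 𝓘(ℝ, H) 𝓘(ℝ, H) (extChartAt 𝓘(ℝ, H) x₀) y :=
    mdifferentiableAt_extChartAt hys
  have hκ : HasMFDerivAt 𝓘(ℝ, H) 𝓘(ℝ, EuclideanSpace ℝ (Fin (Module.finrank ℝ H))) κ y
      ((toEuclidean (E := H)).toContinuousLinearMap ∘L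
        mfderiv 𝓘(ℝ, H) 𝓘(ℝ, H) (extChartAt 𝓘(ℝ, H) x₀) y) :=
    HasMFDerivAt.comp y ((toEuclidean (E := H)).toContinuousLinearMap.hasFDerivAt.hasMFDerivAt)
      hc.hasMFDerivAt
  have hu : HasFDerivAt (f ∘ chartInv x₀) (fderiv ℝ (f ∘ chartInv x₀) z) (κ y) := by
    rw [hκz]
    exact hf.hasFDerivAt
  have hcomp := HasMFDerivAt.comp y hu.hasMFDerivAt hκ
  have he : (f ∘ chartInv x₀) ∘ κ =ᶠ[𝓝 y] f := by
    filter_upwards [(chartAt H x₀).open_source.mem_nhds hys] with w hw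
    simp only [Function.comp, κ, chartInv]
    rw [ContinuousLinearEquiv.symm_apply_apply, (extChartAt 𝓘(ℝ, H) x₀).left_inv (by simpa using hw)]
  have hm := (hcomp.congr_of_eventuallyEq he.symm).mfderiv
  have h1 : mvfderiv 𝓘(ℝ, H) f y (X y) = mfderiv 𝓘(ℝ, H) 𝓘(ℝ, ℝ) f y (X y) := rfl
  rw [h1, hm, chartVF, ← hy, tangentCoord,
    TangentBundle.continuousLinearMapAt_trivializationAt hys]
  rfl

/-- The product rule: differentiating the coefficients of Q costs only a first-order term, so the
principal part is the Euclidean Hessian. -/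
theorem mvfderiv_mvfderiv_chartInv (x₀ : M) {f : M → ℝ} (hf : ContMDiff 𝓘(ℝ, H) 𝓘(ℝ, ℝ) ∞ f)
    (P : (x : M) → Tan H x) {Q : (x : M) → Tan H x} (hQ : SmoothVF Q)
    {z : EuclideanSpace ℝ (Fin (Module.finrank ℝ H))} (hz : z ∈ chartDom (H := H) x₀) :
    mvfderiv 𝓘(ℝ, H) (fun y => mvfderiv 𝓘(ℝ, H) f y (Q y)) (chartInv x₀ z) (P (chartInv x₀ z))
      = fderiv ℝ (fderiv ℝ (f ∘ chartInv x₀)) z (chartVF x₀ P z) (chartVF x₀ Q z)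
        + fderiv ℝ (f ∘ chartInv x₀) z (fderiv ℝ (chartVF x₀ Q) z (chartVF x₀ P z)) := by
  have hO := (isOpen_chartDom (H := H) x₀).mem_nhds hz
  have h0 : ∀ w ∈ chartDom (H := H) x₀, DifferentiableAt ℝ (f ∘ chartInv (H := H) x₀) w :=
    fun w hw => ((contDiffOn_comp_chartInv x₀ hf).contDiffAt
      ((isOpen_chartDom x₀).mem_nhds hw)).differentiableAt (by simp)
  have he : (fun y => mvfderiv 𝓘(ℝ, H) f y (Q y)) ∘ chartInv x₀ =ᶠ[𝓝 z]
      fun z => fderiv ℝ (f ∘ chartInv x₀) z (chartVF x₀ Q z) := by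
    filter_upwards [hO] with w hw using mvfderiv_chartInv x₀ Q hw (h0 w hw)
  have h1 : DifferentiableAt ℝ (fderiv ℝ (f ∘ chartInv (H := H) x₀)) z :=
    (((contDiffOn_comp_chartInv x₀ hf).contDiffAt hO).fderiv_right (m := ∞)
      (by simp)).differentiableAt (by simp)
  have h2 : DifferentiableAt ℝ (chartVF x₀ Q) z :=
    ((contDiffOn_chartVF x₀ hQ).contDiffAt hO).differentiableAt (by simp)
  have h3 := h1.hasFDerivAt.clm_apply h2.hasFDerivAt
  rw [mvfderiv_chartInv x₀ P hz (he.differentiableAt_iff.mpr h3.differentiableAt),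
    he.fderiv_eq, h3.fderiv]
  simp [add_comm]

/-- The strong maximum principle on a manifold. -/
theorem eventually_eq_of_isLocalMax {f : M → ℝ} (hf : ContMDiff 𝓘(ℝ, H) 𝓘(ℝ, ℝ) ∞ f)
    {κ ι : Type*} [Fintype κ] [Fintype ι] {P Q : κ → (x : M) → Tan H x}
    {Z : ι → (x : M) → Tan H x} (hP : ∀ i, SmoothVF (P i)) (hQ : ∀ i, SmoothVF (Q i))
    (hZ : ∀ j, SmoothVF (Z j)) {x₀ : M} (hmax : IsLocalMax f x₀)
    (hell : ∀ᶠ x in 𝓝 x₀, IsElliptic (fun i => P i x) (fun i => Q i x))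
    (hsub : ∀ᶠ x in 𝓝 x₀,
      0 ≤ ∑ i, mvfderiv 𝓘(ℝ, H) (fun y => mvfderiv 𝓘(ℝ, H) f y (Q i y)) x (P i x)
        + ∑ j, mvfderiv 𝓘(ℝ, H) f x (Z j x)) :
    ∀ᶠ x in 𝓝 x₀, f x = f x₀ := by
  obtain ⟨U, hU, hUo, hxU⟩ := eventually_nhds_iff.mp (hmax.and (hell.and hsub))
  set z₀ : EuclideanSpace ℝ (Fin (Module.finrank ℝ H)) :=
    toEuclidean (extChartAt 𝓘(ℝ, H) x₀ x₀) with hz₀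
  have hz₀D : z₀ ∈ chartDom (H := H) x₀ := by simp [z₀, chartDom]
  have hinv : chartInv (H := H) x₀ z₀ = x₀ := by simp [z₀, chartInv]
  have hcont := (contMDiffOn_chartInv (H := H) x₀).continuousOn
  set O := chartDom (H := H) x₀ ∩ chartInv (H := H) x₀ ⁻¹' U with hOdef
  have hO : IsOpen O := hcont.isOpen_inter_preimage (isOpen_chartDom x₀) hUo
  have hu := contDiffOn_comp_chartInv (H := H) x₀ hf
  have hODom : O ⊆ chartDom (H := H) x₀ := inter_subset_left
  have hc : ∀ {X : (x : M) → Tan H x}, SmoothVF X → ContinuousOn (chartVF x₀ X) O :=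
    fun hX => (contDiffOn_chartVF x₀ hX).continuousOn.mono hODom
  have key := eventually_eq_of_isMax hO (u := f ∘ chartInv (H := H) x₀)
    ((hu.of_le ENat.LEInfty.out).mono hODom)
    (P := fun i => chartVF x₀ (P i)) (Q := fun i => chartVF x₀ (Q i))
    -- The drift collects the derivatives of the Q i together with the fields Z j.
    (w := fun z => ∑ i, fderiv ℝ (chartVF x₀ (Q i)) z (chartVF x₀ (P i) z)
      + ∑ j, chartVF x₀ (Z j) z)
    (fun i => hc (hP i)) (fun i => hc (hQ i)) ?_ ?_ ?_ (z₀ := z₀) ⟨hz₀D, by simpa [hinv] using hxU⟩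
    ?_
  · have h1 : ContinuousAt (fun y => (toEuclidean (E := H)) (extChartAt 𝓘(ℝ, H) x₀ y)) x₀ :=
      (toEuclidean (E := H)).continuous.continuousAt.comp (continuousAt_extChartAt x₀)
    filter_upwards [h1.eventually key, extChartAt_source_mem_nhds (I := 𝓘(ℝ, H)) x₀] with y hy hys
    have h2 : chartInv (H := H) x₀ (toEuclidean (extChartAt 𝓘(ℝ, H) x₀ y)) = y := by
      rw [chartInv, ContinuousLinearEquiv.symm_apply_apply, (extChartAt 𝓘(ℝ, H) x₀).left_inv hys]
    simpa only [Function.comp, h2, hinv] using hy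
  · refine (continuousOn_finsetSum _ fun i _ => ?_).add
      (continuousOn_finsetSum _ fun j _ => hc (hZ j))
    exact (((contDiffOn_chartVF x₀ (hQ i)).mono hODom).continuousOn_fderiv_of_isOpen hO
      (by simp)).clm_apply (hc (hP i))
  · intro z hz
    have h1 := ((hU _ hz.2).2.1).map
      ((toEuclidean (E := H)).toLinearEquiv.toLinearMap ∘ₗ
        (tangentCoord x₀ (chartInv (H := H) x₀ z)).toLinearMap) ?_
    · exact h1
    · refine (toEuclidean (E := H)).surjective.comp fun v => ?_
      exact ⟨_, Bundle.Trivialization.continuousLinearMapAt_symmL _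
        (by simpa using chartInv_mem_source x₀ hz.1) v⟩
  · intro z hz
    have h1 := (hU _ hz.2).2.2
    have hd : DifferentiableAt ℝ (f ∘ chartInv (H := H) x₀) z :=
      (hu.contDiffAt ((isOpen_chartDom x₀).mem_nhds hz.1)).differentiableAt (by simp)
    simp only [mvfderiv_mvfderiv_chartInv x₀ hf _ (hQ _) hz.1,
      mvfderiv_chartInv x₀ _ hz.1 hd, Finset.sum_add_distrib] at h1
    rw [map_add, map_sum, map_sum, ← add_assoc]
    exact h1
  · intro z hz
    simpa [hinv] using (hU _ hz.2).1

end ManifoldMaximumPrinciple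

end GenKahler

end

noncomputable section

namespace GenKahler

set_option linter.unusedSectionVars false

/-! ### Local constancy of |s|² -/

section Vanishing

open Topology Filter Set

variable {H : Type*} [NormedAddCommGroup H] [NormedSpace ℝ H] [FiniteDimensional ℝ H]
variable {M : Type*} [TopologicalSpace M] [T2Space M] [ChartedSpace H M] [IsManifold 𝓘(ℝ, H) ∞ M]
variable {F : Type*} [NormedAddCommGroup F] [NormedSpace ℂ F]
variable {E : M → Type*} [∀ x, AddCommGroup (E x)] [∀ x, Module ℂ (E x)]
  [∀ x, TopologicalSpace (E x)] [TopologicalSpace (Bundle.TotalSpace F E)] [FiberBundle F E]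
variable {J Jψ : (x : M) → GenTangent (Tan H x) →ₗ[ℝ] GenTangent (Tan H x)}
  {b Ω : (x : M) → Tan H x [⋀^Fin 2]→L[ℝ] ℝ}
  {D : GenConnection H F E} {h : HermitianMetric H F E}

theorem normSq_nonneg (s : (x : M) → E x) (x : M) : 0 ≤ normSq h s x := by
  by_cases hs : s x = 0
  · simp [normSq, reForm, hs]
  · exact (h.pos x _ hs).le

theorem eventually_normSq_eq (hb : SmoothTwoForm b) (hΩ : IsSymplectic Ω)
    (hJψ : IsInducedBy Jψ (psi b Ω)) (hGK : IsGenKahler J Jψ)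
    (hD : IsHermitianConnection h D) {lam : ℝ} (hEH : IsEinsteinHermitian h D (psi b Ω) lam)
    (hlam : lam ≤ 0) {s : (x : M) → E x} (hs : SmoothSection H F s)
    (hs01 : ∀ x, D01 J D s x = 0) {x₀ : M} (hmax : IsLocalMax (normSq h s) x₀) :
    ∀ᶠ x in 𝓝 x₀, normSq h s x = normSq h s x₀ := by
  obtain ⟨X, θ, hX, hθ, hfr⟩ := exists_smooth_frame (H := H) x₀
  obtain ⟨P, Q, Z, hP, hQ, hZ, hB⟩ := bochner_elliptic hb hΩ hJψ hGK hD hEH hs hs01 hX hθ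
  refine eventually_eq_of_isLocalMax (contMDiff_reForm h hs hs) hP hQ hZ hmax ?_ ?_
  · filter_upwards [hfr] with x hx using (hB x hx).2
  · filter_upwards [hfr] with x hx
    obtain ⟨S, hS, -, he⟩ := (hB x hx).1
    refine le_of_le_of_eq ?_ he.symm
    have := mul_nonneg (neg_nonneg.mpr hlam) (normSq_nonneg (h := h) s x)
    linarith

/-- With all derivatives of |s|² zero, the Bochner equation reads 0 = -8λ|s|² + S. Both summands are
nonnegative, and S = 0 forces 𝒟s = 0. -/
theorem eq_zero_of_eventually_normSq_eq (hb : SmoothTwoForm b) (hΩ : IsSymplectic Ω)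
    (hJψ : IsInducedBy Jψ (psi b Ω)) (hGK : IsGenKahler J Jψ)
    (hD : IsHermitianConnection h D) {lam : ℝ} (hEH : IsEinsteinHermitian h D (psi b Ω) lam)
    (hlam : lam ≤ 0) {s : (x : M) → E x} (hs : SmoothSection H F s)
    (hs01 : ∀ x, D01 J D s x = 0) {x₀ : M} {m : ℝ} (hm : ∀ᶠ x in 𝓝 x₀, normSq h s x = m) :
    lam * normSq h s x₀ = 0 ∧ D.toFun s x₀ = 0 := by
  obtain ⟨X, θ, hX, hθ, hfr⟩ := exists_smooth_frame (H := H) x₀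
  obtain ⟨P, Q, Z, -, -, -, hB⟩ := bochner_elliptic hb hΩ hJψ hGK hD hEH hs hs01 hX hθ
  obtain ⟨S, hS, hS0, he⟩ := (hB x₀ hfr.self_of_nhds).1
  have h1 : ∀ᶠ x in 𝓝 x₀, mvfderiv 𝓘(ℝ, H) (normSq h s) x = 0 := by
    filter_upwards [hm.eventually_nhds] with x hx
    have h2 : normSq h s =ᶠ[𝓝 x] fun _ => m := hx
    change mfderiv 𝓘(ℝ, H) 𝓘(ℝ, ℝ) (normSq h s) x = 0
    rw [h2.mfderiv_eq, mfderiv_const]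
    rfl
  have h3 : ∀ i, mvfderiv 𝓘(ℝ, H) (fun y => mvfderiv 𝓘(ℝ, H) (normSq h s) y (Q i y)) x₀ = 0 := by
    intro i
    have h2 : (fun y => mvfderiv 𝓘(ℝ, H) (normSq h s) y (Q i y)) =ᶠ[𝓝 x₀] fun _ => (0 : ℝ) := by
      filter_upwards [h1] with y hy
      rw [hy]; rfl
    change mfderiv 𝓘(ℝ, H) 𝓘(ℝ, ℝ) (fun y => mvfderiv 𝓘(ℝ, H) (normSq h s) y (Q i y)) x₀ = 0
    rw [h2.mfderiv_eq, mfderiv_const]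
    rfl
  simp only [h3, h1.self_of_nhds, _root_.zero_apply, Finset.sum_const_zero, add_zero] at he
  have h4 := mul_nonneg (neg_nonneg.mpr hlam) (normSq_nonneg (h := h) s x₀)
  exact ⟨by linarith, hS0 (by linarith)⟩

/-- If `𝒟⁰¹ s = 0` and `λ ≤ 0`, then `|s|²` is locally constant. -/
theorem eventually_normSq_eq_const [CompactSpace M] (hb : SmoothTwoForm b) (hΩ : IsSymplectic Ω)
    (hJψ : IsInducedBy Jψ (psi b Ω)) (hGK : IsGenKahler J Jψ)
    (hD : IsHermitianConnection h D) {lam : ℝ} (hEH : IsEinsteinHermitian h D (psi b Ω) lam)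
    (hlam : lam ≤ 0) {s : (x : M) → E x} (hs : SmoothSection H F s)
    (hs01 : ∀ x, D01 J D s x = 0) (x : M) :
    ∃ m, ∀ᶠ y in 𝓝 x, normSq h s y = m := by
  have hf : Continuous (normSq h s) := (contMDiff_reForm h hs hs).continuous
  have : LocallyConnectedSpace M := ChartedSpace.locallyConnectedSpace H M
  let C := connectedComponent x
  have hCo : IsOpen C := isOpen_connectedComponent
  obtain ⟨x₁, hx₁, hmax⟩ := (isClosed_connectedComponent (x := x)).isCompact.exists_isMaxOn
    ⟨x, mem_connectedComponent⟩ hf.continuousOn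
  refine ⟨normSq h s x₁, ?_⟩
  -- The maximum set in the component is closed by continuity and open by the strong maximum
  -- principle. Each component is treated separately, as M need not be connected.
  let A := C ∩ normSq h s ⁻¹' {normSq h s x₁}
  have hAo : IsOpen A := by
    rw [isOpen_iff_mem_nhds]
    rintro y ⟨hyC, hy⟩
    have hy' : normSq h s y = normSq h s x₁ := hy
    have hloc : IsLocalMax (normSq h s) y := by
      filter_upwards [hCo.mem_nhds hyC] with z hz
      rw [hy']
      exact hmax hz
    filter_upwards [hCo.mem_nhds hyC,
      eventually_normSq_eq hb hΩ hJψ hGK hD hEH hlam hs hs01 hloc] with z hz hzy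
    exact ⟨hz, hzy.trans hy'⟩
  have hAc : IsClosed A := isClosed_connectedComponent.inter (isClosed_singleton.preimage hf)
  have hCA : C ⊆ A :=
    isPreconnected_connectedComponent.subset_isClopen ⟨hAc, hAo⟩ ⟨x₁, hx₁, hx₁, rfl⟩
  filter_upwards [hCo.mem_nhds mem_connectedComponent] with y hy using (hCA hy).2

end Vanishing

end GenKahler

end

/-! ### The vanishing theorem -/

theorem mainTheorem5
    {H : Type*} [NormedAddCommGroup H] [NormedSpace ℝ H] [FiniteDimensional ℝ H]
    {M : Type*} [TopologicalSpace M] [T2Space M] [CompactSpace M] [ChartedSpace H M]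
    [IsManifold 𝓘(ℝ, H) ∞ M]
    {F : Type*} [NormedAddCommGroup F] [NormedSpace ℂ F] [FiniteDimensional ℂ F]
    {E : M → Type*} [∀ x, AddCommGroup (E x)] [∀ x, Module ℂ (E x)]
    [∀ x, TopologicalSpace (E x)] [TopologicalSpace (Bundle.TotalSpace F E)]
    [FiberBundle F E] [VectorBundle ℂ F E] [VectorBundle ℝ F E]
    [ContMDiffVectorBundle ∞ F E 𝓘(ℝ, H)]
    (J Jψ : (x : M) → GenKahler.GenTangent (GenKahler.Tan H x) →ₗ[ℝ]
      GenKahler.GenTangent (GenKahler.Tan H x))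
    (b Ω : (x : M) → GenKahler.Tan H x [⋀^Fin 2]→L[ℝ] ℝ)
    (hb : GenKahler.IsClosedTwoForm b) (hΩ : GenKahler.IsSymplectic Ω)
    (hJψ : GenKahler.IsInducedBy Jψ (GenKahler.psi b Ω))
    (hGK : GenKahler.IsGenKahler J Jψ)
    (h : GenKahler.HermitianMetric H F E) (D : GenKahler.GenConnection H F E)
    (hD : GenKahler.IsHermitianConnection h D)
    (hD01 : GenKahler.IsIntegrable01 J D)
    (lam : ℝ) (hEH : GenKahler.IsEinsteinHermitian h D (GenKahler.psi b Ω) lam) :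
    (lam < 0 → ∀ s : (x : M) → E x, GenKahler.SmoothSection H F s →
      (∀ x, GenKahler.D01 J D s x = 0) → ∀ x, s x = 0) ∧
    (lam = 0 → ∀ s : (x : M) → E x, GenKahler.SmoothSection H F s →
      (∀ x, GenKahler.D01 J D s x = 0) → ∀ x, D.toFun s x = 0) := by
  have key := fun hlam s (hs : GenKahler.SmoothSection H F s) h01 x =>
    (GenKahler.eventually_normSq_eq_const hb.smooth hΩ hJψ hGK hD hEH hlam hs h01 x).elim
      fun _ hm =>
        GenKahler.eq_zero_of_eventually_normSq_eq hb.smooth hΩ hJψ hGK hD hEH hlam hs h01 hm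
  refine ⟨fun hlam s hs h01 x => ?_, fun hlam s hs h01 x => (key hlam.le s hs h01 x).2⟩
  by_contra hne
  have h1 : 0 < GenKahler.normSq h s x := h.pos x _ hne
  exact mul_ne_zero hlam.ne h1.ne' (key hlam.le s hs h01 x).1
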